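/- Let $d\ge 2$ be an integer and $s>0$. Put $\phi_s(r)=\sqrt{s^2+r^2}$, $D=\sqrt{-\Delta_x}$ on $\mathbb R^d$ (the Fourier multiplier with symbol $|\xi|$), and let $e^{it\phi_s(D)}$ be the Klein--Gordon propagator on $L^2(\mathbb R^d)$, the Fourier multiplier with symbol $e^{it\phi_s(|\xi|)}$. For $\beta\in\mathbb R$ let $|\square|^\beta$ be the space-time Fourier multiplier with symbol $\big|\tau^2-|\xi|^2\big|^\beta$, where $\square=\partial_t^2-\Delta_x$. For $\alpha\ge0$ let $H^\alpha(\mathbb R^d)=\{f\in L^2(\mathbb R^d;\mathbb C):\phi_s(D)^\alpha f\in L^2(\mathbb R^d)\}$. Define $$\mathbf F(\beta,d)=2^{d-3+4\beta}\,\pi^{-\frac d2}\,\frac{\Gamma(\frac d2)\,\Gamma(\frac{d-1}{2}+2\beta)}{(d-2+2\beta)\,\Gamma(\frac{3d-5}{2}+2\beta)} .$$ (1) For $(\alpha,\beta)=(\tfrac12,\tfrac{3-d}{4})$ and for $(\alpha,\beta)=(1,\tfrac{5-d}{4})$ the estimate $$\big\||\square|^\beta|e^{it\phi_s(D)}f|^2\big\|_{L^2(\mathbb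 R^{d+1})}\le C\,\|\phi_s(D)^\alpha f\|_{L^2(\mathbb R^d)}^2\qquad(f\in H^\alpha(\mathbb R^d))$$ holds with $C=\mathbf F(\beta,d)^{1/2}$. This constant is optimal (the estimate fails for every smaller $C\geq 0$), and there are no extremisers: no non-zero $f\in H^\alpha(\mathbb R^d)$ attains equality with $C=\mathbf F(\beta,d)^{1/2}$. (2) For $\beta=\tfrac{5-d}{4}$ the refined estimate $$\big\||\square|^{\frac{5-d}{4}}|e^{it\phi_s(D)}f|^2\big\|_{L^2(\mathbb R^{d+1})}\le C\,\Big(\|\phi_s(D)f\|_{L^2(\mathbb R^d)}^4-s^2\|\phi_s(D)^{\frac12}f\|_{L^2(\mathbb R^d)}^4\Big)^{\frac12}\qquad(f\in H^1(\mathbb R^d))$$ holds with $C=\mathbf F(\tfrac{5-d}{4},d)^{1/2}$. This constant is again optimal, and no non-zero $f\in H^1(\mathbb R^d)$ attains equality with it. -/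

import Mathlib

open MeasureTheory FourierTransform
open scoped SchwartzMap ENNReal

namespace KleinGordon

noncomputable section

/-- Euclidean space `ℝ^d`. -/
abbrev Space (d : ℕ) : Type := EuclideanSpace ℝ (Fin d)

/-- Space-time `ℝ × ℝ^d` with its Euclidean structure; the first component is the time
(or, on the Fourier side, the time frequency). -/
abbrev SpaceTime (d : ℕ) : Type := WithLp 2 (ℝ × Space d)

/-- Complex-valued `L²(ℝ^d)`. -/
abbrev L2 (d : ℕ) : Type := Lp ℂ 2 (volume : Measure (Space d))

/-- `φ_s(r) = √(s² + r²)`. -/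
def phi (s r : ℝ) : ℝ := Real.sqrt (s ^ 2 + r ^ 2)

/-- The symbol of `φ_s(D)`, `D = √(-Δ)`. Mathlib's Fourier transform has the kernel
`exp (-2πi ⟨x, ξ⟩)`, so that `D` is multiplication by `2π‖ξ‖` on the Fourier side. -/
def phiSymbol {d : ℕ} (s : ℝ) (ξ : Space d) : ℝ := phi s (2 * Real.pi * ‖ξ‖)

/-- `f` is in the `L²` domain of the Fourier multiplier operator with symbol `m`. -/
abbrev InDomain {d : ℕ} (m : Space d → ℂ) (f : L2 d) : Prop :=
  MemLp (fun ξ : Space d => m ξ * (𝓕 f : L2 d) ξ) 2 volume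

open Classical in
/-- The Fourier multiplier operator `f ↦ 𝓕⁻¹ (m · 𝓕 f)` on its domain in `L²(ℝ^d)`
(extended by `0` off the domain). -/
def fourierMul {d : ℕ} (m : Space d → ℂ) (f : L2 d) : L2 d :=
  if h : InDomain m f then 𝓕⁻ (MemLp.toLp _ h : L2 d) else 0

/-- The symbol of `φ_s(D)^α`. -/
def phiPowSymbol {d : ℕ} (s α : ℝ) (ξ : Space d) : ℂ := ((phiSymbol s ξ ^ α : ℝ) : ℂ)

/-- For `α ≥ 0` and `s > 0`: the Sobolev space `H^α(ℝ^d)`, as the set of `f ∈ L²(ℝ^d)` with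
`φ_s(D)^α f ∈ L²(ℝ^d)`. -/
def Sobolev (d : ℕ) (s α : ℝ) : Set (L2 d) := {f | InDomain (phiPowSymbol s α) f}

/-- The operator `φ_s(D)^α`. -/
def phiDPow {d : ℕ} (s α : ℝ) (f : L2 d) : L2 d := fourierMul (phiPowSymbol s α) f

/-- The Klein--Gordon propagator `e^{itφ_s(D)}` on `L²(ℝ^d)`. -/
def propagator {d : ℕ} (s t : ℝ) (f : L2 d) : L2 d :=
  fourierMul (fun ξ => Complex.exp (Complex.I * ((t * phiSymbol s ξ : ℝ) : ℂ))) f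

/-- The pairing of the space-time distribution `|e^{itφ_s(D)} f|²` with a Schwartz function. -/
def modSqPairing {d : ℕ} (s : ℝ) (f : L2 d) (ψ : 𝓢(SpaceTime d, ℂ)) : ℂ :=
  ∫ t : ℝ, ∫ x : Space d, ((‖propagator s t f x‖ ^ 2 : ℝ) : ℂ) * ψ (WithLp.toLp 2 (t, x))

/-- The locally integrable function `g` is the space-time Fourier transform of the tempered
distribution `|e^{itφ_s(D)} f|²`. Such a `g` is unique up to null sets. -/
def IsFourierOfModSq {d : ℕ} (s : ℝ) (f : L2 d) (g : SpaceTime d → ℂ) : Prop :=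
  LocallyIntegrable g volume ∧
    ∀ ψ : 𝓢(SpaceTime d, ℂ), modSqPairing s f (𝓕 ψ) = ∫ z : SpaceTime d, g z * ψ z

/-- The symbol of `|□|^β`, `□ = ∂_t² - Δ_x`: with frequencies in Mathlib's normalisation,
`|(2πτ)² - (2π‖ξ‖)²|^β`. -/
def boxPowSymbol {d : ℕ} (β : ℝ) (z : SpaceTime d) : ℝ :=
  |(2 * Real.pi * z.fst) ^ 2 - (2 * Real.pi * ‖z.snd‖) ^ 2| ^ β

/-- `‖ |□|^β |e^{itφ_s(D)} f|² ‖_{L²(ℝ^{d+1})}`, as the `L²` norm on the Fourier side (Mathlib's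
Fourier transform is unitary). The infimum is over the representatives of one function, the
space-time Fourier transform of `|e^{itφ_s(D)} f|²`, and all of them give the same value. -/
def nullFormNorm {d : ℕ} (s β : ℝ) (f : L2 d) : ℝ≥0∞ :=
  ⨅ (g : SpaceTime d → ℂ) (_ : IsFourierOfModSq s f g),
    eLpNorm (fun z : SpaceTime d => ((boxPowSymbol β z : ℝ) : ℂ) * g z) 2 volume

/-- The constant `𝐅(β, d)`. -/
def constF (β : ℝ) (d : ℕ) : ℝ :=
  (2 : ℝ) ^ ((d : ℝ) - 3 + 4 * β) * Real.pi ^ (-((d : ℝ) / 2)) *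
    (Real.Gamma ((d : ℝ) / 2) * Real.Gamma (((d : ℝ) - 1) / 2 + 2 * β)) /
    (((d : ℝ) - 2 + 2 * β) * Real.Gamma ((3 * (d : ℝ) - 5) / 2 + 2 * β))

/-- For a functional `R` on `X ⊆ L²(ℝ^d)`: `C` is the optimal constant in
`‖ |□|^β |e^{itφ_s(D)} f|² ‖_{L²(ℝ^{d+1})} ≤ C R(f)`, `f ∈ X`. -/
def IsOptimalConst {d : ℕ} (s β : ℝ) (X : Set (L2 d)) (R : L2 d → ℝ) (C : ℝ) : Prop :=
  IsLeast {K : ℝ | 0 ≤ K ∧ ∀ f ∈ X, nullFormNorm s β f ≤ ENNReal.ofReal (K * R f)} C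

/-- No non-zero `f ∈ X` attains equality in
`‖ |□|^β |e^{itφ_s(D)} f|² ‖_{L²(ℝ^{d+1})} ≤ C R(f)`. -/
def NoExtremiser {d : ℕ} (s β : ℝ) (X : Set (L2 d)) (R : L2 d → ℝ) (C : ℝ) : Prop :=
  ∀ f ∈ X, f ≠ 0 → nullFormNorm s β f ≠ ENNReal.ofReal (C * R f)

/-- `‖φ_s(D)^α f‖²_{L²(ℝ^d)}`. -/
def sobolevSq {d : ℕ} (s α : ℝ) (f : L2 d) : ℝ := ‖phiDPow s α f‖ ^ 2

/-- `(‖φ_s(D) f‖⁴ - s² ‖φ_s(D)^{1/2} f‖⁴)^{1/2}`. For `f ∈ H¹(ℝ^d)` the difference is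
nonnegative, since `s φ_s ≤ φ_s²`. -/
def refinedRhs {d : ℕ} (s : ℝ) (f : L2 d) : ℝ :=
  Real.sqrt (‖phiDPow s 1 f‖ ^ 4 - s ^ 2 * ‖phiDPow s (1 / 2) f‖ ^ 4)

end

end KleinGordon

/-! Put σ = s/2π, φ = `energy σ`, F = 𝓕f, d = n + 1 and b = 2β. The space-time Fourier transform of
|e^{itφ_s(D)}f|² at (τ, ξ) is the integral of F(y₁) conj F(y₂) over the pairs with y₁ - y₂ = ξ and
φ(y₁) - φ(y₂) = τ. These pairs exist only for |τ| < ‖ξ‖ (`spaceTimeFourier`, `modSqPairing_fourier`,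
`nullFormNorm_eq`). The square of the null form norm is therefore a quadrilinear integral over
resonant quadruples, those with y₁ + y₄ = y₂ + y₃ and φ(y₁) + φ(y₄) = φ(y₂) + φ(y₃).

The weighted inequality 2|F₁F₂F₃F₄| ≤ |F₁F₄|² φ₁φ₄/(φ₂φ₃) + |F₂F₃|² φ₂φ₃/(φ₁φ₄) decouples the
quadruple (`two_mul_le_quadWeight`). By symmetry what remains is |F₁|²|F₄|² φ₁φ₄ integrated against
a kernel K(y₁, y₄), the integral over y₂, y₃ of (φ₂φ₃)⁻¹ times the symbol of the null form. To
isolate K, the quadruples must be parametrised by (y₁, y₄) instead of (y₁, y₂). `hypInt_eq_ellInt`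
proves that the two parametrisations give the same measure: they agree for almost every energy
defect c by Tonelli, and at c = 0 by continuity.

A Lorentz boost to the centre of mass frame turns K into the integral of (1 - ω·ω')^b over a sphere,
which Gamma functions evaluate (`lintegral_sphere`, `ellInt_bilinear`). The outcome is K = const ·
r^k/√(σ² + r²), where r is the centre of mass momentum and k = 1 or 3 for the two values of β
(`kernel_eq`). Now r < √(σ² + r²). For k = 1 this leaves the square of the H^{1/2} norm squared. For
k = 3 it leaves r² = (φ₁φ₄ - y₁·y₄ - σ²)/2, whose cross term integrates to minus a square, and the
refined bound follows. The inequality for r is strict, so nothing non-zero attains equality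
(`sharpForm_lt`).

For optimality take F = e^{-aφ}/φ. By conservation of energy it gives equality in the weighted
inequality (`quadIntegrand_testFn`). Rescaling replaces σ by aσ, and as a → 0 the ratio r/√(σ² + r²)
tends to 1, so the constant is approached (`constF_le_sq_of_bound`). -/

namespace KleinGordon

noncomputable section

/-! ### One-dimensional substitutions -/

/-- In the coordinates `(τ, v)` on the level sets of `q ↦ ϕ(q + ξ/2) - ϕ(q - ξ/2)`, the component of
`q` along `ξ` is `τ * hypS ‖ξ‖ (σ² + ‖v‖²) τ`. -/
def hypS (a b τ : ℝ) : ℝ := Real.sqrt (b / (a ^ 2 - τ ^ 2) + 1 / 4)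

/-- The derivative of `τ ↦ τ * hypS a b τ`. -/
def hypJ (a b τ : ℝ) : ℝ := (b * a ^ 2 / (a ^ 2 - τ ^ 2) ^ 2 + 1 / 4) / hypS a b τ

/-- In the coordinates adapted to the level sets of `q ↦ ϕ(P/2 + q) + ϕ(P/2 - q)`, the component of
`q` along `P` is `k * ellT ‖P‖ (σ² + ‖v‖²) k`. -/
def ellT (a b k : ℝ) : ℝ := Real.sqrt (1 + a ^ 2 / (4 * (b + k ^ 2)))

/-- The derivative of `k ↦ k * ellT a b k`. -/
def ellJ (a b k : ℝ) : ℝ := (1 + a ^ 2 * b / (4 * (b + k ^ 2) ^ 2)) / ellT a b k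

lemma sq_sub_sq_pos {a τ : ℝ} (h : |τ| < a) : 0 < a ^ 2 - τ ^ 2 := by
  have := sq_lt_sq' (abs_lt.1 h).1 (abs_lt.1 h).2
  linarith

lemma hypS_sq {a b τ : ℝ} (hb : 0 < b) (h : |τ| < a) :
    hypS a b τ ^ 2 = b / (a ^ 2 - τ ^ 2) + 1 / 4 := by
  have := sq_sub_sq_pos h
  rw [hypS, Real.sq_sqrt (by positivity)]

lemma hypS_pos {a b τ : ℝ} (hb : 0 < b) (h : |τ| < a) : 0 < hypS a b τ := by
  have := sq_sub_sq_pos h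
  exact Real.sqrt_pos.2 (by positivity)

lemma hypS_sq_mul {a b τ : ℝ} (hb : 0 < b) (h : |τ| < a) :
    hypS a b τ ^ 2 * (a ^ 2 - τ ^ 2) = b + (a ^ 2 - τ ^ 2) / 4 := by
  rw [hypS_sq hb h]
  have := (sq_sub_sq_pos h).ne'
  field_simp

/-- The inequality is strict because b > 0. It keeps both energies a S ± τ/2 positive, which allows
square roots to be recognised by squaring. -/
lemma half_lt_hypS {a b τ : ℝ} (hb : 0 < b) (h : |τ| < a) : 1 / 2 < hypS a b τ := by
  have h1 := sq_sub_sq_pos h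
  have h2 := hypS_sq hb h
  have h3 := hypS_pos hb h
  have : 0 < b / (a ^ 2 - τ ^ 2) := by positivity
  nlinarith

lemma hyp_energy_pos {a b τ : ℝ} (hb : 0 < b) (h : |τ| < a) :
    0 < a * hypS a b τ + τ / 2 ∧ 0 < a * hypS a b τ - τ / 2 := by
  have h1 := half_lt_hypS hb h
  have h2 := abs_lt.1 h
  have ha : 0 < a := (abs_nonneg τ).trans_lt h
  constructor <;> nlinarith

/-- Squaring reduces the claim to S²(a² - τ²) = b + (a² - τ²)/4, the equation that defines S. With
the companion for the minus sign, the two energies differ by exactly τ, so τ is a coordinate. -/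
lemma hyp_energy_add {a b τ : ℝ} (hb : 0 < b) (h : |τ| < a) :
    Real.sqrt (b + (τ * hypS a b τ + a / 2) ^ 2) = a * hypS a b τ + τ / 2 := by
  rw [Real.sqrt_eq_iff_mul_self_eq_of_pos (hyp_energy_pos hb h).1]
  linarith [hypS_sq_mul hb h]

lemma hyp_energy_sub {a b τ : ℝ} (hb : 0 < b) (h : |τ| < a) :
    Real.sqrt (b + (τ * hypS a b τ - a / 2) ^ 2) = a * hypS a b τ - τ / 2 := by
  rw [Real.sqrt_eq_iff_mul_self_eq_of_pos (hyp_energy_pos hb h).2]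
  linarith [hypS_sq_mul hb h]

lemma hypJ_pos {a b τ : ℝ} (hb : 0 < b) (h : |τ| < a) : 0 < hypJ a b τ := by
  have h1 := sq_sub_sq_pos h
  have h3 := hypS_pos hb h
  rw [hypJ]; positivity

/-- The numerator is the product of the two energies. This form is the one that can be bounded by
them in `norm_mul_hypJac_le`. -/
lemma hypJ_eq {a b τ : ℝ} (hb : 0 < b) (h : |τ| < a) :
    hypJ a b τ = (a * hypS a b τ + τ / 2) * (a * hypS a b τ - τ / 2) /
      ((a ^ 2 - τ ^ 2) * hypS a b τ) := by
  have h1 := sq_sub_sq_pos h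
  have h3 := hypS_pos hb h
  have h4 := hypS_sq hb h
  have e : (a * hypS a b τ + τ / 2) * (a * hypS a b τ - τ / 2) =
    a ^ 2 * hypS a b τ ^ 2 - τ ^ 2 / 4 := by ring
  rw [hypJ, e, h4]
  field_simp
  ring

lemma hasDerivAt_mul_hypS {a b τ : ℝ} (hb : 0 < b) (h : |τ| < a) :
    HasDerivAt (fun t => t * hypS a b t) (hypJ a b τ) τ := by
  have h1 := sq_sub_sq_pos h
  have h3 := hypS_pos hb h
  have h4 := hypS_sq hb h
  have d1 : HasDerivAt (fun t : ℝ => b / (a ^ 2 - t ^ 2) + 1 / 4)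
      (b * (2 * τ) / (a ^ 2 - τ ^ 2) ^ 2) τ := by
    have := ((hasDerivAt_const τ b).div (((hasDerivAt_id τ).pow 2).const_sub (a ^ 2)) h1.ne').add_const
      (1 / 4)
    refine this.congr_deriv ?_
    simp only [Pi.pow_apply, id]
    push_cast
    ring
  have d2 := (hasDerivAt_id τ).mul (d1.sqrt (by positivity))
  refine d2.congr_deriv ?_
  change 1 * hypS a b τ + τ * (_ / (2 * hypS a b τ)) = _
  rw [hypJ]
  field_simp
  rw [h4]
  field_simp
  ring

/-- The preimage of x is the difference p - m of the two energies. It satisfies |p - m| < a because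
((p + m)² - a²)(a² - (p - m)²) = 4a²b is positive and so is the first factor. -/
lemma image_mul_hypS {a b : ℝ} (ha : 0 < a) (hb : 0 < b) :
    (fun t => t * hypS a b t) '' Set.Ioo (-a) a = Set.univ := by
  refine Set.eq_univ_of_forall fun x => ?_
  set p := Real.sqrt (b + (x + a / 2) ^ 2) with hp
  set m := Real.sqrt (b + (x - a / 2) ^ 2) with hm
  have hp2 : p ^ 2 = b + (x + a / 2) ^ 2 := Real.sq_sqrt (by positivity)
  have hm2 : m ^ 2 = b + (x - a / 2) ^ 2 := Real.sq_sqrt (by positivity)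
  have hp0 : 0 < p := Real.sqrt_pos.2 (by positivity)
  have hm0 : 0 < m := Real.sqrt_pos.2 (by positivity)
  have hpx : |x + a / 2| < p := abs_lt_of_sq_lt_sq (by nlinarith) hp0.le
  have hmx : |x - a / 2| < m := abs_lt_of_sq_lt_sq (by nlinarith) hm0.le
  have hs : a < p + m := by
    have := (abs_lt.1 hpx).2
    have := (abs_lt.1 hmx).1
    linarith
  have e1 : (p - m) * (p + m) = 2 * a * x := by nlinarith
  have e2 : (p + m) ^ 2 * (a ^ 2 - (p - m) ^ 2) = a ^ 2 * (a ^ 2 - (p - m) ^ 2 + 4 * b) := by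
    have : (p + m) ^ 2 * (p - m) ^ 2 = 4 * a ^ 2 * x ^ 2 := by rw [← mul_pow, mul_comm, e1]; ring
    nlinarith
  have hpos : 0 < a ^ 2 - (p - m) ^ 2 := by
    have h1 : ((p + m) ^ 2 - a ^ 2) * (a ^ 2 - (p - m) ^ 2) = 4 * a ^ 2 * b := by linarith
    have h2 : 0 < (p + m) ^ 2 - a ^ 2 := by nlinarith
    exact pos_of_mul_pos_right (h1 ▸ by positivity) h2.le
  have hlt : |p - m| < a := abs_lt_of_sq_lt_sq (by linarith) ha.le
  refine ⟨p - m, abs_lt.1 hlt, ?_⟩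
  have hS : hypS a b (p - m) = (p + m) / (2 * a) := by
    rw [hypS, Real.sqrt_eq_iff_mul_self_eq_of_pos (by positivity)]
    field_simp
    linarith
  simp only [hS]
  field_simp
  linarith

lemma lintegral_eq_hyp {a b : ℝ} (ha : 0 < a) (hb : 0 < b) (g : ℝ → ℝ≥0∞) :
    ∫⁻ x, g x = ∫⁻ τ in Set.Ioo (-a) a, ENNReal.ofReal (hypJ a b τ) * g (τ * hypS a b τ) := by
  have hd : ∀ x ∈ Set.Ioo (-a) a, HasDerivAt (fun t => t * hypS a b t) (hypJ a b x) x :=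
    fun x hx => hasDerivAt_mul_hypS hb (abs_lt.2 hx)
  have hmono : MonotoneOn (fun t => t * hypS a b t) (Set.Ioo (-a) a) := by
    refine (strictMonoOn_of_deriv_pos (convex_Ioo _ _)
      (fun x hx => (hd x hx).continuousAt.continuousWithinAt) fun x hx => ?_).monotoneOn
    rw [interior_Ioo] at hx
    rw [(hd x hx).deriv]
    exact hypJ_pos hb (abs_lt.2 hx)
  rw [← lintegral_image_eq_lintegral_deriv_mul_of_monotoneOn measurableSet_Ioo
    (fun x hx => (hd x hx).hasDerivWithinAt) hmono, image_mul_hypS ha hb, Measure.restrict_univ]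

lemma ellT_sq {a b : ℝ} (k : ℝ) (hb : 0 < b) :
    ellT a b k ^ 2 = 1 + a ^ 2 / (4 * (b + k ^ 2)) := by
  rw [ellT, Real.sq_sqrt (by positivity)]

lemma one_le_ellT {a b : ℝ} (k : ℝ) (hb : 0 < b) : 1 ≤ ellT a b k := by
  rw [ellT, Real.one_le_sqrt]
  have : 0 ≤ a ^ 2 / (4 * (b + k ^ 2)) := by positivity
  linarith

lemma ellT_pos {a b : ℝ} (k : ℝ) (hb : 0 < b) : 0 < ellT a b k :=
  one_pos.trans_le (one_le_ellT k hb)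

lemma ellJ_pos {a b : ℝ} (k : ℝ) (hb : 0 < b) : 0 < ellJ a b k := by
  have h3 := ellT_pos (a := a) k hb
  rw [ellJ]; positivity

lemma ell_energy_pos {a b : ℝ} (k : ℝ) (hb : 0 < b) :
    0 < Real.sqrt (b + k ^ 2) * ellT a b k + a * k / (2 * Real.sqrt (b + k ^ 2)) ∧
    0 < Real.sqrt (b + k ^ 2) * ellT a b k - a * k / (2 * Real.sqrt (b + k ^ 2)) := by
  set E := Real.sqrt (b + k ^ 2) with hE
  have hE2 : E ^ 2 = b + k ^ 2 := Real.sq_sqrt (by positivity)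
  have hE0 : 0 < E := Real.sqrt_pos.2 (by positivity)
  have hT := ellT_sq (a := a) k hb
  have hT0 := ellT_pos (a := a) k hb
  rw [← hE2] at hT
  have h : |a * k / (2 * E)| < E * ellT a b k := by
    refine abs_lt_of_sq_lt_sq ?_ (by positivity)
    rw [mul_pow, hT, div_pow, mul_pow, mul_pow]
    field_simp
    nlinarith [sq_nonneg a, sq_nonneg E, mul_nonneg (sq_nonneg a) hb.le, pow_pos hE0 4]
  have := abs_lt.1 h
  constructor <;> linarith

/-- This is a Lorentz boost. Two particles of energy E = √(b + k²) each have centre of mass energy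
2E, and total momentum a corresponds to the boost with γ = T and γ·velocity = a/(2E). Momentum k
becomes kT + a/2 and energy E becomes ET + ak/(2E). -/
lemma ell_energy_add {a b : ℝ} (k : ℝ) (hb : 0 < b) :
    Real.sqrt (b + (k * ellT a b k + a / 2) ^ 2) =
      Real.sqrt (b + k ^ 2) * ellT a b k + a * k / (2 * Real.sqrt (b + k ^ 2)) := by
  have h0 := (ell_energy_pos (a := a) k hb).1
  rw [Real.sqrt_eq_iff_mul_self_eq_of_pos h0]
  set E := Real.sqrt (b + k ^ 2) with hE
  have hE2 : E ^ 2 = b + k ^ 2 := Real.sq_sqrt (by positivity)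
  have hE0 : 0 < E := Real.sqrt_pos.2 (by positivity)
  have hT := ellT_sq (a := a) k hb
  rw [← hE2] at hT
  have hb' : b = E ^ 2 - k ^ 2 := by linarith
  have e1 : (E * ellT a b k + a * k / (2 * E)) * (E * ellT a b k + a * k / (2 * E)) =
    E ^ 2 * ellT a b k ^ 2 + a * k * ellT a b k + a ^ 2 * k ^ 2 / (4 * E ^ 2) := by
    field_simp; ring
  have e2 : b + (k * ellT a b k + a / 2) ^ 2 = (E ^ 2 - k ^ 2) + k ^ 2 * ellT a b k ^ 2 +
    a * k * ellT a b k + a ^ 2 / 4 := by linear_combination hb'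
  rw [e1, e2, hT]
  field_simp
  ring

lemma ell_energy_sub {a b : ℝ} (k : ℝ) (hb : 0 < b) :
    Real.sqrt (b + (k * ellT a b k - a / 2) ^ 2) =
      Real.sqrt (b + k ^ 2) * ellT a b k - a * k / (2 * Real.sqrt (b + k ^ 2)) := by
  have := ell_energy_add (a := a) (-k) hb
  have e : ellT a b (-k) = ellT a b k := by simp [ellT]
  rw [e, neg_sq] at this
  rw [show (k * ellT a b k - a / 2) ^ 2 = (-k * ellT a b k + a / 2) ^ 2 by ring, this]
  ring

lemma ellJ_eq {a b : ℝ} (k : ℝ) (hb : 0 < b) :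
    ellJ a b k = (Real.sqrt (b + k ^ 2) * ellT a b k + a * k / (2 * Real.sqrt (b + k ^ 2))) *
      (Real.sqrt (b + k ^ 2) * ellT a b k - a * k / (2 * Real.sqrt (b + k ^ 2))) /
      ((b + k ^ 2) * ellT a b k) := by
  set E := Real.sqrt (b + k ^ 2) with hE
  have hE2 : E ^ 2 = b + k ^ 2 := Real.sq_sqrt (by positivity)
  have hE0 : 0 < E := Real.sqrt_pos.2 (by positivity)
  have hT := ellT_sq (a := a) k hb
  have hT0 := ellT_pos (a := a) k hb
  have e1 : (E * ellT a b k + a * k / (2 * E)) * (E * ellT a b k - a * k / (2 * E)) =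
    E ^ 2 * ellT a b k ^ 2 - a ^ 2 * k ^ 2 / (4 * E ^ 2) := by
    field_simp
    ring
  rw [e1, ellJ, hT, ← hE2]
  have hb' : b = E ^ 2 - k ^ 2 := by linarith
  field_simp
  rw [hb']
  ring

lemma hasDerivAt_mul_ellT {a b : ℝ} (k : ℝ) (hb : 0 < b) :
    HasDerivAt (fun t => t * ellT a b t) (ellJ a b k) k := by
  have h3 := ellT_pos (a := a) k hb
  have h4 := ellT_sq (a := a) k hb
  have h1 : 0 < b + k ^ 2 := by positivity
  have d1 : HasDerivAt (fun t : ℝ => 1 + a ^ 2 / (4 * (b + t ^ 2)))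
      (-(a ^ 2 * (8 * k)) / (4 * (b + k ^ 2)) ^ 2) k := by
    have := ((hasDerivAt_const k (a ^ 2)).div
      ((((hasDerivAt_id k).pow 2).const_add b).const_mul 4) (by simpa using h1.ne')).const_add 1
    refine this.congr_deriv ?_
    simp only [Pi.pow_apply, id]
    push_cast
    ring
  have d2 := (hasDerivAt_id k).mul (d1.sqrt (by positivity))
  refine d2.congr_deriv ?_
  change 1 * ellT a b k + k * (_ / (2 * ellT a b k)) = _
  rw [ellJ]
  field_simp
  rw [h4]
  field_simp
  ring

lemma surjective_mul_ellT {a b : ℝ} (hb : 0 < b) :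
    Function.Surjective (fun t => t * ellT a b t) := by
  have hc : Continuous (fun t => t * ellT a b t) :=
    continuous_iff_continuousAt.2 fun x => (hasDerivAt_mul_ellT x hb).continuousAt
  refine hc.surjective ?_ ?_
  · refine Filter.tendsto_atTop_mono' _ ?_ Filter.tendsto_id
    filter_upwards [Filter.eventually_ge_atTop 0] with x hx
    exact le_mul_of_one_le_right hx (one_le_ellT x hb)
  · refine Filter.tendsto_atBot_mono' _ ?_ Filter.tendsto_id
    filter_upwards [Filter.eventually_le_atBot 0] with x hx
    simp only [id]
    nlinarith [one_le_ellT (a := a) x hb]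

lemma lintegral_eq_ell {a b : ℝ} (hb : 0 < b) (g : ℝ → ℝ≥0∞) :
    ∫⁻ x, g x = ∫⁻ k, ENNReal.ofReal (ellJ a b k) * g (k * ellT a b k) := by
  have hd : ∀ x, HasDerivAt (fun t => t * ellT a b t) (ellJ a b x) x :=
    fun x => hasDerivAt_mul_ellT x hb
  have hmono : StrictMono (fun t => t * ellT a b t) :=
    strictMono_of_hasDerivAt_pos hd fun x => ellJ_pos x hb
  have := lintegral_image_eq_lintegral_deriv_mul_of_monotoneOn MeasurableSet.univ
    (fun x _ => (hd x).hasDerivWithinAt) (hmono.monotone.monotoneOn Set.univ) g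
  rwa [Set.image_univ, (surjective_mul_ellT hb).range_eq, Measure.restrict_univ] at this

end

end KleinGordon

namespace KleinGordon

noncomputable section

open scoped RealInnerProductSpace

/-! ### Slicing, rotations and polar coordinates -/

/-- The point of `ℝ^{n+1}` with first coordinate `x` and remaining coordinates `v`. -/
def join {n : ℕ} (x : ℝ) (v : Space n) : Space (n + 1) := WithLp.toLp 2 (Fin.cons x v.ofLp)

lemma measurePreserving_join (n : ℕ) :
    MeasurePreserving (fun p : ℝ × Space n => join p.1 p.2) (volume.prod volume) volume := by
  have h1 : MeasurePreserving (Prod.map id (WithLp.ofLp : Space n → (Fin n → ℝ)))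
      ((volume : Measure ℝ).prod volume) (volume.prod volume) :=
    (MeasurePreserving.id volume).prod (PiLp.volume_preserving_ofLp (Fin n))
  have h2 := (volume_preserving_piFinSuccAbove (fun _ : Fin (n + 1) => ℝ) 0).symm
  have h3 := PiLp.volume_preserving_toLp (Fin (n + 1))
  convert! h3.comp (h2.comp h1) using 1
  ext1 p
  simp only [join, Function.comp_apply]
  congr 1
  exact (Fin.insertNth_zero _ _).symm

lemma measurable_join {n : ℕ} : Measurable (fun p : ℝ × Space n => join p.1 p.2) :=
  (measurePreserving_join n).measurable

lemma continuous_join {n : ℕ} : Continuous (fun p : ℝ × Space n => join p.1 p.2) := by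
  unfold join
  refine (PiLp.continuous_toLp 2 _).comp ?_
  refine continuous_pi fun i => ?_
  refine Fin.cases ?_ (fun j => ?_) i
  · simpa using continuous_fst
  · simp only [Fin.cons_succ]
    fun_prop

lemma inner_join {n : ℕ} (x y : ℝ) (v w : Space n) : ⟪join x v, join y w⟫ = x * y + ⟪v, w⟫ := by
  simp [join, PiLp.inner_apply, Fin.sum_univ_succ, mul_comm]

lemma norm_join_sq {n : ℕ} (x : ℝ) (v : Space n) : ‖join x v‖ ^ 2 = x ^ 2 + ‖v‖ ^ 2 := by
  rw [← real_inner_self_eq_norm_sq, inner_join, real_inner_self_eq_norm_sq, sq x]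

lemma join_head_tail {n : ℕ} (p : Space (n + 1)) :
    join (p 0) (WithLp.toLp 2 (Fin.tail p.ofLp)) = p := by
  simp [join]

lemma exists_eq_join {n : ℕ} (p : Space (n + 1)) : ∃ x v, p = join x v :=
  ⟨_, _, (join_head_tail p).symm⟩

lemma lintegral_join {n : ℕ} {H : Space (n + 1) → ℝ≥0∞} (hH : Measurable H) :
    ∫⁻ q, H q = ∫⁻ v, ∫⁻ x, H (join x v) := by
  rw [← (measurePreserving_join n).lintegral_comp hH,
    lintegral_prod_symm (fun p : ℝ × Space n => H (join p.1 p.2))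
      (hH.comp measurable_join).aemeasurable]

/-- The first unit vector. -/
def e0 (n : ℕ) : Space (n + 1) := join 1 0

lemma join_eq_add {n : ℕ} (x : ℝ) (v : Space n) : join x v = x • e0 n + join 0 v := by
  ext i
  refine Fin.cases ?_ (fun j => ?_) i <;> simp [join, e0]

lemma norm_e0 (n : ℕ) : ‖e0 n‖ = 1 := by
  have := norm_join_sq (1 : ℝ) (0 : Space n)
  rw [← e0] at this
  rw [← Real.sqrt_sq (norm_nonneg (e0 n)), this]; simp

/-- The reflection exchanging `‖ξ‖ • e0` and `ξ`. -/
def rot {n : ℕ} (ξ z : Space (n + 1)) : Space (n + 1) :=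
  z - (2 * ⟪‖ξ‖ • e0 n - ξ, z⟫ / ‖‖ξ‖ • e0 n - ξ‖ ^ 2) • (‖ξ‖ • e0 n - ξ)

/-- The explicit formula makes `rot` jointly measurable in both arguments, and the reflection
supplies the isometry properties. When ξ = ‖ξ‖e₀ both are the identity, since the vector reflected
along is 0. -/
lemma rot_eq_reflection {n : ℕ} (ξ : Space (n + 1)) :
    rot ξ = (ℝ ∙ (‖ξ‖ • e0 n - ξ))ᗮ.reflection := by
  ext1 z
  rw [Submodule.reflection_orthogonal_apply, Submodule.reflection_singleton_apply, rot]
  rw [neg_sub, ← Nat.cast_smul_eq_nsmul ℝ, smul_smul]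
  simp [mul_div_assoc]

lemma rot_smul_e0 {n : ℕ} (ξ : Space (n + 1)) : rot ξ (‖ξ‖ • e0 n) = ξ := by
  rw [rot_eq_reflection]
  exact Submodule.reflection_sub (by simp [norm_smul, norm_e0])

lemma inner_rot_rot {n : ℕ} (ξ z w : Space (n + 1)) : ⟪rot ξ z, rot ξ w⟫ = ⟪z, w⟫ := by
  rw [rot_eq_reflection, LinearIsometryEquiv.inner_map_map]

lemma norm_rot {n : ℕ} (ξ z : Space (n + 1)) : ‖rot ξ z‖ = ‖z‖ := by
  rw [rot_eq_reflection, LinearIsometryEquiv.norm_map]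

lemma rot_sub {n : ℕ} (ξ z w : Space (n + 1)) : rot ξ (z - w) = rot ξ z - rot ξ w := by
  rw [rot_eq_reflection, map_sub]

lemma rot_rot {n : ℕ} (ξ z : Space (n + 1)) : rot ξ (rot ξ z) = z := by
  rw [rot_eq_reflection, Submodule.reflection_reflection]

lemma inner_rot_join {n : ℕ} (ξ : Space (n + 1)) (x : ℝ) (v : Space n) :
    ⟪ξ, rot ξ (join x v)⟫ = ‖ξ‖ * x := by
  calc ⟪ξ, rot ξ (join x v)⟫ = ⟪rot ξ (‖ξ‖ • e0 n), rot ξ (join x v)⟫ := by rw [rot_smul_e0]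
    _ = ‖ξ‖ * x := by
      rw [inner_rot_rot, inner_smul_left, e0, inner_join]
      simp

lemma measurePreserving_rot {n : ℕ} (ξ : Space (n + 1)) :
    MeasurePreserving (rot ξ) volume volume := by
  rw [rot_eq_reflection]
  exact LinearIsometryEquiv.measurePreserving _

lemma measurable_rot {n : ℕ} :
    Measurable (fun p : Space (n + 1) × Space (n + 1) => rot p.1 p.2) := by
  unfold rot
  fun_prop

lemma continuous_rot {n : ℕ} (ξ : Space (n + 1)) : Continuous (rot ξ) := by
  rw [rot_eq_reflection]
  exact LinearIsometryEquiv.continuous _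

lemma lintegral_rot {n : ℕ} (ξ : Space (n + 1)) {H : Space (n + 1) → ℝ≥0∞} (hH : Measurable H) :
    ∫⁻ q, H q = ∫⁻ v, ∫⁻ x, H (rot ξ (join x v)) := by
  rw [← (measurePreserving_rot ξ).lintegral_comp hH,
    lintegral_join (H := fun q => H (rot ξ q)) (hH.comp (measurePreserving_rot ξ).measurable)]

/-- The surface measure on the unit sphere. -/
abbrev sphereMeasure (n : ℕ) : Measure (Metric.sphere (0 : Space (n + 1)) 1) :=
  (volume : Measure (Space (n + 1))).toSphere

lemma lintegral_polar {n : ℕ} {H : Space (n + 1) → ℝ≥0∞} (hH : Measurable H) :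
    ∫⁻ p, H p = ∫⁻ ω : Metric.sphere (0 : Space (n + 1)) 1, (∫⁻ r in Set.Ioi (0 : ℝ),
      ENNReal.ofReal (r ^ n) * H (r • ω.1)) ∂(sphereMeasure n) := by
  have hmp := Measure.measurePreserving_homeomorphUnitSphereProd
    (volume : Measure (Space (n + 1)))
  have h0 : (volume : Measure (Space (n + 1))).restrict {0}ᶜ = volume :=
    Measure.restrict_eq_self_of_ae_mem (by
      rw [ae_iff]; simp)
  have hsm : Measurable (fun x : Metric.sphere (0 : Space (n + 1)) 1 × Set.Ioi (0 : ℝ) =>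
      H (x.2.1 • x.1.1)) := by fun_prop
  calc ∫⁻ p, H p = ∫⁻ p in {0}ᶜ, H p := by rw [h0]
    _ = ∫⁻ p : ({0}ᶜ : Set (Space (n + 1))), H p.1 ∂(volume.comap Subtype.val) := by
      rw [lintegral_subtype_comap (MeasurableSet.singleton 0).compl]
    _ = ∫⁻ x, H (x.2.1 • x.1.1) ∂((sphereMeasure n).prod (Measure.volumeIoiPow n)) := by
      have := hmp.lintegral_comp hsm
      rw [finrank_euclideanSpace_fin] at this
      rw [show n + 1 - 1 = n from rfl] at this
      rw [← this]
      refine lintegral_congr fun p => ?_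
      have hp : ‖p.1‖ ≠ 0 := norm_ne_zero_iff.2 p.2
      simp [smul_smul, hp]
    _ = ∫⁻ ω, ∫⁻ r, H (r.1 • ω.1) ∂(Measure.volumeIoiPow n) ∂(sphereMeasure n) :=
      lintegral_prod _ hsm.aemeasurable
    _ = _ := by
      refine lintegral_congr fun ω => ?_
      rw [Measure.volumeIoiPow, lintegral_withDensity_eq_lintegral_mul _ (by fun_prop)
        (by fun_prop)]
      simp only [Pi.mul_apply]
      exact lintegral_subtype_comap measurableSet_Ioi
        (fun r => ENNReal.ofReal (r ^ n) * H (r • ω.1))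

/-! ### The relativistic energy and adapted coordinates -/

/-- `√(σ² + ‖y‖²)`. -/
def energy {d : ℕ} (σ : ℝ) (y : Space d) : ℝ := phi σ ‖y‖

lemma energy_sq {d : ℕ} (σ : ℝ) (y : Space d) : energy σ y ^ 2 = σ ^ 2 + ‖y‖ ^ 2 :=
  Real.sq_sqrt (by positivity)

lemma energy_pos {d : ℕ} {σ : ℝ} (hσ : 0 < σ) (y : Space d) : 0 < energy σ y :=
  Real.sqrt_pos.2 (by positivity)

lemma energy_neg {d : ℕ} (σ : ℝ) (y : Space d) : energy σ (-y) = energy σ y := by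
  simp [energy]

@[fun_prop]
lemma continuous_energy {d : ℕ} (σ : ℝ) : Continuous (energy σ : Space d → ℝ) := by
  unfold energy phi
  fun_prop

@[fun_prop]
lemma measurable_energy {d : ℕ} (σ : ℝ) : Measurable (energy σ : Space d → ℝ) :=
  (continuous_energy σ).measurable

lemma le_energy {d : ℕ} (σ : ℝ) (y : Space d) : σ ≤ energy σ y :=
  Real.le_sqrt_of_sq_le (by nlinarith [sq_nonneg ‖y‖])

lemma norm_le_energy {d : ℕ} (σ : ℝ) (y : Space d) : ‖y‖ ≤ energy σ y :=
  Real.le_sqrt_of_sq_le (by nlinarith [sq_nonneg σ])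

lemma energy_add_half {d : ℕ} (σ : ℝ) (q ξ : Space d) :
    energy σ (q + (1 / 2 : ℝ) • ξ) = Real.sqrt (σ ^ 2 + ‖q‖ ^ 2 + ⟪ξ, q⟫ + ‖ξ‖ ^ 2 / 4) := by
  rw [energy, phi, norm_add_sq_real, norm_smul, inner_smul_right, real_inner_comm]
  congr 1
  norm_num
  ring

lemma energy_sub_half {d : ℕ} (σ : ℝ) (q ξ : Space d) :
    energy σ (q - (1 / 2 : ℝ) • ξ) = Real.sqrt (σ ^ 2 + ‖q‖ ^ 2 - ⟪ξ, q⟫ + ‖ξ‖ ^ 2 / 4) := by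
  rw [energy, phi, norm_sub_sq_real, norm_smul, inner_smul_right, real_inner_comm]
  congr 1
  norm_num
  ring

/-- The point `q` with `ϕ(q + ξ/2) - ϕ(q - ξ/2) = τ` and transversal coordinates `v`. -/
def hypPt {n : ℕ} (σ : ℝ) (ξ : Space (n + 1)) (τ : ℝ) (v : Space n) : Space (n + 1) :=
  rot ξ (join (τ * hypS ‖ξ‖ (σ ^ 2 + ‖v‖ ^ 2) τ) v)

/-- The Jacobian of `(τ, v) ↦ hypPt σ ξ τ v`. -/
def hypJac {n : ℕ} (σ : ℝ) (ξ : Space (n + 1)) (τ : ℝ) (v : Space n) : ℝ :=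
  hypJ ‖ξ‖ (σ ^ 2 + ‖v‖ ^ 2) τ

section Hyp

variable {n : ℕ} {σ : ℝ} {ξ : Space (n + 1)} {τ : ℝ} (v : Space n)

lemma energy_hypPt_add (hσ : 0 < σ) (h : |τ| < ‖ξ‖) : energy σ (hypPt σ ξ τ v + (1 / 2 : ℝ) • ξ) =
    ‖ξ‖ * hypS ‖ξ‖ (σ ^ 2 + ‖v‖ ^ 2) τ + τ / 2 := by
  rw [energy_add_half, ← hyp_energy_add (by positivity) h, hypPt, inner_rot_join, norm_rot,
    norm_join_sq]
  congr 1
  ring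

lemma energy_hypPt_sub (hσ : 0 < σ) (h : |τ| < ‖ξ‖) : energy σ (hypPt σ ξ τ v - (1 / 2 : ℝ) • ξ) =
    ‖ξ‖ * hypS ‖ξ‖ (σ ^ 2 + ‖v‖ ^ 2) τ - τ / 2 := by
  rw [energy_sub_half, ← hyp_energy_sub (by positivity) h, hypPt, inner_rot_join, norm_rot,
    norm_join_sq]
  congr 1
  ring

end Hyp

@[fun_prop]
lemma measurable_coord_zero {n : ℕ} : Measurable (fun p : Space (n + 1) => p 0) := by
  fun_prop

lemma lintegral_hyp {n : ℕ} {σ : ℝ} (hσ : 0 < σ) {ξ : Space (n + 1)} (hξ : ξ ≠ 0)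
    {H : Space (n + 1) → ℝ≥0∞} (hH : Measurable H) :
    ∫⁻ q, H q = ∫⁻ v, ∫⁻ τ in Set.Ioo (-‖ξ‖) ‖ξ‖,
      ENNReal.ofReal (hypJac σ ξ τ v) * H (hypPt σ ξ τ v) := by
  rw [lintegral_rot ξ hH]
  exact lintegral_congr fun v => lintegral_eq_hyp (norm_pos_iff.2 hξ) (by positivity) _

/-- The factor relating the component of the momentum along `P` in the centre of mass frame
to the one in the laboratory frame. -/
def ellFac {n : ℕ} (σ : ℝ) (P p : Space (n + 1)) : ℝ :=
  Real.sqrt (1 + ‖P‖ ^ 2 / (4 * energy σ p ^ 2))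

/-- Half of the relative momentum, in the laboratory frame, of two particles of total momentum `P`
and centre of mass momenta `±p`. -/
def ellPt {n : ℕ} (σ : ℝ) (P p : Space (n + 1)) : Space (n + 1) :=
  rot P (p + ((ellFac σ P p - 1) * p 0) • e0 n)

/-- The Jacobian of `ellPt σ P`. -/
def ellJac {n : ℕ} (σ : ℝ) (P p : Space (n + 1)) : ℝ :=
  energy σ (ellPt σ P p + (1 / 2 : ℝ) • P) * energy σ (ellPt σ P p - (1 / 2 : ℝ) • P) /
    (energy σ p ^ 2 * ellFac σ P p)

lemma join_zero {n : ℕ} (x : ℝ) (v : Space n) : join x v 0 = x := rfl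

lemma energy_join_sq {n : ℕ} (σ x : ℝ) (v : Space n) :
    energy σ (join x v) ^ 2 = σ ^ 2 + ‖v‖ ^ 2 + x ^ 2 := by
  rw [energy_sq, norm_join_sq]; ring

lemma energy_join {n : ℕ} (σ x : ℝ) (v : Space n) :
    energy σ (join x v) = Real.sqrt (σ ^ 2 + ‖v‖ ^ 2 + x ^ 2) := by
  rw [energy, phi, norm_join_sq]; ring_nf

lemma ellFac_join {n : ℕ} (σ : ℝ) (P : Space (n + 1)) (k : ℝ) (v : Space n) :
    ellFac σ P (join k v) = ellT ‖P‖ (σ ^ 2 + ‖v‖ ^ 2) k := by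
  rw [ellFac, ellT, energy_join_sq]

lemma ellPt_join {n : ℕ} (σ : ℝ) (P : Space (n + 1)) (k : ℝ) (v : Space n) :
    ellPt σ P (join k v) = rot P (join (k * ellT ‖P‖ (σ ^ 2 + ‖v‖ ^ 2) k) v) := by
  rw [ellPt, ellFac_join, join_zero, join_eq_add k, join_eq_add (k * _), add_right_comm, ← add_smul]
  congr 3
  ring

@[fun_prop]
lemma measurable_rot' {α : Type*} [MeasurableSpace α] {n : ℕ} {f g : α → Space (n + 1)}
    (hf : Measurable f) (hg : Measurable g) : Measurable (fun a => rot (f a) (g a)) :=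
  measurable_rot.comp (hf.prodMk hg)

@[fun_prop]
lemma measurable_ellFac {α : Type*} [MeasurableSpace α] {n : ℕ} (σ : ℝ) {f g : α → Space (n + 1)}
    (hf : Measurable f) (hg : Measurable g) : Measurable (fun a => ellFac σ (f a) (g a)) := by
  unfold ellFac
  fun_prop

@[fun_prop]
lemma measurable_ellPt {α : Type*} [MeasurableSpace α] {n : ℕ} (σ : ℝ) {f g : α → Space (n + 1)}
    (hf : Measurable f) (hg : Measurable g) : Measurable (fun a => ellPt σ (f a) (g a)) := by
  unfold ellPt
  fun_prop

@[fun_prop]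
lemma measurable_ellJac {α : Type*} [MeasurableSpace α] {n : ℕ} (σ : ℝ) {f g : α → Space (n + 1)}
    (hf : Measurable f) (hg : Measurable g) : Measurable (fun a => ellJac σ (f a) (g a)) := by
  unfold ellJac
  fun_prop

section Ell

variable {n : ℕ} {σ : ℝ}

lemma ellFac_sq (hσ : 0 < σ) (P p : Space (n + 1)) : ellFac σ P p ^ 2 = 1 + ‖P‖ ^ 2 / (4 * energy σ p ^ 2) :=
  Real.sq_sqrt (by have := energy_pos hσ p; positivity)

lemma ellFac_pos (hσ : 0 < σ) (P p : Space (n + 1)) : 0 < ellFac σ P p :=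
  Real.sqrt_pos.2 (by have := energy_pos hσ p; positivity)

lemma energy_ellPt_add (hσ : 0 < σ) (P p : Space (n + 1)) : energy σ (ellPt σ P p + (1 / 2 : ℝ) • P) =
    energy σ p * ellFac σ P p + ‖P‖ * p 0 / (2 * energy σ p) := by
  obtain ⟨k, v, rfl⟩ := exists_eq_join p
  rw [energy_add_half, ellPt_join, inner_rot_join, norm_rot, norm_join_sq, energy_join,
    ellFac_join, join_zero, ← ell_energy_add k (by positivity)]
  congr 1
  ring

lemma energy_ellPt_sub (hσ : 0 < σ) (P p : Space (n + 1)) : energy σ (ellPt σ P p - (1 / 2 : ℝ) • P) =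
    energy σ p * ellFac σ P p - ‖P‖ * p 0 / (2 * energy σ p) := by
  obtain ⟨k, v, rfl⟩ := exists_eq_join p
  rw [energy_sub_half, ellPt_join, inner_rot_join, norm_rot, norm_join_sq, energy_join,
    ellFac_join, join_zero, ← ell_energy_sub k (by positivity)]
  congr 1
  ring

/-- The total energy depends on p only through ‖p‖. Fixing it amounts to fixing the radius in centre
of mass coordinates, so the level sets become spheres. -/
lemma energy_ellPt_sum (hσ : 0 < σ) (P p : Space (n + 1)) : energy σ (ellPt σ P p + (1 / 2 : ℝ) • P) +
    energy σ (ellPt σ P p - (1 / 2 : ℝ) • P) = Real.sqrt (‖P‖ ^ 2 + 4 * energy σ p ^ 2) := by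
  rw [energy_ellPt_add hσ, energy_ellPt_sub hσ]
  have h1 := energy_pos hσ p
  have h2 := ellFac_pos hσ P p
  have h3 := ellFac_sq hσ P p
  symm
  rw [Real.sqrt_eq_iff_mul_self_eq_of_pos (by ring_nf; positivity)]
  have : (energy σ p * ellFac σ P p + ‖P‖ * p 0 / (2 * energy σ p) +
    (energy σ p * ellFac σ P p - ‖P‖ * p 0 / (2 * energy σ p))) *
    (energy σ p * ellFac σ P p + ‖P‖ * p 0 / (2 * energy σ p) +
    (energy σ p * ellFac σ P p - ‖P‖ * p 0 / (2 * energy σ p))) =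
    4 * energy σ p ^ 2 * ellFac σ P p ^ 2 := by ring
  rw [this, h3]
  field_simp
  ring

lemma exists_ellPt_eq (hσ : 0 < σ) (P q : Space (n + 1)) : ∃ p, ellPt σ P p = q := by
  obtain ⟨x, v, hx⟩ := exists_eq_join (rot P q)
  obtain ⟨k, hk⟩ := surjective_mul_ellT (a := ‖P‖) (b := σ ^ 2 + ‖v‖ ^ 2) (by positivity) x
  refine ⟨join k v, ?_⟩
  simp only at hk
  rw [ellPt_join, hk, ← hx, rot_rot]

/-- The interval of the difference of two energy-momentum vectors in the centre of mass frame. -/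
lemma interval_ellPt (hσ : 0 < σ) (P : Space (n + 1)) {p p' : Space (n + 1)} (h : ‖p‖ = ‖p'‖) :
    ‖ellPt σ P p - ellPt σ P p'‖ ^ 2 - (energy σ (ellPt σ P p + (1 / 2 : ℝ) • P) -
      energy σ (ellPt σ P p' + (1 / 2 : ℝ) • P)) ^ 2 = ‖p - p'‖ ^ 2 := by
  have he : energy σ p' = energy σ p := by rw [energy, energy, h]
  have hf : ellFac σ P p' = ellFac σ P p := by rw [ellFac, ellFac, he]
  rw [energy_ellPt_add hσ, energy_ellPt_add hσ, ellPt, ellPt, ← rot_sub, norm_rot, hf, he]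
  have h1 := energy_pos hσ p
  have h3 := ellFac_sq hσ P p
  have e1 : (p - p') 0 = ⟪p - p', e0 n⟫ := by
    obtain ⟨k, v, hk⟩ := exists_eq_join (p - p')
    rw [hk, e0, inner_join, join_zero]; simp
  have e2 : (p - p') 0 = p 0 - p' 0 := rfl
  have e3 : p + ((ellFac σ P p - 1) * p 0) • e0 n - (p' + ((ellFac σ P p - 1) * p' 0) • e0 n) =
      (p - p') + ((ellFac σ P p - 1) * (p - p') 0) • e0 n := by
    rw [e2]; module
  rw [e3, norm_add_sq_real, norm_smul, norm_e0, inner_smul_right, ← e1]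
  have e4 : energy σ p * ellFac σ P p + ‖P‖ * p 0 / (2 * energy σ p) -
      (energy σ p * ellFac σ P p + ‖P‖ * p' 0 / (2 * energy σ p)) =
      ‖P‖ * (p - p') 0 / (2 * energy σ p) := by rw [e2]; ring
  rw [e4, mul_one, Real.norm_eq_abs, sq_abs]
  have h4 : ‖P‖ ^ 2 = (ellFac σ P p ^ 2 - 1) * (4 * energy σ p ^ 2) := by
    rw [h3]; field_simp; ring
  -- The boost stretches the component along P by `ellFac`. The squared energy difference removes
  -- exactly the excess this creates.
  have h5 : (‖P‖ * (p - p') 0 / (2 * energy σ p)) ^ 2 =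
      (ellFac σ P p ^ 2 - 1) * (p - p') 0 ^ 2 := by
    rw [div_pow, mul_pow, h4]; field_simp; ring
  rw [h5]
  ring

lemma lintegral_ell (hσ : 0 < σ) (P : Space (n + 1)) {H : Space (n + 1) → ℝ≥0∞} (hH : Measurable H) :
    ∫⁻ q, H q = ∫⁻ p, ENNReal.ofReal (ellJac σ P p) * H (ellPt σ P p) := by
  rw [lintegral_rot P hH, lintegral_join (by fun_prop)]
  refine lintegral_congr fun v => ?_
  rw [lintegral_eq_ell (a := ‖P‖) (b := σ ^ 2 + ‖v‖ ^ 2) (by positivity)]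
  refine lintegral_congr fun k => ?_
  rw [ellPt_join, ellJac, energy_ellPt_add hσ, energy_ellPt_sub hσ, ellJ_eq k (by positivity),
    ellFac_join, energy_join_sq, energy_join, join_zero]

end Ell

end

end KleinGordon

namespace KleinGordon

noncomputable section

open scoped RealInnerProductSpace
open Filter Topology

/-! ### Two disintegrations of Lebesgue measure on triples of momenta -/

@[fun_prop]
lemma measurable_join' {α : Type*} [MeasurableSpace α] {n : ℕ} {f : α → ℝ} {g : α → Space n}
    (hf : Measurable f) (hg : Measurable g) : Measurable (fun a => join (f a) (g a)) :=
  measurable_join.comp (hf.prodMk hg)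

@[fun_prop]
lemma measurable_hypPt {α : Type*} [MeasurableSpace α] {n : ℕ} (σ : ℝ) {f : α → Space (n + 1)}
    {t : α → ℝ} {g : α → Space n} (hf : Measurable f) (ht : Measurable t) (hg : Measurable g) :
    Measurable (fun a => hypPt σ (f a) (t a) (g a)) := by
  unfold hypPt hypS
  fun_prop

@[fun_prop]
lemma measurable_hypJac {α : Type*} [MeasurableSpace α] {n : ℕ} (σ : ℝ) {f : α → Space (n + 1)}
    {t : α → ℝ} {g : α → Space n} (hf : Measurable f) (ht : Measurable t) (hg : Measurable g) :
    Measurable (fun a => hypJac σ (f a) (t a) (g a)) := by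
  unfold hypJac hypJ hypS
  fun_prop

/-- The density of the momentum `y₄` on the level set
`ϕ(y₁ - y₂ + y₄) - ϕ(y₄) = ϕ(y₁) - ϕ(y₂) + c`, with respect to the transversal coordinate. -/
def hypDens {n : ℕ} (σ c : ℝ) (y : Space (n + 1) × Space (n + 1)) (v : Space n) : ℝ≥0∞ :=
  if |energy σ y.1 - energy σ y.2 + c| < ‖y.1 - y.2‖ then
    ENNReal.ofReal (hypJac σ (y.1 - y.2) (energy σ y.1 - energy σ y.2 + c) v) else 0

/-- The momentum `y₄` on this level set with the given transversal coordinate. -/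
def hypMom {n : ℕ} (σ c : ℝ) (y : Space (n + 1) × Space (n + 1)) (v : Space n) : Space (n + 1) :=
  hypPt σ (y.1 - y.2) (energy σ y.1 - energy σ y.2 + c) v - (1 / 2 : ℝ) • (y.1 - y.2)

/-- The centre of mass momentum of two particles of total momentum `P` and total energy `e`. -/
def cmRad {n : ℕ} (σ : ℝ) (P : Space (n + 1)) (e : ℝ) : ℝ :=
  Real.sqrt ((e ^ 2 - ‖P‖ ^ 2) / 4 - σ ^ 2)

/-- The density of `y₂` on the level set `ϕ(y₂) + ϕ(y₁ + y₄ - y₂) = ϕ(y₁) + ϕ(y₄) + c`, with respect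
to the direction of the centre of mass momentum. -/
def ellDens {n : ℕ} (σ c : ℝ) (y : Space (n + 1) × Space (n + 1)) (ω : Space (n + 1)) : ℝ≥0∞ :=
  if Real.sqrt (‖y.1 + y.2‖ ^ 2 + 4 * σ ^ 2) < energy σ y.1 + energy σ y.2 + c then
    ENNReal.ofReal ((energy σ y.1 + energy σ y.2 + c) /
      (4 * cmRad σ (y.1 + y.2) (energy σ y.1 + energy σ y.2 + c)) *
      cmRad σ (y.1 + y.2) (energy σ y.1 + energy σ y.2 + c) ^ n *
      ellJac σ (y.1 + y.2) (cmRad σ (y.1 + y.2) (energy σ y.1 + energy σ y.2 + c) • ω)) else 0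

/-- The momentum `y₂` on this level set with the given direction. -/
def ellMom {n : ℕ} (σ c : ℝ) (y : Space (n + 1) × Space (n + 1)) (ω : Space (n + 1)) :
    Space (n + 1) :=
  ellPt σ (y.1 + y.2) (cmRad σ (y.1 + y.2) (energy σ y.1 + energy σ y.2 + c) • ω) +
    (1 / 2 : ℝ) • (y.1 + y.2)

@[fun_prop]
lemma measurable_cmRad {α : Type*} [MeasurableSpace α] {n : ℕ} (σ : ℝ) {f : α → Space (n + 1)}
    {t : α → ℝ} (hf : Measurable f) (ht : Measurable t) :
    Measurable (fun a => cmRad σ (f a) (t a)) := by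
  unfold cmRad
  fun_prop

lemma measurable_hypMom {n : ℕ} (σ : ℝ) :
    Measurable (fun x : ℝ × (Space (n + 1) × Space (n + 1)) × Space n =>
      hypMom σ x.1 x.2.1 x.2.2) := by
  unfold hypMom
  fun_prop

lemma measurable_hypDens {n : ℕ} (σ : ℝ) :
    Measurable (fun x : ℝ × (Space (n + 1) × Space (n + 1)) × Space n =>
      hypDens σ x.1 x.2.1 x.2.2) := by
  unfold hypDens
  refine Measurable.ite (measurableSet_lt ?_ ?_) ?_ ?_ <;> fun_prop

lemma measurable_ellMom {n : ℕ} (σ : ℝ) :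
    Measurable (fun x : ℝ × (Space (n + 1) × Space (n + 1)) × Space (n + 1) =>
      ellMom σ x.1 x.2.1 x.2.2) := by
  unfold ellMom
  fun_prop

lemma measurable_ellDens {n : ℕ} (σ : ℝ) :
    Measurable (fun x : ℝ × (Space (n + 1) × Space (n + 1)) × Space (n + 1) =>
      ellDens σ x.1 x.2.1 x.2.2) := by
  unfold ellDens
  refine Measurable.ite (measurableSet_lt ?_ ?_) ?_ ?_ <;> fun_prop

/-- The integral over quadruples `y₁ - y₂ = y₃ - y₄` with energy defect `c`, in hyperbolic
coordinates. -/
def hypInt {n : ℕ} (σ c : ℝ) (Ψ : Space (n + 1) × Space (n + 1) × Space (n + 1) → ℝ≥0∞) : ℝ≥0∞ :=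
  ∫⁻ y : Space (n + 1) × Space (n + 1), ∫⁻ v : Space n,
    hypDens σ c y v * Ψ (y.1, y.2, hypMom σ c y v)

/-- The integral over quadruples `y₁ + y₄ = y₂ + y₃` with energy defect `c`, in elliptic
coordinates. -/
def ellInt {n : ℕ} (σ c : ℝ) (Ψ : Space (n + 1) × Space (n + 1) × Space (n + 1) → ℝ≥0∞) : ℝ≥0∞ :=
  ∫⁻ y : Space (n + 1) × Space (n + 1), ∫⁻ ω : Metric.sphere (0 : Space (n + 1)) 1,
    ellDens σ c y ω.1 * Ψ (y.1, ellMom σ c y ω.1, y.2) ∂(sphereMeasure n)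

lemma ae_ne {n : ℕ} : ∀ᵐ y : Space (n + 1) × Space (n + 1), y.1 ≠ y.2 := by
  refine (Measure.ae_prod_iff_ae_ae ?_).2 ?_
  · exact (measurableSet_eq_fun measurable_fst measurable_snd).compl
  · exact Eventually.of_forall fun x => by
      rw [ae_iff]
      simp

section

variable {n : ℕ} {σ : ℝ}

/-- The weight `ρ` acts as a smeared delta function in the energy defect. For fixed (y₁, y₂) the
coordinates (τ, v) turn the integral over y₄ into one over the energy difference τ of the second
pair, and c is τ minus the energy difference of the first. -/
lemma lintegral_defect_eq_hypInt (hσ : 0 < σ)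
    {Ψ : Space (n + 1) × Space (n + 1) × Space (n + 1) → ℝ≥0∞} (hΨ : Measurable Ψ)
    {ρ : ℝ → ℝ≥0∞} (hρ : Measurable ρ) :
    ∫⁻ y : Space (n + 1) × Space (n + 1), ∫⁻ y4, Ψ (y.1, y.2, y4) *
      ρ (energy σ (y.1 - y.2 + y4) - energy σ y4 - (energy σ y.1 - energy σ y.2)) =
    ∫⁻ c, ρ c * hypInt σ c Ψ := by
  have hm1 := measurable_hypDens (n := n) σ
  have hm2 := measurable_hypMom (n := n) σ
  have hm3 : Measurable (fun x : ℝ × (Space (n + 1) × Space (n + 1)) × Space n =>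
      ρ x.1 * (hypDens σ x.1 x.2.1 x.2.2 * Ψ (x.2.1.1, x.2.1.2, hypMom σ x.1 x.2.1 x.2.2))) := by
    fun_prop
  have step : ∀ᵐ y : Space (n + 1) × Space (n + 1), (∫⁻ y4, Ψ (y.1, y.2, y4) *
      ρ (energy σ (y.1 - y.2 + y4) - energy σ y4 - (energy σ y.1 - energy σ y.2))) =
      ∫⁻ c, ρ c * ∫⁻ v : Space n, hypDens σ c y v * Ψ (y.1, y.2, hypMom σ c y v) := by
    filter_upwards [ae_ne] with y hy
    set ξ := y.1 - y.2 with hξ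
    have hξ0 : ξ ≠ 0 := sub_ne_zero.2 hy
    set t := energy σ y.1 - energy σ y.2 with ht
    -- Centring the second pair at its midpoint q makes its momenta q + ξ/2 and q - ξ/2.
    rw [← lintegral_sub_right_eq_self _ ((1 / 2 : ℝ) • ξ), lintegral_hyp hσ hξ0 (by fun_prop)]
    have hswap : (∫⁻ c, ρ c * ∫⁻ v : Space n, hypDens σ c y v * Ψ (y.1, y.2, hypMom σ c y v)) =
        ∫⁻ v : Space n, ∫⁻ c, ρ c * (hypDens σ c y v * Ψ (y.1, y.2, hypMom σ c y v)) := by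
      rw [lintegral_lintegral_swap]
      · refine lintegral_congr fun c => ?_
        rw [lintegral_const_mul]
        fun_prop
      · refine Measurable.aemeasurable ?_
        exact hm3.comp (by fun_prop : Measurable fun p : Space n × ℝ => (p.2, y, p.1))
    rw [hswap]
    refine lintegral_congr fun v => ?_
    -- The translation τ = t + c replaces the energy difference by the defect.
    rw [← lintegral_indicator measurableSet_Ioo, ← lintegral_add_left_eq_self _ t]
    refine lintegral_congr fun c => ?_
    rw [hypDens, hypMom, ← ht, ← hξ]
    by_cases h : |t + c| < ‖ξ‖
    · rw [Set.indicator_of_mem (by exact abs_lt.1 h), if_pos h]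
      have e1 : ξ + (hypPt σ ξ (t + c) v - (1 / 2 : ℝ) • ξ) =
          hypPt σ ξ (t + c) v + (1 / 2 : ℝ) • ξ := by module
      rw [e1, energy_hypPt_add v hσ h, energy_hypPt_sub v hσ h]
      ring_nf
    · rw [Set.indicator_of_notMem (by exact fun h' => h (abs_lt.2 h')), if_neg h]
      simp
  rw [lintegral_congr_ae step, lintegral_lintegral_swap]
  · refine lintegral_congr fun c => ?_
    rw [hypInt, lintegral_const_mul]
    refine Measurable.lintegral_prod_right'
      (f := fun p : (Space (n + 1) × Space (n + 1)) × Space n =>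
        hypDens σ c p.1 p.2 * Ψ (p.1.1, p.1.2, hypMom σ c p.1 p.2)) ?_
    fun_prop
  · refine Measurable.aemeasurable ?_
    refine Measurable.mul (by fun_prop) ?_
    refine Measurable.lintegral_prod_right'
      (f := fun p : ((Space (n + 1) × Space (n + 1)) × ℝ) × Space n =>
        hypDens σ p.1.2 p.1.1 p.2 * Ψ (p.1.1.1, p.1.1.2, hypMom σ p.1.2 p.1.1 p.2)) ?_
    fun_prop

/-- From 4r² = e² - ‖P‖² - 4σ² comes dr = e/(4r) de. The threshold for e is the total energy of two
particles at rest in the centre of mass frame. -/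
lemma lintegral_energy_radius (hσ : 0 < σ) (P : Space (n + 1)) (H : ℝ → ℝ≥0∞) :
    ∫⁻ r in Set.Ioi 0, H r = ∫⁻ e in Set.Ioi (Real.sqrt (‖P‖ ^ 2 + 4 * σ ^ 2)),
      ENNReal.ofReal (e / (4 * cmRad σ P e)) * H (cmRad σ P e) := by
  set e₀ := Real.sqrt (‖P‖ ^ 2 + 4 * σ ^ 2) with he₀
  have he₀2 : e₀ ^ 2 = ‖P‖ ^ 2 + 4 * σ ^ 2 := Real.sq_sqrt (by positivity)
  have he₀0 : 0 < e₀ := Real.sqrt_pos.2 (by positivity)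
  have hpos : ∀ e ∈ Set.Ioi e₀, 0 < (e ^ 2 - ‖P‖ ^ 2) / 4 - σ ^ 2 := fun e he => by
    have : e₀ < e := he
    nlinarith
  have hd : ∀ e ∈ Set.Ioi e₀, HasDerivAt (cmRad σ P) (e / (4 * cmRad σ P e)) e := fun e he => by
    have h1 : HasDerivAt (fun e : ℝ => (e ^ 2 - ‖P‖ ^ 2) / 4 - σ ^ 2) (e / 2) e := by
      refine ((((hasDerivAt_id e).pow 2).sub_const (‖P‖ ^ 2)).div_const 4).sub_const (σ ^ 2)
        |>.congr_deriv ?_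
      simp only [id]
      push_cast
      ring
    refine (h1.sqrt (hpos e he).ne').congr_deriv ?_
    rw [cmRad]
    ring
  have hmono : MonotoneOn (cmRad σ P) (Set.Ioi e₀) := fun a ha b _ hab => by
    refine Real.sqrt_le_sqrt ?_
    have : e₀ < a := ha
    nlinarith
  have himg : cmRad σ P '' Set.Ioi e₀ = Set.Ioi 0 := by
    ext r
    constructor
    · rintro ⟨e, he, rfl⟩
      exact Real.sqrt_pos.2 (hpos e he)
    · intro hr
      have hr : 0 < r := hr
      refine ⟨Real.sqrt (‖P‖ ^ 2 + 4 * σ ^ 2 + 4 * r ^ 2), ?_, ?_⟩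
      · exact Real.sqrt_lt_sqrt (by positivity) (by nlinarith)
      · rw [cmRad, Real.sq_sqrt (by positivity), Real.sqrt_eq_iff_mul_self_eq_of_pos hr]
        ring
  rw [← himg, lintegral_image_eq_lintegral_deriv_mul_of_monotoneOn measurableSet_Ioi
    (fun e he => (hd e he).hasDerivWithinAt) hmono]

lemma cmRad_sq {P : Space (n + 1)} {e : ℝ}
    (he : Real.sqrt (‖P‖ ^ 2 + 4 * σ ^ 2) < e) :
    cmRad σ P e ^ 2 = (e ^ 2 - ‖P‖ ^ 2) / 4 - σ ^ 2 ∧ 0 < cmRad σ P e := by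
  have he2 := (Real.sqrt_lt' ((Real.sqrt_nonneg _).trans_lt he)).1 he
  have : 0 < (e ^ 2 - ‖P‖ ^ 2) / 4 - σ ^ 2 := by linarith
  exact ⟨Real.sq_sqrt this.le, Real.sqrt_pos.2 this⟩

lemma energy_sum_cmRad (hσ : 0 < σ) {P : Space (n + 1)} {e : ℝ}
    (he : Real.sqrt (‖P‖ ^ 2 + 4 * σ ^ 2) < e) {ω : Space (n + 1)} (hω : ‖ω‖ = 1) :
    energy σ (ellPt σ P (cmRad σ P e • ω) + (1 / 2 : ℝ) • P) +
      energy σ (ellPt σ P (cmRad σ P e • ω) - (1 / 2 : ℝ) • P) = e := by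
  have he0 := (Real.sqrt_nonneg _).trans_lt he
  rw [energy_ellPt_sum hσ, energy_sq, norm_smul, hω, mul_one, Real.norm_eq_abs, sq_abs,
    (cmRad_sq he).1, Real.sqrt_eq_iff_mul_self_eq_of_pos he0]
  ring

/-- Here (y₁, y₄) is fixed. Boosted polar coordinates turn the integral over y₂ into one over a
direction ω and the total energy e of the outgoing pair, and c is e minus the total energy of the
incoming pair. -/
lemma lintegral_defect_eq_ellInt (hσ : 0 < σ)
    {Ψ : Space (n + 1) × Space (n + 1) × Space (n + 1) → ℝ≥0∞} (hΨ : Measurable Ψ)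
    {ρ : ℝ → ℝ≥0∞} (hρ : Measurable ρ) :
    ∫⁻ y : Space (n + 1) × Space (n + 1), ∫⁻ y2, Ψ (y.1, y2, y.2) *
      ρ (energy σ (y.1 - y2 + y.2) - energy σ y.2 - (energy σ y.1 - energy σ y2)) =
    ∫⁻ c, ρ c * ellInt σ c Ψ := by
  have hm1 := measurable_ellDens (n := n) σ
  have hm2 := measurable_ellMom (n := n) σ
  have hm3 : Measurable (fun x : ℝ × (Space (n + 1) × Space (n + 1)) × Space (n + 1) =>
      ρ x.1 * (ellDens σ x.1 x.2.1 x.2.2 * Ψ (x.2.1.1, ellMom σ x.1 x.2.1 x.2.2, x.2.1.2))) := by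
    fun_prop
  have step : ∀ y : Space (n + 1) × Space (n + 1), (∫⁻ y2, Ψ (y.1, y2, y.2) *
      ρ (energy σ (y.1 - y2 + y.2) - energy σ y.2 - (energy σ y.1 - energy σ y2))) =
      ∫⁻ c, ρ c * ∫⁻ ω : Metric.sphere (0 : Space (n + 1)) 1,
        ellDens σ c y ω.1 * Ψ (y.1, ellMom σ c y ω.1, y.2) ∂(sphereMeasure n) := by
    intro y
    set P := y.1 + y.2 with hP
    set t := energy σ y.1 + energy σ y.2 with ht
    rw [← lintegral_add_right_eq_self _ ((1 / 2 : ℝ) • P), lintegral_ell hσ P (by fun_prop),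
      lintegral_polar (by fun_prop)]
    have hswap : (∫⁻ c, ρ c * ∫⁻ ω : Metric.sphere (0 : Space (n + 1)) 1,
          ellDens σ c y ω.1 * Ψ (y.1, ellMom σ c y ω.1, y.2) ∂(sphereMeasure n)) =
        ∫⁻ ω : Metric.sphere (0 : Space (n + 1)) 1, (∫⁻ c, ρ c *
          (ellDens σ c y ω.1 * Ψ (y.1, ellMom σ c y ω.1, y.2))) ∂(sphereMeasure n) := by
      rw [lintegral_lintegral_swap]
      · refine lintegral_congr fun c => ?_
        rw [lintegral_const_mul]
        fun_prop
      · refine Measurable.aemeasurable ?_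
        exact hm3.comp (by fun_prop : Measurable fun p : Metric.sphere (0 : Space (n + 1)) 1 × ℝ =>
          (p.2, y, p.1.1))
    rw [hswap]
    refine lintegral_congr fun ω => ?_
    have hω : ‖ω.1‖ = 1 := by simp
    rw [lintegral_energy_radius hσ P, ← lintegral_indicator measurableSet_Ioi,
      ← lintegral_add_left_eq_self _ t]
    refine lintegral_congr fun c => ?_
    rw [ellDens, ellMom, ← ht, ← hP]
    by_cases h : Real.sqrt (‖P‖ ^ 2 + 4 * σ ^ 2) < t + c
    · rw [Set.indicator_of_mem (by exact h), if_pos h]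
      obtain ⟨-, hr⟩ := cmRad_sq h
      have hs := energy_sum_cmRad hσ h hω
      set q := ellPt σ P (cmRad σ P (t + c) • ω.1)
      -- The remaining momentum y₃ = P - y₂ equals P/2 - q, and the energy is even.
      have e1 : y.1 - (q + (1 / 2 : ℝ) • P) + y.2 = -(q - (1 / 2 : ℝ) • P) := by
        rw [show y.1 - (q + (1 / 2 : ℝ) • P) + y.2 = P - (q + (1 / 2 : ℝ) • P) by rw [hP]; abel]
        module
      have e2 : energy σ (q - (1 / 2 : ℝ) • P) - energy σ y.2 -
          (energy σ y.1 - energy σ (q + (1 / 2 : ℝ) • P)) = c := by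
        rw [ht] at hs
        linarith
      have he0 := (Real.sqrt_nonneg _).trans_lt h
      rw [e1, energy_neg, e2, ENNReal.ofReal_mul (by positivity), ENNReal.ofReal_mul (by positivity)]
      ring
    · rw [Set.indicator_of_notMem (by exact h), if_neg h]
      simp
  rw [lintegral_congr step, lintegral_lintegral_swap]
  · refine lintegral_congr fun c => ?_
    rw [ellInt, lintegral_const_mul]
    refine Measurable.lintegral_prod_right'
      (f := fun p : (Space (n + 1) × Space (n + 1)) × Metric.sphere (0 : Space (n + 1)) 1 =>
        ellDens σ c p.1 p.2.1 * Ψ (p.1.1, ellMom σ c p.1 p.2.1, p.1.2)) ?_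
    fun_prop
  · refine Measurable.aemeasurable ?_
    refine Measurable.mul (by fun_prop) ?_
    refine Measurable.lintegral_prod_right'
      (f := fun p : ((Space (n + 1) × Space (n + 1)) × ℝ) × Metric.sphere (0 : Space (n + 1)) 1 =>
        ellDens σ p.1.2 p.1.1 p.2.1 * Ψ (p.1.1.1, ellMom σ p.1.2 p.1.1 p.2.1, p.1.1.2)) ?_
    fun_prop

lemma measurable_hypInt {Ψ : Space (n + 1) × Space (n + 1) × Space (n + 1) → ℝ≥0∞}
    (hΨ : Measurable Ψ) : Measurable (fun c => hypInt σ c Ψ) := by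
  have hm1 := measurable_hypDens (n := n) σ
  have hm2 := measurable_hypMom (n := n) σ
  refine Measurable.lintegral_prod_right' (f := fun p : ℝ × Space (n + 1) × Space (n + 1) =>
    ∫⁻ v : Space n, hypDens σ p.1 p.2 v * Ψ (p.2.1, p.2.2, hypMom σ p.1 p.2 v)) ?_
  refine Measurable.lintegral_prod_right'
    (f := fun p : (ℝ × Space (n + 1) × Space (n + 1)) × Space n =>
    hypDens σ p.1.1 p.1.2 p.2 * Ψ (p.1.2.1, p.1.2.2, hypMom σ p.1.1 p.1.2 p.2)) ?_
  fun_prop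

lemma measurable_ellInt {Ψ : Space (n + 1) × Space (n + 1) × Space (n + 1) → ℝ≥0∞}
    (hΨ : Measurable Ψ) : Measurable (fun c => ellInt σ c Ψ) := by
  have hm1 := measurable_ellDens (n := n) σ
  have hm2 := measurable_ellMom (n := n) σ
  refine Measurable.lintegral_prod_right' (f := fun p : ℝ × Space (n + 1) × Space (n + 1) =>
    ∫⁻ v : Metric.sphere (0 : Space (n + 1)) 1, ellDens σ p.1 p.2 v *
      Ψ (p.2.1, ellMom σ p.1 p.2 v, p.2.2) ∂(sphereMeasure n)) ?_
  refine Measurable.lintegral_prod_right'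
    (f := fun p : (ℝ × Space (n + 1) × Space (n + 1)) × Metric.sphere (0 : Space (n + 1)) 1 =>
    ellDens σ p.1.1 p.1.2 p.2 * Ψ (p.1.2.1, ellMom σ p.1.1 p.1.2 p.2, p.1.2.2)) ?_
  fun_prop

/-- Both sides are the density in c of one triple integral, taken in two orders by Tonelli. This
settles almost every c but says nothing about c = 0, the only value needed; continuity has to supply
it. -/
lemma hypInt_ae_eq_ellInt (hσ : 0 < σ)
    {Ψ : Space (n + 1) × Space (n + 1) × Space (n + 1) → ℝ≥0∞} (hΨ : Measurable Ψ) :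
    (fun c => hypInt σ c Ψ) =ᵐ[volume] fun c => ellInt σ c Ψ := by
  refine ae_eq_of_forall_setLIntegral_eq_of_sigmaFinite (measurable_hypInt hΨ)
    (measurable_ellInt hΨ) fun s hs _ => ?_
  have hρ : Measurable (s.indicator (1 : ℝ → ℝ≥0∞)) := measurable_one.indicator hs
  have h1 := lintegral_defect_eq_hypInt hσ hΨ hρ
  have h2 := lintegral_defect_eq_ellInt hσ hΨ hρ
  have h3 : ∀ G : ℝ → ℝ≥0∞, ∫⁻ c in s, G c = ∫⁻ c, s.indicator 1 c * G c := fun G => by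
    rw [← lintegral_indicator hs]
    refine lintegral_congr fun c => ?_
    by_cases hc : c ∈ s <;> simp [hc]
  rw [h3, h3, ← h1, ← h2]
  rw [Measure.volume_eq_prod, lintegral_prod _ (Measurable.aemeasurable ?_),
    lintegral_prod _ (Measurable.aemeasurable ?_)]
  · refine lintegral_congr fun y1 => ?_
    exact lintegral_lintegral_swap (Measurable.aemeasurable (by fun_prop))
  · refine Measurable.lintegral_prod_right'
      (f := fun p : (Space (n + 1) × Space (n + 1)) × Space (n + 1) => Ψ (p.1.1, p.2, p.1.2) *
        s.indicator (1 : ℝ → ℝ≥0∞) (energy σ (p.1.1 - p.2 + p.1.2) -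
        energy σ p.1.2 - (energy σ p.1.1 - energy σ p.2))) ?_
    fun_prop
  · refine Measurable.lintegral_prod_right'
      (f := fun p : (Space (n + 1) × Space (n + 1)) × Space (n + 1) => Ψ (p.1.1, p.1.2, p.2) *
        s.indicator (1 : ℝ → ℝ≥0∞) (energy σ (p.1.1 - p.1.2 + p.2) -
        energy σ p.2 - (energy σ p.1.1 - energy σ p.1.2))) ?_
    fun_prop

end

end

end KleinGordon

namespace KleinGordon

noncomputable section

open scoped RealInnerProductSpace
open Filter Topology

/-! ### The two disintegrations agree on the resonant set -/

/-- A weight making the disintegrations finite. -/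
def cutoff {n : ℕ} (σ : ℝ) (x : Space (n + 1) × Space (n + 1) × Space (n + 1)) : ℝ :=
  ‖x.1 - x.2.1‖ * ((energy σ x.1 * energy σ x.2.1 * energy σ (x.1 - x.2.1 + x.2.2) *
    energy σ x.2.2) ^ (n + 3))⁻¹

section

variable {n : ℕ} {σ : ℝ}

lemma cutoff_nonneg (hσ : 0 < σ) (x : Space (n + 1) × Space (n + 1) × Space (n + 1)) :
    0 ≤ cutoff σ x := by
  have h1 := energy_pos hσ x.1
  have h2 := energy_pos hσ x.2.1
  have h3 := energy_pos hσ (x.1 - x.2.1 + x.2.2)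
  have h4 := energy_pos hσ x.2.2
  rw [cutoff]; positivity

lemma cutoff_eq_zero_iff (hσ : 0 < σ) (x : Space (n + 1) × Space (n + 1) × Space (n + 1)) :
    cutoff σ x = 0 ↔ x.1 = x.2.1 := by
  have h1 := energy_pos hσ x.1
  have h2 := energy_pos hσ x.2.1
  have h3 := energy_pos hσ (x.1 - x.2.1 + x.2.2)
  have h4 := energy_pos hσ x.2.2
  rw [cutoff, mul_eq_zero, norm_eq_zero, sub_eq_zero, or_iff_left (by positivity)]

lemma continuous_cutoff (hσ : 0 < σ) :
    Continuous (cutoff σ : Space (n + 1) × Space (n + 1) × Space (n + 1) → ℝ) := by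
  unfold cutoff
  refine Continuous.mul (by fun_prop) (Continuous.inv₀ (by fun_prop) fun x => ?_)
  have h1 := energy_pos hσ x.1
  have h2 := energy_pos hσ x.2.1
  have h3 := energy_pos hσ (x.1 - x.2.1 + x.2.2)
  have h4 := energy_pos hσ x.2.2
  positivity

/-! ### Majorants, uniform in the energy defect, for the densities times the cutoff. -/

lemma lintegral_inv_energy_pow_lt_top {d k : ℕ} (hσ : 0 < σ) (hk : d < k) :
    ∫⁻ y : Space d, ENNReal.ofReal ((energy σ y ^ k)⁻¹) < ∞ := by
  have h := finite_integral_one_add_norm (E := Space d) (μ := volume) (r := k)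
    (by rw [finrank_euclideanSpace_fin]; exact_mod_cast hk)
  have hb : ∀ y : Space d, ENNReal.ofReal ((energy σ y ^ k)⁻¹) ≤
      ENNReal.ofReal ((1 / σ + 1) ^ k) * ENNReal.ofReal ((1 + ‖y‖) ^ (-(k : ℝ))) := fun y => by
    rw [← ENNReal.ofReal_mul (by positivity)]
    refine ENNReal.ofReal_le_ofReal ?_
    rw [Real.rpow_neg (by positivity), Real.rpow_natCast, ← div_eq_mul_inv, le_div_iff₀ (by positivity),
      inv_mul_le_iff₀ (pow_pos (energy_pos hσ y) _), ← mul_pow]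
    refine pow_le_pow_left₀ (by positivity) ?_ _
    have h1 := norm_le_energy σ y
    have h2 := le_energy σ y
    have : 1 ≤ energy σ y / σ := (one_le_div hσ).2 h2
    calc 1 + ‖y‖ ≤ energy σ y / σ + energy σ y := by linarith
      _ = _ := by ring
  refine (lintegral_mono hb).trans_lt ?_
  rw [lintegral_const_mul _ (by fun_prop)]
  exact ENNReal.mul_lt_top ENNReal.ofReal_lt_top h

/-- Squaring reduces this to Cauchy–Schwarz for (σ, y) and (σ, z), which is strict because these
vectors are parallel only if y = z. Strictness puts c = 0 in the interior of the region where
`hypDens` is the Jacobian. -/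
lemma abs_energy_sub_lt (hσ : 0 < σ) {y z : Space n} (h : y ≠ z) :
    |energy σ y - energy σ z| < ‖y - z‖ := by
  refine abs_lt_of_sq_lt_sq ?_ (norm_nonneg _)
  have h1 := energy_sq σ y
  have h2 := energy_sq σ z
  have h3 := energy_pos hσ y
  have h4 := energy_pos hσ z
  have h5 : 0 < ‖y - z‖ := norm_pos_iff.2 (sub_ne_zero.2 h)
  have h6 := norm_sub_sq_real y z
  have h7 := abs_le.1 (abs_real_inner_le_norm y z)
  suffices ⟪y, z⟫ + σ ^ 2 < energy σ y * energy σ z by nlinarith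
  by_contra hcon
  push Not at hcon
  have h8 : (energy σ y * energy σ z) ^ 2 = (σ ^ 2 + ‖y‖ ^ 2) * (σ ^ 2 + ‖z‖ ^ 2) := by
    rw [mul_pow, h1, h2]
  have h9 : (energy σ y * energy σ z) ^ 2 ≤ (⟪y, z⟫ + σ ^ 2) ^ 2 :=
    pow_le_pow_left₀ (by positivity) hcon 2
  have h10 : ⟪y, z⟫ ^ 2 ≤ ‖y‖ ^ 2 * ‖z‖ ^ 2 := by rw [← mul_pow]; exact sq_le_sq' h7.1 h7.2
  nlinarith [pow_pos hσ 2, pow_pos h5 2, mul_pos (pow_pos hσ 2) (pow_pos h5 2)]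

/-- The Jacobian grows like 1/‖ξ‖ as ξ → 0, which is why `cutoff` carries the factor ‖y₁ - y₂‖. With
energies X, Y ≥ σ one has (‖ξ‖² - τ²)S² ≥ σ² and ‖ξ‖S = (X + Y)/2 ≤ XY/σ, and these two bounds give
the estimate. -/
lemma norm_mul_hypJac_le (hσ : 0 < σ) {ξ : Space (n + 1)} {τ : ℝ} (v : Space n) (h : |τ| < ‖ξ‖) :
    ‖ξ‖ * hypJac σ ξ τ v ≤ (energy σ (hypPt σ ξ τ v + (1 / 2 : ℝ) • ξ) *
      energy σ (hypPt σ ξ τ v - (1 / 2 : ℝ) • ξ)) ^ 2 / σ ^ 3 := by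
  have hX := le_energy σ (hypPt σ ξ τ v + (1 / 2 : ℝ) • ξ)
  have hY := le_energy σ (hypPt σ ξ τ v - (1 / 2 : ℝ) • ξ)
  have hb : 0 < σ ^ 2 + ‖v‖ ^ 2 := by positivity
  rw [hypJac, hypJ_eq hb h]
  rw [energy_hypPt_add v hσ h] at *
  rw [energy_hypPt_sub v hσ h] at *
  have hm := sq_sub_sq_pos h
  have hS := hypS_pos hb h
  have hSm := hypS_sq_mul hb h
  set S := hypS ‖ξ‖ (σ ^ 2 + ‖v‖ ^ 2) τ
  set X := ‖ξ‖ * S + τ / 2 with hXd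
  set Y := ‖ξ‖ * S - τ / 2 with hYd
  have hX0 : 0 < X := hσ.trans_le hX
  have hY0 : 0 < Y := hσ.trans_le hY
  have h1 : ‖ξ‖ * S = (X + Y) / 2 := by rw [hXd, hYd]; ring
  have h2 : X + Y ≤ 2 * (X * Y) / σ := by
    rw [le_div_iff₀ hσ]; nlinarith
  rw [mul_div_assoc', div_le_div_iff₀ (by positivity) (by positivity)]
  have h3 : σ ^ 2 ≤ (‖ξ‖ ^ 2 - τ ^ 2) * S ^ 2 := by nlinarith [sq_nonneg ‖v‖]
  have h4 : ‖ξ‖ * S * σ ≤ X * Y := by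
    rw [h1]; rw [le_div_iff₀ hσ] at h2; linarith
  have h5 : ‖ξ‖ * (X * Y) * σ ^ 3 * S ≤ (X * Y) ^ 2 * σ ^ 2 := by
    have : ‖ξ‖ * (X * Y) * σ ^ 3 * S = (‖ξ‖ * S * σ) * ((X * Y) * σ ^ 2) := by ring
    rw [this, sq (X * Y), mul_assoc (X * Y)]
    exact mul_le_mul_of_nonneg_right h4 (by positivity)
  have h6 : ‖ξ‖ * (X * Y) * σ ^ 3 * S ≤ (X * Y) ^ 2 * ((‖ξ‖ ^ 2 - τ ^ 2) * S) * S := by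
    refine h5.trans ?_
    have := mul_le_mul_of_nonneg_left h3 (sq_nonneg (X * Y))
    linarith
  exact le_of_mul_le_mul_right h6 hS

lemma energy_le_energy_hypPt (hσ : 0 < σ) {ξ : Space (n + 1)} {τ : ℝ} (v : Space n)
    (h : |τ| < ‖ξ‖) : energy σ v ≤ energy σ (hypPt σ ξ τ v + (1 / 2 : ℝ) • ξ) ∧
      energy σ v ≤ energy σ (hypPt σ ξ τ v - (1 / 2 : ℝ) • ξ) := by
  rw [energy_hypPt_sub v hσ h, energy_hypPt_add v hσ h, ← hyp_energy_add (by positivity) h,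
    ← hyp_energy_sub (by positivity) h]
  constructor <;> exact Real.sqrt_le_sqrt (le_add_of_nonneg_right (sq_nonneg _))

/-- The Jacobian costs two of the n + 3 powers of XY. The remaining n + 1 dominate `energy σ v` to
the power 2(n + 1), integrable over ℝⁿ. The powers n + 3 of the energies of y₁ and y₂ are integrable
over ℝ^{n+1}. -/
lemma hypDens_mul_cutoff_le (hσ : 0 < σ) (c : ℝ) (y : Space (n + 1) × Space (n + 1)) (v : Space n) :
    hypDens σ c y v * ENNReal.ofReal (cutoff σ (y.1, y.2, hypMom σ c y v)) ≤
      ENNReal.ofReal (1 / σ ^ 3) * (ENNReal.ofReal ((energy σ y.1 ^ (n + 3))⁻¹) *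
        ENNReal.ofReal ((energy σ y.2 ^ (n + 3))⁻¹) *
        ENNReal.ofReal ((energy σ v ^ (2 * (n + 1)))⁻¹)) := by
  rw [hypDens]
  split_ifs with h
  · set τ := energy σ y.1 - energy σ y.2 + c with hτ
    have h1 := energy_pos hσ y.1
    have h2 := energy_pos hσ y.2
    have h5 := energy_pos hσ v
    have hJ : 0 ≤ hypJac σ (y.1 - y.2) τ v := (hypJ_pos (by positivity) h).le
    have hle := norm_mul_hypJac_le hσ v h
    obtain ⟨hvX, hvY⟩ := energy_le_energy_hypPt hσ v h
    rw [← ENNReal.ofReal_mul hJ, ← ENNReal.ofReal_mul (by positivity),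
      ← ENNReal.ofReal_mul (by positivity), ← ENNReal.ofReal_mul (by positivity)]
    refine ENNReal.ofReal_le_ofReal ?_
    rw [cutoff, hypMom, ← hτ]
    rw [show y.1 - y.2 + (hypPt σ (y.1 - y.2) τ v - (1 / 2 : ℝ) • (y.1 - y.2)) =
      hypPt σ (y.1 - y.2) τ v + (1 / 2 : ℝ) • (y.1 - y.2) by module]
    set X := energy σ (hypPt σ (y.1 - y.2) τ v + (1 / 2 : ℝ) • (y.1 - y.2))
    set Y := energy σ (hypPt σ (y.1 - y.2) τ v - (1 / 2 : ℝ) • (y.1 - y.2))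
    have hX0 : 0 < X := h5.trans_le hvX
    have hY0 : 0 < Y := h5.trans_le hvY
    have hXY : energy σ v ^ 2 ≤ X * Y := by
      rw [sq]; exact mul_le_mul hvX hvY h5.le hX0.le
    have hpow : energy σ v ^ (2 * (n + 1)) ≤ (X * Y) ^ (n + 1) := by
      rw [pow_mul]; exact pow_le_pow_left₀ (by positivity) hXY _
    calc hypJac σ (y.1 - y.2) τ v * (‖y.1 - y.2‖ *
          ((energy σ y.1 * energy σ y.2 * X * Y) ^ (n + 3))⁻¹)
        = (‖y.1 - y.2‖ * hypJac σ (y.1 - y.2) τ v) *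
          ((energy σ y.1 * energy σ y.2 * X * Y) ^ (n + 3))⁻¹ := by ring
      _ ≤ ((X * Y) ^ 2 / σ ^ 3) * ((energy σ y.1 * energy σ y.2 * X * Y) ^ (n + 3))⁻¹ :=
        mul_le_mul_of_nonneg_right hle (by positivity)
      _ = 1 / σ ^ 3 * ((energy σ y.1 ^ (n + 3))⁻¹ * (energy σ y.2 ^ (n + 3))⁻¹ *
          ((X * Y) ^ (n + 1))⁻¹) := by
        rw [show energy σ y.1 * energy σ y.2 * X * Y = energy σ y.1 * energy σ y.2 * (X * Y) by ring,
          mul_pow, mul_pow _ _ (n + 3), show n + 3 = (n + 1) + 2 by ring, pow_add (X * Y)]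
        field_simp
        ring
      _ ≤ _ := by
        gcongr
  · simp

/-- The boost factor cancels because e = 2 φ(r) `ellFac`. Apart from the energies of y₂ and y₃, only
the invariant radius r remains. The condition 1 ≤ n turns rⁿ/r into r^(n-1). -/
lemma ellDens_eq (hn : 1 ≤ n) (hσ : 0 < σ) {c : ℝ} {y : Space (n + 1) × Space (n + 1)}
    {ω : Space (n + 1)} (hω : ‖ω‖ = 1)
    (h : Real.sqrt (‖y.1 + y.2‖ ^ 2 + 4 * σ ^ 2) < energy σ y.1 + energy σ y.2 + c) :
    ellDens σ c y ω = ENNReal.ofReal (cmRad σ (y.1 + y.2) (energy σ y.1 + energy σ y.2 + c) ^ (n - 1) *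
      (energy σ (ellMom σ c y ω) * energy σ (y.1 - ellMom σ c y ω + y.2)) /
      (2 * phi σ (cmRad σ (y.1 + y.2) (energy σ y.1 + energy σ y.2 + c)))) := by
  rw [ellDens, if_pos h]
  congr 1
  obtain ⟨-, hr⟩ := cmRad_sq h
  have hs := energy_sum_cmRad hσ h hω
  set e := energy σ y.1 + energy σ y.2 + c with he
  set P := y.1 + y.2 with hP
  set r := cmRad σ P e with hrd
  have hE : energy σ (r • ω) = phi σ r := by
    rw [energy, norm_smul, hω, mul_one, Real.norm_eq_abs, phi, phi, sq_abs]
  have hE0 : 0 < phi σ r := hE ▸ energy_pos hσ _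
  have hT0 := ellFac_pos hσ P (r • ω)
  have hET : e = 2 * (phi σ r * ellFac σ P (r • ω)) := by
    rw [← hs, energy_ellPt_add hσ, energy_ellPt_sub hσ, hE]; ring
  rw [ellMom, ← he, ← hP, ← hrd, show y.1 - (ellPt σ P (r • ω) + (1 / 2 : ℝ) • P) + y.2 =
    -(ellPt σ P (r • ω) - (1 / 2 : ℝ) • P) by
      rw [show y.1 - (ellPt σ P (r • ω) + (1 / 2 : ℝ) • P) + y.2 =
        P - (ellPt σ P (r • ω) + (1 / 2 : ℝ) • P) by rw [hP]; abel]
      module, energy_neg, ellJac, hE]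
  obtain ⟨m, rfl⟩ := Nat.exists_eq_add_of_le' hn
  rw [hET, Nat.add_sub_cancel, pow_succ]
  field_simp
  norm_num

/-- With X, Y the energies of y₂, y₃ one has r ≤ XY/σ and ‖y₁ - y₂‖ ≤ 2A XY/σ². At most n + 1 powers
of XY and one power of A are used up, so n + 2 powers of A are left. The bound is independent of ω,
and the sphere has finite measure. -/
lemma ellDens_mul_cutoff_le (hn : 1 ≤ n) (hσ : 0 < σ) (c : ℝ) (y : Space (n + 1) × Space (n + 1))
    {ω : Space (n + 1)} (hω : ‖ω‖ = 1) :
    ellDens σ c y ω * ENNReal.ofReal (cutoff σ (y.1, ellMom σ c y ω, y.2)) ≤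
      ENNReal.ofReal (1 / σ ^ (n + 6)) * (ENNReal.ofReal ((energy σ y.1 ^ (n + 2))⁻¹) *
        ENNReal.ofReal ((energy σ y.2 ^ (n + 3))⁻¹)) := by
  by_cases h : Real.sqrt (‖y.1 + y.2‖ ^ 2 + 4 * σ ^ 2) < energy σ y.1 + energy σ y.2 + c
  swap
  · rw [ellDens, if_neg h]; simp
  rw [ellDens_eq hn hσ hω h, cutoff]
  obtain ⟨hr2, hr⟩ := cmRad_sq h
  have hs := energy_sum_cmRad hσ h hω
  have h1 := energy_pos hσ y.1
  have h4 := energy_pos hσ y.2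
  have hx := le_energy σ y.1
  simp only
  have hsum : energy σ (ellMom σ c y ω) + energy σ (y.1 - ellMom σ c y ω + y.2) =
      energy σ y.1 + energy σ y.2 + c := by
    rw [← hs, ellMom]
    congr 1
    rw [← energy_neg]
    congr 1
    module
  have hX := le_energy σ (ellMom σ c y ω)
  have hY := le_energy σ (y.1 - ellMom σ c y ω + y.2)
  have hd : ‖y.1 - ellMom σ c y ω‖ ≤ energy σ y.1 + energy σ (ellMom σ c y ω) :=
    (norm_sub_le _ _).trans (add_le_add (norm_le_energy σ _) (norm_le_energy σ _))
  set e := energy σ y.1 + energy σ y.2 + c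
  set r := cmRad σ (y.1 + y.2) e
  set X := energy σ (ellMom σ c y ω)
  set Y := energy σ (y.1 - ellMom σ c y ω + y.2)
  set A := energy σ y.1
  set B := energy σ y.2
  have hX0 : 0 < X := hσ.trans_le hX
  have hY0 : 0 < Y := hσ.trans_le hY
  have hZ : σ ^ 2 ≤ X * Y := by rw [sq]; exact mul_le_mul hX hY hσ.le hX0.le
  have hphi : σ ≤ phi σ r := Real.le_sqrt_of_sq_le (by nlinarith [sq_nonneg r])
  have hphi0 : 0 < phi σ r := hσ.trans_le hphi
  have hrZ : r ≤ X * Y / σ := by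
    have : r ≤ e / 2 := by
      refine abs_le_of_sq_le_sq' ?_ (by linarith) |>.2
      nlinarith [sq_nonneg ‖y.1 + y.2‖, sq_nonneg σ]
    refine this.trans ?_
    rw [le_div_iff₀ hσ, ← hsum]
    nlinarith
  have hdZ : ‖y.1 - ellMom σ c y ω‖ ≤ 2 * A * (X * Y) / σ ^ 2 := by
    refine hd.trans ?_
    rw [le_div_iff₀ (by positivity)]
    have h5 : X * σ ≤ X * Y := mul_le_mul_of_nonneg_left hY hX0.le
    have h2 : σ * (X * σ) ≤ A * (X * Y) := mul_le_mul hx h5 (by positivity) h1.le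
    nlinarith [mul_le_mul_of_nonneg_left hZ h1.le]
  rw [← ENNReal.ofReal_mul (by positivity), ← ENNReal.ofReal_mul (by positivity),
    ← ENNReal.ofReal_mul (by positivity)]
  refine ENNReal.ofReal_le_ofReal ?_
  calc r ^ (n - 1) * (X * Y) / (2 * phi σ r) * (‖y.1 - ellMom σ c y ω‖ *
        ((A * X * Y * B) ^ (n + 3))⁻¹)
      ≤ (X * Y / σ) ^ (n - 1) * (X * Y) / (2 * σ) * (2 * A * (X * Y) / σ ^ 2 *
        ((A * X * Y * B) ^ (n + 3))⁻¹) := by gcongr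
    _ = 1 / σ ^ (n + 2) * ((A ^ (n + 2))⁻¹ * (B ^ (n + 3))⁻¹) * ((X * Y) ^ 2)⁻¹ := by
      obtain ⟨m, rfl⟩ := Nat.exists_eq_add_of_le' hn
      rw [Nat.add_sub_cancel]
      rw [show A * X * Y * B = A * B * (X * Y) by ring]
      generalize X * Y = Z at *
      have hZ0 : 0 < Z := (by positivity : 0 < σ ^ 2).trans_le hZ
      rw [div_pow, mul_pow, mul_pow]
      field_simp
      ring
    _ ≤ 1 / σ ^ (n + 2) * ((A ^ (n + 2))⁻¹ * (B ^ (n + 3))⁻¹) * ((σ ^ 2) ^ 2)⁻¹ := by gcongr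
    _ = _ := by
      field_simp
      ring

end

end

end KleinGordon

namespace KleinGordon

noncomputable section

open scoped RealInnerProductSpace
open Filter Topology

/-! ### Continuity at zero energy defect, and equality of the two resonant measures. -/

section

variable {n : ℕ} {σ : ℝ}

lemma continuousAt_hypJ {a b τ : ℝ} (hb : 0 < b) (h : |τ| < a) : ContinuousAt (hypJ a b) τ := by
  have h1 := sq_sub_sq_pos h
  have h2 := hypS_pos hb h
  have h3 : ContinuousAt (hypS a b) τ := by
    unfold hypS
    refine ContinuousAt.sqrt (ContinuousAt.add (ContinuousAt.div ?_ ?_ h1.ne') ?_) <;> fun_prop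
  unfold hypJ
  refine ContinuousAt.div ?_ h3 h2.ne'
  refine ContinuousAt.add (ContinuousAt.div ?_ ?_ (by positivity)) ?_ <;> fun_prop

lemma continuousAt_hypPt (hσ : 0 < σ) {ξ : Space (n + 1)} {τ : ℝ} (v : Space n) (h : |τ| < ‖ξ‖) :
    ContinuousAt (fun t => hypPt σ ξ t v) τ := by
  unfold hypPt
  refine (continuous_rot ξ).continuousAt.comp (f := fun t => join (t * hypS ‖ξ‖ (σ ^ 2 + ‖v‖ ^ 2) t) v) ?_
  refine continuous_join.continuousAt.comp (f := fun t => (t * hypS ‖ξ‖ (σ ^ 2 + ‖v‖ ^ 2) t, v)) ?_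
  exact (hasDerivAt_mul_hypS (by positivity) h).continuousAt.prodMk continuousAt_const

lemma tendsto_hypDens_mul (hσ : 0 < σ) {y : Space (n + 1) × Space (n + 1)} (hy : y.1 ≠ y.2)
    (v : Space n) {G : Space (n + 1) × Space (n + 1) × Space (n + 1) → ℝ≥0∞} (hG : Continuous G)
    (hGt : ∀ x, G x ≠ ∞) :
    Tendsto (fun c => hypDens σ c y v * G (y.1, y.2, hypMom σ c y v)) (𝓝 0)
      (𝓝 (hypDens σ 0 y v * G (y.1, y.2, hypMom σ 0 y v))) := by
  have h0 := abs_energy_sub_lt hσ hy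
  set τ := energy σ y.1 - energy σ y.2 with hτ
  have hct : Tendsto (fun c : ℝ => τ + c) (𝓝 0) (𝓝 τ) := by
    have : Continuous fun c : ℝ => τ + c := by fun_prop
    simpa using this.tendsto 0
  have hev : ∀ᶠ c in 𝓝 (0 : ℝ), |τ + c| < ‖y.1 - y.2‖ :=
    (hct.abs).eventually_lt_const h0
  have hJ : Tendsto (fun c => hypDens σ c y v) (𝓝 0) (𝓝 (hypDens σ 0 y v)) := by
    rw [show hypDens σ 0 y v = ENNReal.ofReal (hypJac σ (y.1 - y.2) τ v) by
      rw [hypDens, ← hτ, add_zero, if_pos h0]]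
    refine Tendsto.congr' (f₁ := fun c => ENNReal.ofReal (hypJac σ (y.1 - y.2) (τ + c) v)) ?_ ?_
    · filter_upwards [hev] with c hc
      rw [hypDens, ← hτ, if_pos hc]
    · exact ENNReal.tendsto_ofReal
        ((continuousAt_hypJ (by positivity : 0 < σ ^ 2 + ‖v‖ ^ 2) h0).tendsto.comp hct)
  have hM : Tendsto (fun c => hypMom σ c y v) (𝓝 0) (𝓝 (hypMom σ 0 y v)) := by
    unfold hypMom
    rw [← hτ, add_zero]
    exact ((continuousAt_hypPt hσ v h0).tendsto.comp hct).sub_const _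
  have hGM : Tendsto (fun c => G (y.1, y.2, hypMom σ c y v)) (𝓝 0)
      (𝓝 (G (y.1, y.2, hypMom σ 0 y v))) :=
    (hG.tendsto _).comp (tendsto_const_nhds.prodMk_nhds (tendsto_const_nhds.prodMk_nhds hM))
  refine ENNReal.Tendsto.mul hJ (Or.inr (hGt _)) hGM (Or.inr ?_)
  rw [hypDens]
  split_ifs <;> simp

lemma continuous_ellFac (hσ : 0 < σ) (P : Space (n + 1)) : Continuous (ellFac σ P) := by
  unfold ellFac
  refine Continuous.sqrt (Continuous.add continuous_const (Continuous.div (by fun_prop)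
    (by fun_prop) fun p => ?_))
  have := energy_pos hσ p
  positivity

lemma continuous_ellPt (hσ : 0 < σ) (P : Space (n + 1)) : Continuous (ellPt σ P) := by
  have := continuous_ellFac hσ P
  unfold ellPt
  refine (continuous_rot P).comp ?_
  fun_prop

lemma continuous_ellJac (hσ : 0 < σ) (P : Space (n + 1)) : Continuous (ellJac σ P) := by
  have h1 := continuous_ellFac hσ P
  have h2 := continuous_ellPt hσ P
  unfold ellJac
  refine Continuous.div (by fun_prop) (by fun_prop) fun p => ?_
  have := energy_pos hσ p
  have := ellFac_pos hσ P p
  positivity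

/-- Two momenta are given by the direction of their centre of mass momentum. -/
lemma exists_cm (hσ : 0 < σ) {y : Space (n + 1) × Space (n + 1)} (hy : y.1 ≠ y.2) :
    Real.sqrt (‖y.1 + y.2‖ ^ 2 + 4 * σ ^ 2) < energy σ y.1 + energy σ y.2 ∧
    ∃ ω : Space (n + 1), ‖ω‖ = 1 ∧ ellPt σ (y.1 + y.2)
      (cmRad σ (y.1 + y.2) (energy σ y.1 + energy σ y.2) • ω) + (1 / 2 : ℝ) • (y.1 + y.2) = y.1 := by
  set P := y.1 + y.2 with hP
  obtain ⟨p, hp⟩ := exists_ellPt_eq hσ P ((1 / 2 : ℝ) • (y.1 - y.2))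
  have e1 : ellPt σ P p + (1 / 2 : ℝ) • P = y.1 := by rw [hp, hP]; module
  have e2 : ellPt σ P p - (1 / 2 : ℝ) • P = -y.2 := by rw [hp, hP]; module
  have hs := energy_ellPt_sum hσ P p
  rw [e1, e2, energy_neg, energy_sq] at hs
  -- The centre of mass momentum vanishes only when the two particles have the same momentum.
  have hp0 : p ≠ 0 := by
    rintro rfl
    have : ellPt σ P 0 = 0 := by
      rw [ellPt, rot]; simp
    rw [this] at hp
    exact hy (sub_eq_zero.1 ((smul_eq_zero.1 hp.symm).resolve_left (by norm_num)))
  have hpn : 0 < ‖p‖ := norm_pos_iff.2 hp0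
  have hr : cmRad σ P (energy σ y.1 + energy σ y.2) = ‖p‖ := by
    rw [cmRad, hs, Real.sq_sqrt (by positivity), Real.sqrt_eq_iff_mul_self_eq_of_pos hpn]
    ring
  refine ⟨?_, ‖p‖⁻¹ • p, ?_, ?_⟩
  · rw [hs]
    exact Real.sqrt_lt_sqrt (by positivity) (by nlinarith)
  · rw [norm_smul, norm_inv, norm_norm, inv_mul_cancel₀ hpn.ne']
  · rw [hr, smul_smul, mul_inv_cancel₀ hpn.ne', one_smul, e1]

lemma tendsto_ellDens_mul (hσ : 0 < σ) {y : Space (n + 1) × Space (n + 1)} (hy : y.1 ≠ y.2)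
    (ω : Space (n + 1)) {G : Space (n + 1) × Space (n + 1) × Space (n + 1) → ℝ≥0∞}
    (hG : Continuous G) (hGt : ∀ x, G x ≠ ∞) :
    Tendsto (fun c => ellDens σ c y ω * G (y.1, ellMom σ c y ω, y.2)) (𝓝 0)
      (𝓝 (ellDens σ 0 y ω * G (y.1, ellMom σ 0 y ω, y.2))) := by
  obtain ⟨h0, -⟩ := exists_cm hσ hy
  set e := energy σ y.1 + energy σ y.2 with he
  set P := y.1 + y.2 with hP
  have hct : Tendsto (fun c : ℝ => e + c) (𝓝 0) (𝓝 e) := by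
    have : Continuous fun c : ℝ => e + c := by fun_prop
    simpa using this.tendsto 0
  have hev : ∀ᶠ c in 𝓝 (0 : ℝ), Real.sqrt (‖P‖ ^ 2 + 4 * σ ^ 2) < e + c :=
    hct.eventually_const_lt h0
  have hr : Tendsto (fun c => cmRad σ P (e + c)) (𝓝 0) (𝓝 (cmRad σ P e)) := by
    have : Continuous (cmRad σ P) := by unfold cmRad; fun_prop
    exact (this.tendsto e).comp hct
  have hrω : Tendsto (fun c => cmRad σ P (e + c) • ω) (𝓝 0) (𝓝 (cmRad σ P e • ω)) :=
    hr.smul_const ω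
  obtain ⟨-, hr0⟩ := cmRad_sq h0
  have hJ : Tendsto (fun c => ellDens σ c y ω) (𝓝 0) (𝓝 (ellDens σ 0 y ω)) := by
    rw [ellDens, ← he, ← hP, add_zero, if_pos h0]
    refine Tendsto.congr' (f₁ := fun c => ENNReal.ofReal ((e + c) / (4 * cmRad σ P (e + c)) *
      cmRad σ P (e + c) ^ n * ellJac σ P (cmRad σ P (e + c) • ω))) ?_ ?_
    · filter_upwards [hev] with c hc
      rw [ellDens, ← he, ← hP, if_pos hc]
    · refine ENNReal.tendsto_ofReal (((hct.div (hr.const_mul 4) ?_).mul (hr.pow n)).mul ?_)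
      · positivity
      · exact ((continuous_ellJac hσ P).tendsto _).comp hrω
  have hM : Tendsto (fun c => ellMom σ c y ω) (𝓝 0) (𝓝 (ellMom σ 0 y ω)) := by
    unfold ellMom
    rw [← he, ← hP, add_zero]
    exact (((continuous_ellPt hσ P).tendsto _).comp hrω).add_const _
  have hGM : Tendsto (fun c => G (y.1, ellMom σ c y ω, y.2)) (𝓝 0)
      (𝓝 (G (y.1, ellMom σ 0 y ω, y.2))) :=
    (hG.tendsto _).comp (tendsto_const_nhds.prodMk_nhds (hM.prodMk_nhds tendsto_const_nhds))
  refine ENNReal.Tendsto.mul hJ (Or.inr (hGt _)) hGM (Or.inr ?_)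
  rw [ellDens]
  split_ifs <;> simp

lemma hypInt_eq_prod {c : ℝ} {Ψ : Space (n + 1) × Space (n + 1) × Space (n + 1) → ℝ≥0∞}
    (hΨ : Measurable Ψ) : hypInt σ c Ψ = ∫⁻ x : (Space (n + 1) × Space (n + 1)) × Space n,
      hypDens σ c x.1 x.2 * Ψ (x.1.1, x.1.2, hypMom σ c x.1 x.2) := by
  have hm1 := measurable_hypDens (n := n) σ
  have hm2 := measurable_hypMom (n := n) σ
  rw [hypInt, Measure.volume_eq_prod (Space (n + 1) × Space (n + 1)) (Space n),
    lintegral_prod _ (Measurable.aemeasurable (by fun_prop))]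

lemma ellInt_eq_prod {c : ℝ} {Ψ : Space (n + 1) × Space (n + 1) × Space (n + 1) → ℝ≥0∞}
    (hΨ : Measurable Ψ) : ellInt σ c Ψ =
      ∫⁻ x : (Space (n + 1) × Space (n + 1)) × Metric.sphere (0 : Space (n + 1)) 1,
      ellDens σ c x.1 x.2.1 * Ψ (x.1.1, ellMom σ c x.1 x.2.1, x.1.2)
        ∂((volume : Measure (Space (n + 1) × Space (n + 1))).prod (sphereMeasure n)) := by
  have hm1 := measurable_ellDens (n := n) σ
  have hm2 := measurable_ellMom (n := n) σ
  rw [ellInt, lintegral_prod _ (Measurable.aemeasurable (by fun_prop))]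

/-- The integrable majorant in hyperbolic coordinates. -/
lemma lintegral_hyp_majorant_lt_top (hσ : 0 < σ) :
    ∫⁻ x : (Space (n + 1) × Space (n + 1)) × Space n, ENNReal.ofReal (1 / σ ^ 3) *
      (ENNReal.ofReal ((energy σ x.1.1 ^ (n + 3))⁻¹) *
        ENNReal.ofReal ((energy σ x.1.2 ^ (n + 3))⁻¹) *
        ENNReal.ofReal ((energy σ x.2 ^ (2 * (n + 1)))⁻¹)) < ∞ := by
  rw [lintegral_const_mul _ (by fun_prop)]
  refine ENNReal.mul_lt_top ENNReal.ofReal_lt_top ?_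
  rw [Measure.volume_eq_prod, lintegral_prod_mul (f := fun y : Space (n + 1) × Space (n + 1) =>
    ENNReal.ofReal ((energy σ y.1 ^ (n + 3))⁻¹) * ENNReal.ofReal ((energy σ y.2 ^ (n + 3))⁻¹))
    (g := fun v : Space n => ENNReal.ofReal ((energy σ v ^ (2 * (n + 1)))⁻¹))
    (by fun_prop) (by fun_prop)]
  refine ENNReal.mul_lt_top ?_ (lintegral_inv_energy_pow_lt_top hσ (by lia))
  rw [Measure.volume_eq_prod, lintegral_prod_mul
    (f := fun y : Space (n + 1) => ENNReal.ofReal ((energy σ y ^ (n + 3))⁻¹))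
    (g := fun y : Space (n + 1) => ENNReal.ofReal ((energy σ y ^ (n + 3))⁻¹))
    (by fun_prop) (by fun_prop)]
  exact ENNReal.mul_lt_top (lintegral_inv_energy_pow_lt_top hσ (by lia))
    (lintegral_inv_energy_pow_lt_top hσ (by lia))

/-- The integrable majorant in elliptic coordinates. -/
lemma lintegral_ell_majorant_lt_top (hσ : 0 < σ) :
    ∫⁻ x : (Space (n + 1) × Space (n + 1)) × Metric.sphere (0 : Space (n + 1)) 1,
      ENNReal.ofReal (1 / σ ^ (n + 6)) *
      (ENNReal.ofReal ((energy σ x.1.1 ^ (n + 2))⁻¹) *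
        ENNReal.ofReal ((energy σ x.1.2 ^ (n + 3))⁻¹))
        ∂((volume : Measure (Space (n + 1) × Space (n + 1))).prod (sphereMeasure n)) < ∞ := by
  rw [lintegral_const_mul _ (by fun_prop)]
  refine ENNReal.mul_lt_top ENNReal.ofReal_lt_top ?_
  rw [lintegral_prod _ (Measurable.aemeasurable (by fun_prop))]
  simp only [lintegral_const]
  rw [lintegral_mul_const _ (by fun_prop)]
  refine ENNReal.mul_lt_top ?_ (measure_lt_top _ _)
  rw [Measure.volume_eq_prod, lintegral_prod_mul
    (f := fun y : Space (n + 1) => ENNReal.ofReal ((energy σ y ^ (n + 2))⁻¹))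
    (g := fun y : Space (n + 1) => ENNReal.ofReal ((energy σ y ^ (n + 3))⁻¹))
    (by fun_prop) (by fun_prop)]
  exact ENNReal.mul_lt_top (lintegral_inv_energy_pow_lt_top hσ (by lia))
    (lintegral_inv_energy_pow_lt_top hσ (by lia))

open scoped BoundedContinuousFunction

lemma coe_le_nnnorm {Ω : Type*} [TopologicalSpace Ω] (f : Ω →ᵇ NNReal) :
    ∃ M : NNReal, ∀ x, f x ≤ M := by
  obtain ⟨C, hC⟩ := f.bounded
  rcases isEmpty_or_nonempty Ω with h | ⟨⟨x₀⟩⟩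
  · exact ⟨0, fun x => h.elim x⟩
  refine ⟨Real.toNNReal C + f x₀, fun x => ?_⟩
  have := hC x x₀
  rw [NNReal.dist_eq] at this
  have h2 := le_abs_self ((f x : ℝ) - f x₀)
  have h3 := Real.le_coe_toNNReal C
  rw [← NNReal.coe_le_coe, NNReal.coe_add]
  linarith

lemma tendsto_hypInt (hσ : 0 < σ)
    (f : (Space (n + 1) × Space (n + 1) × Space (n + 1)) →ᵇ NNReal) :
    Tendsto (fun c => hypInt σ c (fun x => ENNReal.ofReal (cutoff σ x) * f x)) (𝓝 0)
      (𝓝 (hypInt σ 0 (fun x => ENNReal.ofReal (cutoff σ x) * f x))) := by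
  have hcut := continuous_cutoff (n := n) hσ
  have hf : Continuous fun x => ((f x : NNReal) : ℝ≥0∞) :=
    ENNReal.continuous_coe.comp f.continuous
  have hcm := hcut.measurable
  have hfm := hf.measurable
  have hG : Continuous fun x => ENNReal.ofReal (cutoff σ x) * (f x : ℝ≥0∞) := by
    have : Continuous fun x => ((Real.toNNReal (cutoff σ x) * f x : NNReal) : ℝ≥0∞) :=
      ENNReal.continuous_coe.comp ((continuous_real_toNNReal.comp hcut).mul f.continuous)
    simpa only [ENNReal.coe_mul] using! this
  have hm1 := measurable_hypDens (n := n) σ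
  have hm2 := measurable_hypMom (n := n) σ
  simp only [hypInt_eq_prod hG.measurable]
  obtain ⟨M, hM⟩ := coe_le_nnnorm f
  refine tendsto_lintegral_filter_of_dominated_convergence
    (fun x => (M : ℝ≥0∞) * (ENNReal.ofReal (1 / σ ^ 3) *
      (ENNReal.ofReal ((energy σ x.1.1 ^ (n + 3))⁻¹) *
        ENNReal.ofReal ((energy σ x.1.2 ^ (n + 3))⁻¹) *
        ENNReal.ofReal ((energy σ x.2 ^ (2 * (n + 1)))⁻¹)))) ?_ ?_ ?_ ?_
  · exact Eventually.of_forall fun c => by fun_prop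
  · refine Eventually.of_forall fun c => Eventually.of_forall fun x => ?_
    rw [← mul_assoc, mul_comm]
    exact mul_le_mul' (by exact_mod_cast hM _) (hypDens_mul_cutoff_le hσ c x.1 x.2)
  · rw [lintegral_const_mul _ (by fun_prop)]
    exact (ENNReal.mul_lt_top ENNReal.coe_lt_top (lintegral_hyp_majorant_lt_top hσ)).ne
  · have : ∀ᵐ x : (Space (n + 1) × Space (n + 1)) × Space n, x.1.1 ≠ x.1.2 :=
      Measure.quasiMeasurePreserving_fst.ae ae_ne
    filter_upwards [this] with x hx
    exact tendsto_hypDens_mul hσ hx x.2 hG fun x => by finiteness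

lemma tendsto_ellInt (hn : 1 ≤ n) (hσ : 0 < σ)
    (f : (Space (n + 1) × Space (n + 1) × Space (n + 1)) →ᵇ NNReal) :
    Tendsto (fun c => ellInt σ c (fun x => ENNReal.ofReal (cutoff σ x) * f x)) (𝓝 0)
      (𝓝 (ellInt σ 0 (fun x => ENNReal.ofReal (cutoff σ x) * f x))) := by
  have hcut := continuous_cutoff (n := n) hσ
  have hf : Continuous fun x => ((f x : NNReal) : ℝ≥0∞) :=
    ENNReal.continuous_coe.comp f.continuous
  have hcm := hcut.measurable
  have hfm := hf.measurable
  have hG : Continuous fun x => ENNReal.ofReal (cutoff σ x) * (f x : ℝ≥0∞) := by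
    have : Continuous fun x => ((Real.toNNReal (cutoff σ x) * f x : NNReal) : ℝ≥0∞) :=
      ENNReal.continuous_coe.comp ((continuous_real_toNNReal.comp hcut).mul f.continuous)
    simpa only [ENNReal.coe_mul] using! this
  have hm1 := measurable_ellDens (n := n) σ
  have hm2 := measurable_ellMom (n := n) σ
  simp only [ellInt_eq_prod hG.measurable]
  obtain ⟨M, hM⟩ := coe_le_nnnorm f
  refine tendsto_lintegral_filter_of_dominated_convergence
    (fun x => (M : ℝ≥0∞) * (ENNReal.ofReal (1 / σ ^ (n + 6)) *
      (ENNReal.ofReal ((energy σ x.1.1 ^ (n + 2))⁻¹) *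
        ENNReal.ofReal ((energy σ x.1.2 ^ (n + 3))⁻¹)))) ?_ ?_ ?_ ?_
  · exact Eventually.of_forall fun c => by fun_prop
  · refine Eventually.of_forall fun c => Eventually.of_forall fun x => ?_
    rw [← mul_assoc, mul_comm]
    exact mul_le_mul' (by exact_mod_cast hM _) (ellDens_mul_cutoff_le hn hσ c x.1 (by simp))
  · rw [lintegral_const_mul _ (by fun_prop)]
    exact (ENNReal.mul_lt_top ENNReal.coe_lt_top (lintegral_ell_majorant_lt_top hσ)).ne
  · have : ∀ᵐ x ∂((volume : Measure (Space (n + 1) × Space (n + 1))).prod (sphereMeasure n)),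
        x.1.1 ≠ x.1.2 := Measure.quasiMeasurePreserving_fst.ae ae_ne
    filter_upwards [this] with x hx
    exact tendsto_ellDens_mul hσ hx x.2 hG fun x => by finiteness

/-- A set of full measure is dense, so 0 is approached by points where the two functions agree. -/
lemma eq_of_ae_eq_of_tendsto {F G : ℝ → ℝ≥0∞} (h : F =ᵐ[volume] G) (hF : Tendsto F (𝓝 0) (𝓝 (F 0)))
    (hG : Tendsto G (𝓝 0) (𝓝 (G 0))) : F 0 = G 0 := by
  have hd : Dense {c | F c = G c} := Measure.dense_of_ae h
  have hne : (𝓝[{c | F c = G c}] (0 : ℝ)).NeBot := mem_closure_iff_nhdsWithin_neBot.1 (hd 0)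
  refine tendsto_nhds_unique (l := 𝓝[{c | F c = G c}] (0 : ℝ)) (hF.mono_left nhdsWithin_le_nhds)
    ((hG.mono_left nhdsWithin_le_nhds).congr' ?_)
  filter_upwards [self_mem_nhdsWithin] with c hc using Eq.symm hc

lemma lintegral_map_withDensity {α β : Type*} [MeasurableSpace α] [MeasurableSpace β]
    {μ : Measure α} {D : α → ℝ≥0∞} {T : α → β} {Φ : β → ℝ≥0∞} (hD : Measurable D)
    (hT : Measurable T) (hΦ : Measurable Φ) :
    ∫⁻ x, Φ x ∂((μ.withDensity D).map T) = ∫⁻ x, D x * Φ (T x) ∂μ := by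
  rw [lintegral_map hΦ hT]
  exact lintegral_withDensity_eq_lintegral_mul _ hD (hΦ.comp hT)

/-- The measure on resonant triples `(y₁, y₂, y₄)` given by hyperbolic coordinates. -/
def hypMeasure (n : ℕ) (σ : ℝ) : Measure (Space (n + 1) × Space (n + 1) × Space (n + 1)) :=
  ((volume : Measure ((Space (n + 1) × Space (n + 1)) × Space n)).withDensity
    (fun x => hypDens σ 0 x.1 x.2)).map (fun x => (x.1.1, x.1.2, hypMom σ 0 x.1 x.2))

/-- The measure on resonant triples `(y₁, y₂, y₄)` given by elliptic coordinates. -/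
def ellMeasure (n : ℕ) (σ : ℝ) : Measure (Space (n + 1) × Space (n + 1) × Space (n + 1)) :=
  (((volume : Measure (Space (n + 1) × Space (n + 1))).prod (sphereMeasure n)).withDensity
    (fun x => ellDens σ 0 x.1 x.2.1)).map (fun x => (x.1.1, ellMom σ 0 x.1 x.2.1, x.1.2))

lemma lintegral_hypMeasure {Φ : Space (n + 1) × Space (n + 1) × Space (n + 1) → ℝ≥0∞}
    (hΦ : Measurable Φ) : ∫⁻ x, Φ x ∂(hypMeasure n σ) = hypInt σ 0 Φ := by
  have h1 := measurable_hypDens (n := n) σ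
  have h2 := measurable_hypMom (n := n) σ
  rw [hypMeasure, hypInt_eq_prod hΦ]
  refine lintegral_map_withDensity ?_ ?_ hΦ <;> fun_prop

lemma lintegral_ellMeasure {Φ : Space (n + 1) × Space (n + 1) × Space (n + 1) → ℝ≥0∞}
    (hΦ : Measurable Φ) : ∫⁻ x, Φ x ∂(ellMeasure n σ) = ellInt σ 0 Φ := by
  have h1 := measurable_ellDens (n := n) σ
  have h2 := measurable_ellMom (n := n) σ
  rw [ellMeasure, ellInt_eq_prod hΦ]
  refine lintegral_map_withDensity ?_ ?_ hΦ <;> fun_prop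

/-- Bounded continuous functions determine the finite measure κμ, so κμ = κν. Dividing by κ recovers
the integral of Ψ, the zeros of κ being harmless because Ψ vanishes there. -/
lemma eq_of_lintegral_mul_eq {Ω : Type*} [TopologicalSpace Ω] [MeasurableSpace Ω] [BorelSpace Ω]
    [HasOuterApproxClosed Ω] {μ ν : Measure Ω} {κ Ψ : Ω → ℝ≥0∞} (hκ : Measurable κ)
    (hfin : ∫⁻ x, κ x ∂μ ≠ ∞)
    (h : ∀ f : Ω →ᵇ NNReal, ∫⁻ x, κ x * f x ∂μ = ∫⁻ x, κ x * f x ∂ν)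
    (hΨ : Measurable Ψ) (hκt : ∀ x, κ x ≠ ∞) (h0 : ∀ x, κ x = 0 → Ψ x = 0) :
    ∫⁻ x, Ψ x ∂μ = ∫⁻ x, Ψ x ∂ν := by
  have hf : IsFiniteMeasure (μ.withDensity κ) := isFiniteMeasure_withDensity hfin
  have hEq : μ.withDensity κ = ν.withDensity κ := by
    refine ext_of_forall_lintegral_eq_of_IsFiniteMeasure fun f => ?_
    have hf : Measurable fun x => ((f x : NNReal) : ℝ≥0∞) :=
      (ENNReal.continuous_coe.comp f.continuous).measurable
    rw [lintegral_withDensity_eq_lintegral_mul _ hκ hf,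
      lintegral_withDensity_eq_lintegral_mul _ hκ hf]
    exact h f
  have hdiv : ∀ x, κ x * (Ψ x / κ x) = Ψ x := fun x => by
    by_cases hx : κ x = 0
    · rw [h0 x hx]; simp
    · exact ENNReal.mul_div_cancel hx (hκt x)
  have key := congrArg (fun m => ∫⁻ x, (Ψ / κ) x ∂m) hEq
  rw [lintegral_withDensity_eq_lintegral_mul _ hκ (hΨ.div hκ),
    lintegral_withDensity_eq_lintegral_mul _ hκ (hΨ.div hκ)] at key
  simpa only [Pi.mul_apply, Pi.div_apply, hdiv] using key

/-- The two parametrisations of resonant quadruples define the same integral. -/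
theorem hypInt_eq_ellInt (hn : 1 ≤ n) (hσ : 0 < σ)
    {Ψ : Space (n + 1) × Space (n + 1) × Space (n + 1) → ℝ≥0∞} (hΨ : Measurable Ψ)
    (hdiag : ∀ x, x.1 = x.2.1 → Ψ x = 0) : hypInt σ 0 Ψ = ellInt σ 0 Ψ := by
  have hcm : Measurable fun x : Space (n + 1) × Space (n + 1) × Space (n + 1) =>
    ENNReal.ofReal (cutoff σ x) := (continuous_cutoff hσ).measurable.ennreal_ofReal
  rw [← lintegral_hypMeasure hΨ, ← lintegral_ellMeasure hΨ]
  refine eq_of_lintegral_mul_eq hcm ?_ (fun f => ?_) hΨ (fun _ => ENNReal.ofReal_ne_top)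
    fun x hx => hdiag x ?_
  · rw [lintegral_hypMeasure hcm, hypInt_eq_prod hcm]
    refine ne_top_of_le_ne_top (lintegral_hyp_majorant_lt_top hσ).ne (lintegral_mono fun x => ?_)
    exact hypDens_mul_cutoff_le hσ 0 x.1 x.2
  · have hf : Measurable fun x => ((f x : NNReal) : ℝ≥0∞) :=
      (ENNReal.continuous_coe.comp f.continuous).measurable
    have hcf : Measurable fun x => ENNReal.ofReal (cutoff σ x) * (f x : ℝ≥0∞) := hcm.mul hf
    rw [lintegral_hypMeasure hcf, lintegral_ellMeasure hcf]
    -- Equality for almost every defect becomes equality at defect 0.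
    exact eq_of_ae_eq_of_tendsto (hypInt_ae_eq_ellInt hσ hcf) (tendsto_hypInt hσ f)
      (tendsto_ellInt hn hσ f)
  · rw [ENNReal.ofReal_eq_zero] at hx
    exact (cutoff_eq_zero_iff hσ x).1 (le_antisymm hx (cutoff_nonneg hσ x))

end

end

end KleinGordon

namespace KleinGordon

noncomputable section

open scoped RealInnerProductSpace
open Filter Topology

/-! ### A spherical integral -/

/-- The power `t ^ b` of a positive number, extended by `0`. -/
def posPow (b t : ℝ) : ℝ≥0∞ := if 0 < t then ENNReal.ofReal (t ^ b) else 0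

@[fun_prop]
lemma measurable_posPow (b : ℝ) : Measurable (posPow b) := by
  unfold posPow
  exact Measurable.ite measurableSet_Ioi (by fun_prop) measurable_const

lemma posPow_mul {b s : ℝ} (hs : 0 < s) (t : ℝ) :
    posPow b (s * t) = ENNReal.ofReal (s ^ b) * posPow b t := by
  unfold posPow
  by_cases ht : 0 < t
  · rw [if_pos (mul_pos hs ht), if_pos ht, ← ENNReal.ofReal_mul (by positivity),
      Real.mul_rpow hs.le ht.le]
  · rw [if_neg (fun h => ht (pos_of_mul_pos_right h hs.le)), if_neg ht, mul_zero]

lemma posPow_of_pos {b t : ℝ} (ht : 0 < t) : posPow b t = ENNReal.ofReal (t ^ b) := if_pos ht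

/-- The value of `∫ (1 - ω·ω') ^ b dω` over the unit sphere of `ℝ^{n+1}`. -/
def sphereConst (n : ℕ) (b : ℝ) : ℝ :=
  (2 * Real.pi) ^ ((n : ℝ) / 2) * 2 ^ (b + (n : ℝ) / 2) * Real.Gamma (b + (n : ℝ) / 2) /
    Real.Gamma (n + b)

lemma lintegral_rpow_mul_exp {s k : ℝ} (hs : 0 < s) (hk : 0 < k) :
    ∫⁻ t in Set.Ioi (0 : ℝ), ENNReal.ofReal (t ^ (s - 1) * Real.exp (-(k * t))) =
      ENNReal.ofReal ((1 / k) ^ s * Real.Gamma s) := by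
  have h := Real.integral_rpow_mul_exp_neg_mul_Ioi hs hk
  rw [← h, ofReal_integral_eq_lintegral_ofReal]
  · by_contra hcon
    have := integral_undef hcon
    rw [h] at this
    have h2 := Real.Gamma_pos_of_pos hs
    have : 0 < (1 / k) ^ s * Real.Gamma s := by positivity
    linarith
  · filter_upwards [ae_restrict_mem measurableSet_Ioi] with t ht
    have : 0 < t := ht
    simp only [Pi.zero_apply]
    positivity

lemma lintegral_exp_neg_mul_sq_norm {n : ℕ} {a : ℝ} (ha : 0 < a) :
    ∫⁻ v : Space n, ENNReal.ofReal (Real.exp (-a * ‖v‖ ^ 2)) =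
      ENNReal.ofReal ((Real.pi / a) ^ ((n : ℝ) / 2)) := by
  have h := GaussianFourier.integral_rexp_neg_mul_sq_norm (V := Space n) ha
  rw [finrank_euclideanSpace_fin] at h
  rw [← h, ofReal_integral_eq_lintegral_ofReal]
  · by_contra hcon
    have := integral_undef hcon
    rw [h] at this
    have : 0 < (Real.pi / a) ^ ((n : ℝ) / 2) := by positivity
    linarith
  · exact Eventually.of_forall fun t => (Real.exp_pos _).le

/-- The substitution `a = √(ρ² + x²) - x`. -/
lemma lintegral_light_cone {ρ b : ℝ} (hρ : 0 < ρ) :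
    ∫⁻ x : ℝ, ENNReal.ofReal (Real.exp (-Real.sqrt (x ^ 2 + ρ ^ 2)) / Real.sqrt (x ^ 2 + ρ ^ 2)) *
      posPow b (Real.sqrt (x ^ 2 + ρ ^ 2) - x) =
    ∫⁻ a in Set.Ioi (0 : ℝ),
      ENNReal.ofReal (a ^ (b - 1) * Real.exp (-(1 / 2 * a)) * Real.exp (-(1 / (2 * a)) * ρ ^ 2)) := by
  -- The inverse substitution. It gives √(X² + ρ²) = (ρ²/a + a)/2, hence dX/√(X² + ρ²) = -da/a.
  set X : ℝ → ℝ := fun a => (ρ ^ 2 / a - a) / 2 with hX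
  have hsq : ∀ a, 0 < a → Real.sqrt (X a ^ 2 + ρ ^ 2) = (ρ ^ 2 / a + a) / 2 := fun a ha => by
    rw [Real.sqrt_eq_iff_mul_self_eq_of_pos (by positivity), hX]
    field_simp
    ring
  have hd : ∀ a ∈ Set.Ioi (0 : ℝ), HasDerivWithinAt X (-(ρ ^ 2 / a ^ 2 + 1) / 2) (Set.Ioi 0) a :=
    fun a ha => by
      have ha' : a ≠ 0 := ne_of_gt ha
      refine (((((hasDerivAt_const a (ρ ^ 2)).div (hasDerivAt_id a) ha').sub
        (hasDerivAt_id a)).div_const 2).congr_deriv ?_).hasDerivWithinAt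
      simp only [id]
      ring
  have hinj : Set.InjOn X (Set.Ioi 0) := fun a ha c hc hac => by
    have h1 := hsq a ha
    have h2 := hsq c hc
    rw [hac, h2] at h1
    simp only [hX] at hac
    linarith
  have himg : X '' Set.Ioi 0 = Set.univ := Set.eq_univ_of_forall fun x => by
    have h1 : |x| < Real.sqrt (x ^ 2 + ρ ^ 2) := by
      rw [← Real.sqrt_sq_eq_abs]
      exact Real.sqrt_lt_sqrt (by positivity) (by nlinarith)
    have h2 : Real.sqrt (x ^ 2 + ρ ^ 2) ^ 2 = x ^ 2 + ρ ^ 2 := Real.sq_sqrt (by positivity)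
    have h3 : 0 < Real.sqrt (x ^ 2 + ρ ^ 2) - x := by
      have := (abs_lt.1 h1).2
      linarith
    refine ⟨Real.sqrt (x ^ 2 + ρ ^ 2) - x, h3, ?_⟩
    simp only [hX]
    field_simp
    linarith
  have key := lintegral_image_eq_lintegral_abs_deriv_mul measurableSet_Ioi hd hinj
    (fun x => ENNReal.ofReal (Real.exp (-Real.sqrt (x ^ 2 + ρ ^ 2)) / Real.sqrt (x ^ 2 + ρ ^ 2)) *
      posPow b (Real.sqrt (x ^ 2 + ρ ^ 2) - x))
  rw [himg, Measure.restrict_univ] at key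
  rw [key]
  refine setLIntegral_congr_fun measurableSet_Ioi fun a ha => ?_
  have ha : 0 < a := ha
  rw [hsq a ha, show (ρ ^ 2 / a + a) / 2 - X a = a by simp only [hX]; ring, posPow_of_pos ha,
    ← ENNReal.ofReal_mul (by positivity), ← ENNReal.ofReal_mul (by positivity)]
  congr 1
  rw [show -(ρ ^ 2 / a ^ 2 + 1) / 2 = -((ρ ^ 2 / a ^ 2 + 1) / 2) by ring, abs_neg,
    abs_of_pos (by positivity), mul_assoc (a ^ (b - 1)), ← Real.exp_add, Real.rpow_sub_one ha.ne',
    show -(1 / 2 * a) + -(1 / (2 * a)) * ρ ^ 2 = -((ρ ^ 2 / a + a) / 2) by field_simp; ring]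
  field_simp

/-- The function e^{-‖p‖}/‖p‖ · (‖p‖ - ω'·p)^b is integrated over ℝ^{n+1} twice. Polar coordinates
give the spherical integral times Γ(n + b). The light-cone variable a = ‖p‖ - ω'·p makes the
dependence on the n transversal coordinates Gaussian and leaves a Gamma integral in a. -/
lemma lintegral_sphere {n : ℕ} (hn : 1 ≤ n) {b : ℝ} (hb : 0 < b + (n : ℝ) / 2)
    {ω' : Space (n + 1)} (hω' : ‖ω'‖ = 1) :
    ∫⁻ ω : Metric.sphere (0 : Space (n + 1)) 1, posPow b (1 - ⟪ω', ω.1⟫) ∂(sphereMeasure n) =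
      ENNReal.ofReal (sphereConst n b) := by
  have hn' : (1 : ℝ) ≤ n := by exact_mod_cast hn
  have hnb : 0 < (n : ℝ) + b := by linarith
  set H : Space (n + 1) → ℝ≥0∞ := fun p =>
    ENNReal.ofReal (Real.exp (-‖p‖) / ‖p‖) * posPow b (‖p‖ - ⟪ω', p⟫) with hH
  have hHm : Measurable H := by fun_prop
  have h1 : ∫⁻ p, H p = (∫⁻ ω : Metric.sphere (0 : Space (n + 1)) 1,
      posPow b (1 - ⟪ω', ω.1⟫) ∂(sphereMeasure n)) * ENNReal.ofReal (Real.Gamma (n + b)) := by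
    rw [lintegral_polar hHm, ← lintegral_mul_const _ (by fun_prop)]
    refine lintegral_congr fun ω => ?_
    have hω : ‖ω.1‖ = 1 := by simp
    have h2 := lintegral_rpow_mul_exp hnb one_pos
    rw [div_one, Real.one_rpow, one_mul] at h2
    rw [← h2, ← lintegral_const_mul _ (by fun_prop)]
    refine setLIntegral_congr_fun measurableSet_Ioi fun r hr => ?_
    have hr : 0 < r := hr
    simp only [hH]
    rw [norm_smul, hω, mul_one, Real.norm_eq_abs, abs_of_pos hr, inner_smul_right,
      show r - r * ⟪ω', ω.1⟫ = r * (1 - ⟪ω', ω.1⟫) by ring, posPow_mul hr, ← mul_assoc, ← mul_assoc,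
      ← ENNReal.ofReal_mul (by positivity), ← ENNReal.ofReal_mul (by positivity), mul_comm]
    congr 2
    rw [Real.rpow_sub_one hr.ne', Real.rpow_add hr, Real.rpow_natCast]
    field_simp
  have h2 : ∫⁻ p, H p = ENNReal.ofReal ((2 * Real.pi) ^ ((n : ℝ) / 2) * 2 ^ (b + (n : ℝ) / 2) *
      Real.Gamma (b + (n : ℝ) / 2)) := by
    rw [lintegral_rot ω' hHm]
    have hv : ∀ᵐ v : Space n, v ≠ 0 := by
      have : Nontrivial (Space n) := by
        have : Nonempty (Fin n) := ⟨⟨0, hn⟩⟩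
        infer_instance
      rw [ae_iff]
      simp
    have h3 : ∀ᵐ v : Space n, (∫⁻ x, H (rot ω' (join x v))) = ∫⁻ a in Set.Ioi (0 : ℝ),
        ENNReal.ofReal (a ^ (b - 1) * Real.exp (-(1 / 2 * a)) *
          Real.exp (-(1 / (2 * a)) * ‖v‖ ^ 2)) := by
      filter_upwards [hv] with v hv
      rw [← lintegral_light_cone (norm_pos_iff.2 hv)]
      refine lintegral_congr fun x => ?_
      have : ‖join x v‖ = Real.sqrt (x ^ 2 + ‖v‖ ^ 2) := by
        rw [← norm_join_sq, Real.sqrt_sq (norm_nonneg _)]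
      simp only [hH]
      rw [inner_rot_join, hω', one_mul, norm_rot, this]
    rw [lintegral_congr_ae h3, lintegral_lintegral_swap (Measurable.aemeasurable (by fun_prop))]
    have h4 : ∀ a ∈ Set.Ioi (0 : ℝ), (∫⁻ v : Space n, ENNReal.ofReal (a ^ (b - 1) *
        Real.exp (-(1 / 2 * a)) * Real.exp (-(1 / (2 * a)) * ‖v‖ ^ 2))) =
        ENNReal.ofReal ((2 * Real.pi) ^ ((n : ℝ) / 2)) *
          ENNReal.ofReal (a ^ (b + (n : ℝ) / 2 - 1) * Real.exp (-(1 / 2 * a))) := fun a ha => by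
      have ha : 0 < a := ha
      simp_rw [ENNReal.ofReal_mul (show 0 ≤ a ^ (b - 1) * Real.exp (-(1 / 2 * a)) by positivity)]
      rw [lintegral_const_mul _ (by fun_prop), lintegral_exp_neg_mul_sq_norm (by positivity),
        ← ENNReal.ofReal_mul (by positivity), ← ENNReal.ofReal_mul (by positivity)]
      congr 1
      rw [show Real.pi / (1 / (2 * a)) = (2 * Real.pi) * a by field_simp,
        Real.mul_rpow (by positivity) ha.le, show b + (n : ℝ) / 2 - 1 = (b - 1) + (n : ℝ) / 2 by ring,
        Real.rpow_add ha]
      ring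
    rw [setLIntegral_congr_fun measurableSet_Ioi h4, lintegral_const_mul _ (by fun_prop),
      lintegral_rpow_mul_exp hb (by norm_num), ← ENNReal.ofReal_mul (by positivity)]
    congr 1
    norm_num
    ring
  have hG := Real.Gamma_pos_of_pos hnb
  rw [h2] at h1
  rw [sphereConst, ENNReal.ofReal_div_of_pos hG, h1, ENNReal.mul_div_cancel_right]
  · simpa using hG
  · simp

lemma sphereConst_pos {n : ℕ} (hn : 1 ≤ n) {b : ℝ} (hb : 0 < b + (n : ℝ) / 2) :
    0 < sphereConst n b := by
  have hn' : (1 : ℝ) ≤ n := by exact_mod_cast hn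
  have h1 := Real.Gamma_pos_of_pos hb
  have h2 := Real.Gamma_pos_of_pos (show 0 < (n : ℝ) + b by linarith)
  have := Real.pi_pos
  unfold sphereConst
  positivity

/-- The kernel of the sharp bilinear estimate. -/
def kernel {n : ℕ} (σ b : ℝ) (y : Space (n + 1) × Space (n + 1)) : ℝ :=
  cmRad σ (y.1 + y.2) (energy σ y.1 + energy σ y.2) ^ (n - 1) /
    (2 * phi σ (cmRad σ (y.1 + y.2) (energy σ y.1 + energy σ y.2))) *
    (2 * cmRad σ (y.1 + y.2) (energy σ y.1 + energy σ y.2) ^ 2) ^ b * sphereConst n b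

/-- If ω₁ is the centre of mass direction of y₁, the invariance in `interval_ellPt` makes the null
form weight equal to (2r²(1 - ω₁·ω))^b. The factor (φ₂φ₃)⁻¹ cancels the energies in `ellDens_eq`, so
only the spherical integral depends on ω. -/
lemma ellInt_bilinear {n : ℕ} (hn : 1 ≤ n) {σ : ℝ} (hσ : 0 < σ) {b : ℝ} (hb : 0 < b + (n : ℝ) / 2)
    (H : Space (n + 1) × Space (n + 1) → ℝ≥0∞) :
    ellInt σ 0 (fun x => H (x.1, x.2.2) *
      posPow b (‖x.1 - x.2.1‖ ^ 2 - (energy σ x.1 - energy σ x.2.1) ^ 2) *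
      ENNReal.ofReal ((energy σ x.2.1 * energy σ (x.1 - x.2.1 + x.2.2))⁻¹)) =
    ∫⁻ y, H y * ENNReal.ofReal (kernel σ b y) := by
  unfold ellInt
  refine lintegral_congr_ae ?_
  filter_upwards [ae_ne] with y hy
  obtain ⟨h0, ω₁, hω₁, hy1⟩ := exists_cm hσ hy
  have hsc := sphereConst_pos hn hb
  rw [kernel, ENNReal.ofReal_mul' hsc.le, ← lintegral_sphere hn hb hω₁, ← mul_assoc,
    ← lintegral_const_mul _ (by fun_prop)]
  refine lintegral_congr fun ω => ?_
  have hω : ‖ω.1‖ = 1 := by simp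
  have h00 : Real.sqrt (‖y.1 + y.2‖ ^ 2 + 4 * σ ^ 2) < energy σ y.1 + energy σ y.2 + 0 := by
    rwa [add_zero]
  rw [ellDens_eq hn hσ hω h00]
  have hX := energy_pos hσ (ellMom σ 0 y ω.1)
  have hY := energy_pos hσ (y.1 - ellMom σ 0 y ω.1 + y.2)
  obtain ⟨-, hr⟩ := cmRad_sq h0
  have hint : ‖y.1 - ellMom σ 0 y ω.1‖ ^ 2 - (energy σ y.1 - energy σ (ellMom σ 0 y ω.1)) ^ 2 =
      2 * cmRad σ (y.1 + y.2) (energy σ y.1 + energy σ y.2) ^ 2 * (1 - ⟪ω₁, ω.1⟫) := by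
    have h := interval_ellPt hσ (y.1 + y.2)
      (p := cmRad σ (y.1 + y.2) (energy σ y.1 + energy σ y.2) • ω₁)
      (p' := cmRad σ (y.1 + y.2) (energy σ y.1 + energy σ y.2) • ω.1) (by
        rw [norm_smul, norm_smul, hω, hω₁])
    rw [hy1] at h
    rw [ellMom, add_zero]
    have e1 : ∀ z : Space (n + 1), ‖y.1 - (z + (1 / 2 : ℝ) • (y.1 + y.2))‖ =
        ‖ellPt σ (y.1 + y.2) (cmRad σ (y.1 + y.2) (energy σ y.1 + energy σ y.2) • ω₁) - z‖ := fun z => by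
      conv_lhs => rw [← hy1]
      rw [hy1]
      congr 1
      rw [eq_sub_of_add_eq hy1]
      abel
    rw [e1, h, ← smul_sub, norm_smul, mul_pow, Real.norm_eq_abs, sq_abs, norm_sub_sq_real, hω, hω₁]
    ring
  simp only [Prod.mk.eta]
  rw [hint, posPow_mul (by positivity), add_zero]
  have hphi : 0 < phi σ (cmRad σ (y.1 + y.2) (energy σ y.1 + energy σ y.2)) :=
    Real.sqrt_pos.2 (by positivity)
  set r := cmRad σ (y.1 + y.2) (energy σ y.1 + energy σ y.2)
  set X := energy σ (ellMom σ 0 y ω.1)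
  set Y := energy σ (y.1 - ellMom σ 0 y ω.1 + y.2)
  set p := posPow b (1 - ⟪ω₁, ω.1⟫)
  have e2 : r ^ (n - 1) / (2 * phi σ r) * (2 * r ^ 2) ^ b =
      r ^ (n - 1) * (X * Y) / (2 * phi σ r) * (X * Y)⁻¹ * (2 * r ^ 2) ^ b := by
    field_simp
  rw [e2, ENNReal.ofReal_mul (by positivity), ENNReal.ofReal_mul (by positivity)]
  ring

end

end KleinGordon

namespace KleinGordon

noncomputable section

open scoped RealInnerProductSpace ComplexConjugate
open Filter Topology

/-! ### The space-time Fourier transform of `|e^{itφ_s(D)} f|²` -/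

lemma phiSymbol_eq {d : ℕ} (s : ℝ) (y : Space d) :
    phiSymbol s y = 2 * Real.pi * energy (s / (2 * Real.pi)) y := by
  have hpi := Real.pi_pos
  rw [phiSymbol, phi, energy, phi, Real.sqrt_eq_iff_mul_self_eq (by positivity) (by positivity),
    mul_mul_mul_comm, Real.mul_self_sqrt (by positivity)]
  field_simp

/-- `exp (2πiθ)`. -/
def expi (θ : ℝ) : ℂ := Complex.exp (((2 * Real.pi * θ : ℝ) : ℂ) * Complex.I)

lemma norm_expi (θ : ℝ) : ‖expi θ‖ = 1 := Complex.norm_exp_ofReal_mul_I _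

@[fun_prop]
lemma continuous_expi : Continuous expi := by
  unfold expi
  fun_prop

lemma expi_add (a b : ℝ) : expi (a + b) = expi a * expi b := by
  rw [expi, expi, expi, ← Complex.exp_add]
  congr 1
  push_cast
  ring

lemma conj_expi (a : ℝ) : conj (expi a) = expi (-a) := by
  rw [expi, expi, ← Complex.exp_conj, map_mul, Complex.conj_ofReal, Complex.conj_I]
  congr 1
  push_cast
  ring

lemma integral_fourierInv_mul {V : Type*} [NormedAddCommGroup V] [InnerProductSpace ℝ V]
    [FiniteDimensional ℝ V] [MeasurableSpace V] [BorelSpace V] {f g : V → ℂ} (hf : Integrable f)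
    (hg : Integrable g) : ∫ x, 𝓕⁻ f x * g x = ∫ x, f x * 𝓕⁻ g x := by
  have := VectorFourier.integral_fourierIntegral_smul_eq_flip (L := -innerₗ V) (μ := volume)
    (ν := volume) (e := Real.fourierChar) Real.continuous_fourierChar
    (by exact (continuous_inner (𝕜 := ℝ) (E := V)).neg) hf hg
  have e1 : ∀ (k : V → ℂ) (w : V),
      VectorFourier.fourierIntegral Real.fourierChar volume (-innerₗ V) k w = 𝓕⁻ k w := fun k w => by
    rw [VectorFourier.fourierIntegral, Real.fourierInv_eq]
    simp
  have e2 : ∀ (k : V → ℂ) (w : V),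
      VectorFourier.fourierIntegral Real.fourierChar volume (-innerₗ V).flip k w = 𝓕⁻ k w :=
    fun k w => by
      rw [VectorFourier.fourierIntegral, Real.fourierInv_eq]
      simp [real_inner_comm]
  simpa only [e1, e2, smul_eq_mul] using this

lemma continuous_fourierInv {V : Type*} [NormedAddCommGroup V] [InnerProductSpace ℝ V]
    [FiniteDimensional ℝ V] [MeasurableSpace V] [BorelSpace V] {f : V → ℂ} (hf : Integrable f) :
    Continuous (𝓕⁻ f) := by
  have h : Continuous (𝓕 f) := VectorFourier.fourierIntegral_continuous Real.continuous_fourierChar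
    (by exact continuous_inner) hf
  have : 𝓕⁻ f = fun w => 𝓕 f (-w) := by
    ext w
    rw [Real.fourierInv_eq_fourier_neg]
  rw [this]
  exact h.comp continuous_neg

/-- Both sides are locally integrable and agree as distributions, because the inverse transform can
be moved onto the test function in L² and in L¹ alike. -/
lemma fourierInv_toLp_ae {d : ℕ} {h : Space d → ℂ} (h1 : Integrable h) (h2 : MemLp h 2 volume) :
    ((𝓕⁻ (h2.toLp h) : L2 d) : Space d → ℂ) =ᵐ[volume] 𝓕⁻ h := by
  refine ae_eq_of_integral_contDiff_smul_eq ((Lp.memLp _).locallyIntegrable one_le_two)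
    (continuous_fourierInv h1).locallyIntegrable fun g g_smooth g_cpt => ?_
  have hg₁ : HasCompactSupport (Complex.ofRealCLM ∘ g) := g_cpt.comp_left rfl
  have hg₂ : ContDiff ℝ ((⊤ : ℕ∞) : WithTop ℕ∞) (Complex.ofRealCLM ∘ g) := by fun_prop
  set φ : 𝓢(Space d, ℂ) := hg₁.toSchwartzMap hg₂ with hφ
  have hφx : ∀ x, φ x = (g x : ℂ) := fun x => rfl
  have e1 := congrArg (fun T => T φ) (Lp.fourierInv_toTemperedDistribution_eq (h2.toLp h))
  simp only [TemperedDistribution.fourierInv_apply, Lp.toTemperedDistribution_apply] at e1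
  have e2 : ∫ x, (𝓕⁻ φ) x • (h2.toLp h : Space d → ℂ) x = ∫ x, (𝓕⁻ φ) x * h x := by
    refine integral_congr_ae ?_
    filter_upwards [h2.coeFn_toLp] with x hx
    rw [hx, smul_eq_mul]
  have e3 : ∫ x, (𝓕⁻ φ) x * h x = ∫ x, φ x * 𝓕⁻ h x := by
    rw [SchwartzMap.fourierInv_coe]
    exact integral_fourierInv_mul φ.integrable h1
  calc ∫ x, g x • (𝓕⁻ (h2.toLp h) : L2 d) x = ∫ x, φ x • (𝓕⁻ (h2.toLp h) : L2 d) x := by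
        simp only [hφx, Complex.real_smul, smul_eq_mul]
    _ = ∫ x, φ x * 𝓕⁻ h x := by rw [← e1, e2, e3]
    _ = ∫ x, g x • 𝓕⁻ h x := by simp only [hφx, Complex.real_smul]

lemma inDomain_of_norm_le {d : ℕ} {m : Space d → ℂ} (hm : Measurable m) {C : ℝ}
    (hC : ∀ y, ‖m y‖ ≤ C) (f : L2 d) : InDomain m f := by
  refine MemLp.of_le_mul (c := C) (Lp.memLp (𝓕 f)) ?_ (Eventually.of_forall fun y => ?_)
  · exact hm.aestronglyMeasurable.mul (Lp.aestronglyMeasurable _)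
  · rw [norm_mul]
    exact mul_le_mul_of_nonneg_right (hC y) (norm_nonneg _)

/-- The symbol of the propagator. -/
def propSymbol {d : ℕ} (s t : ℝ) (y : Space d) : ℂ :=
  Complex.exp (Complex.I * ((t * phiSymbol s y : ℝ) : ℂ))

lemma propSymbol_eq {d : ℕ} (s t : ℝ) (y : Space d) :
    propSymbol s t y = expi (t * energy (s / (2 * Real.pi)) y) := by
  rw [propSymbol, expi, phiSymbol_eq, mul_comm Complex.I]
  congr 2
  push_cast
  ring

lemma norm_propSymbol {d : ℕ} (s t : ℝ) (y : Space d) : ‖propSymbol s t y‖ = 1 := by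
  rw [propSymbol_eq, norm_expi]

@[fun_prop]
lemma measurable_propSymbol {d : ℕ} (s t : ℝ) : Measurable (propSymbol s t : Space d → ℂ) := by
  have : (propSymbol s t : Space d → ℂ) = fun y => expi (t * energy (s / (2 * Real.pi)) y) :=
    funext fun y => propSymbol_eq s t y
  rw [this]
  fun_prop

lemma inDomain_propSymbol {d : ℕ} (s t : ℝ) (f : L2 d) : InDomain (propSymbol s t) f :=
  inDomain_of_norm_le (measurable_propSymbol s t) (fun y => (norm_propSymbol s t y).le) f

lemma fourier_fourierMul {d : ℕ} {m : Space d → ℂ} {f : L2 d} (h : InDomain m f) :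
    (𝓕 (fourierMul m f) : L2 d) = MemLp.toLp _ h := by
  rw [fourierMul, dif_pos h, fourier_fourierInv_eq]

lemma norm_fourierMul {d : ℕ} {m : Space d → ℂ} {f : L2 d} (h : InDomain m f) :
    ‖fourierMul m f‖ = (eLpNorm (fun ξ => m ξ * (𝓕 f : L2 d) ξ) 2 volume).toReal := by
  rw [← Lp.norm_fourier_eq, fourier_fourierMul h, Lp.norm_toLp]

lemma propagator_eq {d : ℕ} (s t : ℝ) (f : L2 d) :
    propagator s t f = 𝓕⁻ (MemLp.toLp _ (inDomain_propSymbol s t f) : L2 d) := by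
  rw [propagator, fourierMul]
  exact dif_pos (inDomain_propSymbol s t f)

lemma norm_propagator {d : ℕ} (s t : ℝ) (f : L2 d) : ‖propagator s t f‖ = ‖f‖ := by
  have h := norm_fourierMul (inDomain_propSymbol s t f)
  change ‖propagator s t f‖ = _ at h
  rw [h, ← Lp.norm_fourier_eq f, Lp.norm_def]
  congr 1
  refine eLpNorm_congr_norm_ae (Eventually.of_forall fun y => ?_)
  rw [norm_mul, norm_propSymbol, one_mul]

lemma propagator_sub {d : ℕ} (s t : ℝ) (f g : L2 d) :
    propagator s t (f - g) = propagator s t f - propagator s t g := by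
  have hsub : ∀ a b : L2 d, (𝓕 (a - b) : L2 d) = 𝓕 a - 𝓕 b := fun a b =>
    (Lp.fourierTransformₗᵢ (Space d) ℂ).map_sub a b
  have hinj : Function.Injective (fun a : L2 d => (𝓕 a : L2 d)) :=
    (Lp.fourierTransformₗᵢ (Space d) ℂ).injective
  apply hinj
  simp only [hsub]
  rw [propagator_eq, propagator_eq, propagator_eq, fourier_fourierInv_eq, fourier_fourierInv_eq,
    fourier_fourierInv_eq, ← MemLp.toLp_sub, MemLp.toLp_eq_toLp_iff]
  have := Lp.coeFn_sub (𝓕 f : L2 d) (𝓕 g)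
  rw [← hsub] at this
  filter_upwards [this] with y hy
  simp only [Pi.sub_apply, hy]
  ring

/-- The solution with integrable Fourier data `h`. -/
def waveInt {d : ℕ} (s : ℝ) (h : Space d → ℂ) (t : ℝ) (x : Space d) : ℂ :=
  ∫ y, expi (⟪y, x⟫ + t * energy (s / (2 * Real.pi)) y) * h y

lemma propagator_ae_eq {d : ℕ} (s t : ℝ) {f : L2 d} {h : Space d → ℂ} (h1 : Integrable h)
    (hf : (𝓕 f : L2 d) =ᵐ[volume] h) :
    (propagator s t f : Space d → ℂ) =ᵐ[volume] waveInt s h t := by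
  rw [propagator_eq]
  have hint : Integrable (fun y => propSymbol s t y * (𝓕 f : L2 d) y) := by
    refine (h1.congr hf.symm).bdd_mul (c := 1)
      (measurable_propSymbol s t).aestronglyMeasurable
      (Eventually.of_forall fun y => (norm_propSymbol s t y).le)
  refine (fourierInv_toLp_ae hint (inDomain_propSymbol s t f)).trans ?_
  refine Eventually.of_forall fun x => ?_
  rw [Real.fourierInv_eq', waveInt]
  refine integral_congr_ae ?_
  filter_upwards [hf] with y hy
  rw [expi_add, hy, propSymbol_eq, smul_eq_mul]
  exact (mul_assoc (expi ⟪y, x⟫) _ _).symm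

lemma norm_waveInt_sq {d : ℕ} (s : ℝ) (h : Space d → ℂ) (t : ℝ) (x : Space d) :
    ((‖waveInt s h t x‖ ^ 2 : ℝ) : ℂ) = ∫ y : Space d × Space d,
      expi (t * (energy (s / (2 * Real.pi)) y.1 - energy (s / (2 * Real.pi)) y.2) +
        ⟪x, y.1 - y.2⟫) * (h y.1 * conj (h y.2)) := by
  rw [Complex.ofReal_pow, ← Complex.mul_conj', waveInt, ← integral_conj, ← integral_prod_mul,
    ← Measure.volume_eq_prod]
  refine integral_congr_ae (Eventually.of_forall fun y => ?_)
  simp only [map_mul, conj_expi]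
  rw [show t * (energy (s / (2 * Real.pi)) y.1 - energy (s / (2 * Real.pi)) y.2) +
    ⟪x, y.1 - y.2⟫ = (⟪y.1, x⟫ + t * energy (s / (2 * Real.pi)) y.1) +
      -(⟪y.2, x⟫ + t * energy (s / (2 * Real.pi)) y.2) by
    rw [inner_sub_right, real_inner_comm, real_inner_comm y.2 x]; ring,
    expi_add (⟪y.1, x⟫ + t * energy (s / (2 * Real.pi)) y.1)]
  ring

/-- The space-time frequency of the interaction of the frequencies `y.1` and `y.2`. -/
def freq {d : ℕ} (σ : ℝ) (y : Space d × Space d) : SpaceTime d :=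
  WithLp.toLp 2 (energy σ y.1 - energy σ y.2, y.1 - y.2)

@[fun_prop]
lemma continuous_freq {d : ℕ} (σ : ℝ) : Continuous (freq σ : Space d × Space d → SpaceTime d) := by
  unfold freq
  exact (WithLp.prod_continuous_toLp 2 ℝ (Space d)).comp (by fun_prop)

lemma inner_freq {d : ℕ} (σ : ℝ) (z : SpaceTime d) (y : Space d × Space d) :
    ⟪z, freq σ y⟫ = z.fst * (energy σ y.1 - energy σ y.2) + ⟪z.snd, y.1 - y.2⟫ := by
  rw [WithLp.prod_inner_apply]
  simp [freq, mul_comm]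

lemma integrable_tensor {d : ℕ} {h : Space d → ℂ} (h1 : Integrable h) :
    Integrable (fun y : Space d × Space d => h y.1 * conj (h y.2)) := by
  have h2 : Integrable (fun y => conj (h y)) :=
    Complex.conjCLE.toContinuousLinearMap.integrable_comp h1
  exact h1.mul_prod h2

lemma integrable_waveInt {d : ℕ} (s : ℝ) {h : Space d → ℂ} (h1 : Integrable h)
    (Ψ : 𝓢(SpaceTime d, ℂ)) :
    Integrable (fun p : SpaceTime d × (Space d × Space d) =>
      expi ⟪p.1, freq (s / (2 * Real.pi)) p.2⟫ * (Ψ p.1 * (h p.2.1 * conj (h p.2.2)))) := by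
  refine Integrable.bdd_mul (c := 1) ?_ ?_ (Eventually.of_forall fun p => (norm_expi _).le)
  · exact Ψ.integrable.mul_prod (integrable_tensor h1)
  · exact (Continuous.aestronglyMeasurable (by fun_prop))

lemma integrable_norm_waveInt_sq {d : ℕ} (s : ℝ) {h : Space d → ℂ} (h1 : Integrable h)
    (Ψ : 𝓢(SpaceTime d, ℂ)) :
    Integrable (fun z : SpaceTime d => ((‖waveInt s h z.fst z.snd‖ ^ 2 : ℝ) : ℂ) * Ψ z) := by
  refine (integrable_waveInt s h1 Ψ).integral_prod_left.congr (Eventually.of_forall fun z => ?_)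
  simp only
  rw [norm_waveInt_sq, ← integral_mul_const]
  refine integral_congr_ae (Eventually.of_forall fun y => ?_)
  simp only [inner_freq]
  ring

/-- |u|² is a superposition of exponentials of frequency `freq`. Integrating each against 𝓕ψ first
is Fourier inversion of ψ at that frequency. -/
lemma integral_norm_waveInt_sq {d : ℕ} (s : ℝ) {h : Space d → ℂ} (h1 : Integrable h)
    (ψ : 𝓢(SpaceTime d, ℂ)) :
    ∫ z : SpaceTime d, ((‖waveInt s h z.fst z.snd‖ ^ 2 : ℝ) : ℂ) * (𝓕 ψ) z =
      ∫ y : Space d × Space d, h y.1 * conj (h y.2) * ψ (freq (s / (2 * Real.pi)) y) := by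
  have h2 := integrable_waveInt s h1 (𝓕 ψ)
  calc ∫ z : SpaceTime d, ((‖waveInt s h z.fst z.snd‖ ^ 2 : ℝ) : ℂ) * (𝓕 ψ) z
      = ∫ z : SpaceTime d, ∫ y : Space d × Space d, expi ⟪z, freq (s / (2 * Real.pi)) y⟫ *
          ((𝓕 ψ) z * (h y.1 * conj (h y.2))) := by
        refine integral_congr_ae (Eventually.of_forall fun z => ?_)
        simp only
        rw [norm_waveInt_sq, ← integral_mul_const]
        refine integral_congr_ae (Eventually.of_forall fun y => ?_)
        simp only [inner_freq]
        ring
    _ = ∫ y : Space d × Space d, ∫ z : SpaceTime d, expi ⟪z, freq (s / (2 * Real.pi)) y⟫ *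
          ((𝓕 ψ) z * (h y.1 * conj (h y.2))) := integral_integral_swap h2
    _ = _ := by
        refine integral_congr_ae (Eventually.of_forall fun y => ?_)
        simp only
        have : ψ (freq (s / (2 * Real.pi)) y) =
            ∫ z, expi ⟪z, freq (s / (2 * Real.pi)) y⟫ * (𝓕 ψ) z := by
          have e : (𝓕⁻ (𝓕 ψ : 𝓢(SpaceTime d, ℂ)) : 𝓢(SpaceTime d, ℂ)) = ψ :=
            fourierInv_fourier_eq ψ
          conv_lhs => rw [← e, SchwartzMap.fourierInv_coe, Real.fourierInv_eq']
          rfl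
        rw [this, ← integral_const_mul]
        refine integral_congr_ae (Eventually.of_forall fun z => ?_)
        simp only
        ring

lemma integrable_spaceTime_prod {d : ℕ} {G : SpaceTime d → ℂ} (hG : Integrable G) :
    Integrable (fun p : ℝ × Space d => G (WithLp.toLp 2 p)) (volume.prod volume) :=
  (WithLp.volume_preserving_toLp ℝ (Space d)).integrable_comp_of_integrable hG

lemma integral_spaceTime {d : ℕ} {G : SpaceTime d → ℂ} (hG : Integrable G) :
    ∫ t : ℝ, ∫ x : Space d, G (WithLp.toLp 2 (t, x)) = ∫ z, G z := by
  rw [← (WithLp.volume_preserving_toLp ℝ (Space d)).integral_comp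
    (MeasurableEquiv.toLp 2 (ℝ × Space d)).measurableEmbedding G]
  exact (integral_prod _ (integrable_spaceTime_prod hG)).symm

end

end KleinGordon

namespace KleinGordon

noncomputable section

open scoped RealInnerProductSpace ComplexConjugate
open Filter Topology

/-! ### Extension of the Fourier formula from Schwartz data to all of L². -/

lemma modSqPairing_of_integrable {d : ℕ} (s : ℝ) {f : L2 d} {h : Space d → ℂ}
    (h1 : Integrable h) (hf : (𝓕 f : L2 d) =ᵐ[volume] h) (ψ : 𝓢(SpaceTime d, ℂ)) :
    modSqPairing s f (𝓕 ψ) =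
      ∫ y : Space d × Space d, h y.1 * conj (h y.2) * ψ (freq (s / (2 * Real.pi)) y) := by
  rw [← integral_norm_waveInt_sq s h1 ψ, ← integral_spaceTime (integrable_norm_waveInt_sq s h1 _)]
  unfold modSqPairing
  congr 1 with t
  refine integral_congr_ae ?_
  filter_upwards [propagator_ae_eq s t h1 hf] with x hx
  simp only [hx]
  rfl

lemma exists_norm_le_one_add_rpow {V : Type*} [NormedAddCommGroup V] [NormedSpace ℝ V]
    (ψ : 𝓢(V, ℂ)) (k : ℕ) : ∃ C : ℝ, 0 ≤ C ∧ ∀ z, ‖ψ z‖ ≤ C * (1 + ‖z‖) ^ (-(k : ℝ)) := by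
  refine ⟨2 ^ k * ((Finset.Iic (k, 0)).sup fun m => SchwartzMap.seminorm ℝ m.1 m.2) ψ,
    by positivity, fun z => ?_⟩
  have := SchwartzMap.one_add_le_sup_seminorm_apply (𝕜 := ℝ) (m := (k, 0)) (k := k) (n := 0) le_rfl
    le_rfl ψ z
  rw [norm_iteratedFDeriv_zero] at this
  have hp : (0 : ℝ) < 1 + ‖z‖ := by positivity
  rw [Real.rpow_neg hp.le, Real.rpow_natCast, ← div_eq_mul_inv, le_div_iff₀ (by positivity)]
  linarith

lemma one_add_rpow_neg_le {a b : ℝ} (ha : 0 ≤ a) (hab : a ≤ b) (k : ℕ) :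
    (1 + b) ^ (-(k : ℝ)) ≤ (1 + a) ^ (-(k : ℝ)) :=
  Real.rpow_le_rpow_of_nonpos (by positivity) (by linarith) (by simp)

lemma integral_norm_mul_norm_le {α : Type*} [MeasurableSpace α] {μ : Measure α} {f g : α → ℂ}
    (hf : MemLp f 2 μ) (hg : MemLp g 2 μ) :
    ∫ x, ‖f x‖ * ‖g x‖ ∂μ ≤ (eLpNorm f 2 μ).toReal * (eLpNorm g 2 μ).toReal := by
  have h := integral_mul_norm_le_Lp_mul_Lq (f := f) (g := g) (p := 2) (q := 2) (μ := μ)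
    Real.HolderConjugate.two_two (by simpa using hf) (by simpa using hg)
  have e : ∀ {k : α → ℂ}, MemLp k 2 μ → (∫ x, ‖k x‖ ^ (2 : ℝ) ∂μ) ^ (1 / (2 : ℝ)) =
      (eLpNorm k 2 μ).toReal := fun {k} hk => by
    rw [hk.eLpNorm_eq_integral_rpow_norm (by simp) (by simp), ENNReal.toReal_ofReal (by positivity)]
    simp
  rwa [e hf, e hg] at h

/-- The pairing at time `t`. -/
def modSqSlice {d : ℕ} (u : L2 d) (φ : Space d → ℂ) : ℂ := ∫ x, ((‖u x‖ ^ 2 : ℝ) : ℂ) * φ x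

lemma norm_modSqSlice_le {d : ℕ} (u : L2 d) {φ : Space d → ℂ} {M : ℝ} (hM : ∀ x, ‖φ x‖ ≤ M) :
    ‖modSqSlice u φ‖ ≤ M * ‖u‖ ^ 2 := by
  have h := integral_norm_mul_norm_le (Lp.memLp u) (Lp.memLp u)
  rw [← Lp.norm_def, ← sq] at h
  have hM0 : 0 ≤ M := (norm_nonneg _).trans (hM 0)
  have hi : Integrable (fun x => ‖u x‖ * ‖u x‖) :=
    ((Lp.memLp u).norm.integrable_mul (Lp.memLp u).norm)
  calc ‖modSqSlice u φ‖ ≤ ∫ x, M * (‖u x‖ * ‖u x‖) := by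
        refine norm_integral_le_of_norm_le (hi.const_mul M) (Eventually.of_forall fun x => ?_)
        rw [norm_mul, Complex.norm_real, Real.norm_of_nonneg (by positivity), mul_comm, sq]
        exact mul_le_mul_of_nonneg_right (hM x) (by positivity)
    _ ≤ _ := by
        rw [integral_const_mul]
        exact mul_le_mul_of_nonneg_left h hM0

lemma norm_modSqSlice_sub_le {d : ℕ} (u w : L2 d) {φ : Space d → ℂ} {M : ℝ} (hφ : Continuous φ)
    (hM : ∀ x, ‖φ x‖ ≤ M) :
    ‖modSqSlice u φ - modSqSlice w φ‖ ≤ M * (‖u - w‖ * (‖u‖ + ‖w‖)) := by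
  have hM0 : 0 ≤ M := (norm_nonneg _).trans (hM 0)
  have hint : ∀ u : L2 d, Integrable (fun x => ((‖u x‖ ^ 2 : ℝ) : ℂ) * φ x) := fun u => by
    have hi : Integrable (fun x => ‖u x‖ ^ 2) := (Lp.memLp u).integrable_norm_pow two_ne_zero
    exact (hi.ofReal (𝕜 := ℂ)).mul_bdd hφ.aestronglyMeasurable (Eventually.of_forall hM)
  have h1 := integral_norm_mul_norm_le (Lp.memLp (u - w)) (Lp.memLp u)
  have h2 := integral_norm_mul_norm_le (Lp.memLp (u - w)) (Lp.memLp w)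
  rw [← Lp.norm_def, ← Lp.norm_def] at h1 h2
  have i1 : Integrable (fun x => ‖(u - w : L2 d) x‖ * ‖u x‖) :=
    ((Lp.memLp (u - w)).norm.integrable_mul (Lp.memLp u).norm)
  have i2 : Integrable (fun x => ‖(u - w : L2 d) x‖ * ‖w x‖) :=
    ((Lp.memLp (u - w)).norm.integrable_mul (Lp.memLp w).norm)
  rw [modSqSlice, modSqSlice, ← integral_sub (hint u) (hint w)]
  calc _ ≤ ∫ x, M * (‖(u - w : L2 d) x‖ * ‖u x‖ + ‖(u - w : L2 d) x‖ * ‖w x‖) := by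
        refine norm_integral_le_of_norm_le ((i1.add i2).const_mul M) ?_
        filter_upwards [Lp.coeFn_sub u w] with x hx
        rw [hx, Pi.sub_apply, ← sub_mul, norm_mul, ← Complex.ofReal_sub, Complex.norm_real, mul_comm]
        refine mul_le_mul (hM x) ?_ (norm_nonneg _) hM0
        rw [show ‖u x‖ ^ 2 - ‖w x‖ ^ 2 = (‖u x‖ - ‖w x‖) * (‖u x‖ + ‖w x‖) by ring, norm_mul,
          Real.norm_of_nonneg (by positivity : 0 ≤ ‖u x‖ + ‖w x‖), ← mul_add]
        exact mul_le_mul_of_nonneg_right (abs_norm_sub_norm_le _ _) (by positivity)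
    _ ≤ _ := by
        rw [integral_const_mul, integral_add i1 i2, mul_add ‖u - w‖]
        exact mul_le_mul_of_nonneg_left (add_le_add h1 h2) hM0

/-- The propagator is unitary, so the time slices converge and are dominated by the decay of Ψ in t.
Measurability in t is required of the approximants only. -/
lemma tendsto_modSqPairing {d : ℕ} (s : ℝ) {f : L2 d} {u : ℕ → L2 d} (hu : Tendsto u atTop (𝓝 f))
    (Ψ : 𝓢(SpaceTime d, ℂ))
    (hm : ∀ k, AEStronglyMeasurable (fun t : ℝ =>
      modSqSlice (propagator s t (u k)) (fun x => Ψ (WithLp.toLp 2 (t, x)))) volume) :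
    Tendsto (fun k => modSqPairing s (u k) Ψ) atTop (𝓝 (modSqPairing s f Ψ)) := by
  obtain ⟨C, hC0, hC⟩ := exists_norm_le_one_add_rpow Ψ 2
  have hCt : ∀ t : ℝ, ∀ x : Space d, ‖Ψ (WithLp.toLp 2 (t, x))‖ ≤ C * (1 + ‖t‖) ^ (-((2 : ℕ) : ℝ)) :=
    fun t x => (hC _).trans <| mul_le_mul_of_nonneg_left (one_add_rpow_neg_le (norm_nonneg t)
      (WithLp.norm_fst_le (x := (WithLp.toLp 2 (t, x) : SpaceTime d))) 2) hC0
  obtain ⟨B, hB⟩ := hu.norm.bddAbove_range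
  have hB' : ∀ k, ‖u k‖ ≤ B := fun k => hB (Set.mem_range_self k)
  have hΨ : ∀ t : ℝ, Continuous fun x : Space d => Ψ (WithLp.toLp 2 (t, x)) := fun t =>
    Ψ.continuous.comp ((WithLp.prod_continuous_toLp 2 ℝ (Space d)).comp (by fun_prop))
  refine tendsto_integral_of_dominated_convergence
    (fun t : ℝ => C * (1 + ‖t‖) ^ (-((2 : ℕ) : ℝ)) * B ^ 2) hm ?_ ?_ ?_
  · exact ((integrable_one_add_norm (by simp)).const_mul C).mul_const _
  · refine fun k => Eventually.of_forall fun t => (norm_modSqSlice_le _ (hCt t)).trans ?_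
    rw [norm_propagator]
    refine mul_le_mul_of_nonneg_left ?_ (by positivity)
    exact pow_le_pow_left₀ (norm_nonneg _) (hB' k) 2
  · refine Eventually.of_forall fun t => ?_
    rw [tendsto_iff_norm_sub_tendsto_zero]
    have hlim : Tendsto (fun k => C * (1 + ‖t‖) ^ (-((2 : ℕ) : ℝ)) * (‖u k - f‖ * (‖u k‖ + ‖f‖)))
        atTop (𝓝 (C * (1 + ‖t‖) ^ (-((2 : ℕ) : ℝ)) * (0 * (‖f‖ + ‖f‖)))) :=
      ((tendsto_iff_norm_sub_tendsto_zero.1 hu).mul (hu.norm.add_const _)).const_mul _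
    rw [zero_mul, mul_zero] at hlim
    refine squeeze_zero (fun k => norm_nonneg _) (fun k => ?_) hlim
    have := norm_modSqSlice_sub_le (propagator s t (u k)) (propagator s t f) (hΨ t) (hCt t)
    rwa [← propagator_sub, norm_propagator, norm_propagator, norm_propagator] at this

/-- For each fixed difference ξ = y₁ - y₂, Cauchy–Schwarz bounds the remaining integral uniformly in
ξ. -/
lemma lintegral_tensor_mul_sub_le {d : ℕ} {f g k : Space d → ℝ≥0∞} (hf : Measurable f)
    (hg : Measurable g) (hk : Measurable k) :
    ∫⁻ y : Space d × Space d, f y.1 * g y.2 * k (y.1 - y.2) ≤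
      (∫⁻ y, k y) * ((∫⁻ y, f y ^ (2 : ℝ)) ^ (1 / (2 : ℝ)) * (∫⁻ y, g y ^ (2 : ℝ)) ^ (1 / (2 : ℝ))) := by
  have hle : ∀ ξ : Space d, ∫⁻ y, f y * g (y - ξ) ≤
      (∫⁻ y, f y ^ (2 : ℝ)) ^ (1 / (2 : ℝ)) * (∫⁻ y, g y ^ (2 : ℝ)) ^ (1 / (2 : ℝ)) := fun ξ => by
    have := ENNReal.lintegral_mul_le_Lp_mul_Lq volume Real.HolderConjugate.two_two
      (f := f) (g := fun y => g (y - ξ)) hf.aemeasurable (by fun_prop)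
    rwa [lintegral_sub_right_eq_self (fun y => g y ^ (2 : ℝ)) ξ] at this
  calc ∫⁻ y : Space d × Space d, f y.1 * g y.2 * k (y.1 - y.2)
      = ∫⁻ y : Space d, ∫⁻ z : Space d, f y * g z * k (y - z) := by
        rw [Measure.volume_eq_prod, lintegral_prod _ (by fun_prop)]
    _ = ∫⁻ y : Space d, ∫⁻ ξ : Space d, k ξ * (f y * g (y - ξ)) := by
        refine lintegral_congr fun y => ?_
        rw [← lintegral_sub_left_eq_self (fun z => f y * g z * k (y - z)) y]
        refine lintegral_congr fun ξ => ?_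
        rw [sub_sub_cancel, mul_comm]
    _ = ∫⁻ ξ : Space d, ∫⁻ y : Space d, k ξ * (f y * g (y - ξ)) :=
        lintegral_lintegral_swap (by fun_prop)
    _ = ∫⁻ ξ : Space d, k ξ * ∫⁻ y : Space d, f y * g (y - ξ) :=
        lintegral_congr fun ξ => lintegral_const_mul _ (by fun_prop)
    _ ≤ _ := by
        rw [← lintegral_mul_const _ hk]
        exact lintegral_mono fun ξ => mul_le_mul_right (hle ξ) _

lemma lintegral_enorm_rpow_two {d : ℕ} (F : L2 d) :
    (∫⁻ y, ‖F y‖ₑ ^ (2 : ℝ)) ^ (1 / (2 : ℝ)) = ENNReal.ofReal ‖F‖ := by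
  rw [Lp.norm_def, ENNReal.ofReal_toReal (Lp.memLp F).eLpNorm_ne_top,
    eLpNorm_eq_lintegral_rpow_enorm_toReal (by simp) (by simp)]
  simp

lemma measurable_L2 {d : ℕ} (F : L2 d) : Measurable F := (Lp.stronglyMeasurable F).measurable

lemma norm_sub_le_norm_freq {d : ℕ} (σ : ℝ) (y : Space d × Space d) :
    ‖y.1 - y.2‖ ≤ ‖freq σ y‖ := WithLp.norm_snd_le (x := freq σ y)

/-- Decay of ψ in the spatial difference alone suffices: order d + 1 is integrable over ℝ^d. The
pairing is thus bounded on L² × L², which allows the passage to the limit on the Fourier side. -/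
lemma exists_lintegral_freq_le {d : ℕ} (σ : ℝ) (ψ : 𝓢(SpaceTime d, ℂ)) : ∃ K : ℝ, 0 ≤ K ∧
    ∀ F G : L2 d, ∫⁻ y : Space d × Space d, ‖F y.1 * conj (G y.2) * ψ (freq σ y)‖ₑ ≤
      ENNReal.ofReal (K * (‖F‖ * ‖G‖)) := by
  obtain ⟨C, hC0, hC⟩ := exists_norm_le_one_add_rpow ψ (d + 1)
  set k : Space d → ℝ := fun ξ => C * (1 + ‖ξ‖) ^ (-((d + 1 : ℕ) : ℝ)) with hk
  have hki : Integrable k := (integrable_one_add_norm (by simp)).const_mul C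
  have hk0 : ∀ ξ, 0 ≤ k ξ := fun ξ => by positivity
  refine ⟨∫ ξ, k ξ, integral_nonneg hk0, fun F G => ?_⟩
  have hF := measurable_L2 F
  have hG := measurable_L2 G
  calc _ ≤ ∫⁻ y : Space d × Space d, ‖F y.1‖ₑ * ‖G y.2‖ₑ * ENNReal.ofReal (k (y.1 - y.2)) := by
        refine lintegral_mono fun y => ?_
        rw [enorm_mul, enorm_mul, show ‖conj (G y.2)‖ₑ = ‖G y.2‖ₑ from
          enorm_eq_iff_norm_eq.2 (Complex.norm_conj _)]
        refine mul_le_mul_right ?_ _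
        rw [← ofReal_norm]
        refine ENNReal.ofReal_le_ofReal ((hC _).trans (mul_le_mul_of_nonneg_left ?_ hC0))
        exact one_add_rpow_neg_le (norm_nonneg _) (norm_sub_le_norm_freq σ y) _
    _ ≤ _ := by
        refine (lintegral_tensor_mul_sub_le (f := fun y => ‖F y‖ₑ) (g := fun y => ‖G y‖ₑ)
          (k := fun ξ => ENNReal.ofReal (k ξ)) hF.enorm hG.enorm (by fun_prop)).trans ?_
        rw [lintegral_enorm_rpow_two, lintegral_enorm_rpow_two,
          ← ofReal_integral_eq_lintegral_ofReal hki (Eventually.of_forall hk0),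
          ENNReal.ofReal_mul (integral_nonneg hk0), ENNReal.ofReal_mul (norm_nonneg _)]

lemma integrable_freq {d : ℕ} (σ : ℝ) (ψ : 𝓢(SpaceTime d, ℂ)) (F G : L2 d) :
    Integrable (fun y : Space d × Space d => F y.1 * conj (G y.2) * ψ (freq σ y)) := by
  obtain ⟨K, -, hK⟩ := exists_lintegral_freq_le σ ψ
  have hF := measurable_L2 F
  have hG := measurable_L2 G
  have hψ : Measurable fun y : Space d × Space d => ψ (freq σ y) :=
    (ψ.continuous.comp (continuous_freq σ)).measurable
  have hc : Measurable fun y : Space d × Space d => conj (G y.2) :=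
    Complex.continuous_conj.measurable.comp (hG.comp measurable_snd)
  exact ⟨(((hF.comp measurable_fst).mul hc).mul hψ).aestronglyMeasurable,
    (hK F G).trans_lt ENNReal.ofReal_lt_top⟩

/-- The Fourier side of the pairing of `|e^{itφ_s(D)} f|²` with a Schwartz function. -/
def freqPairing {d : ℕ} (σ : ℝ) (ψ : 𝓢(SpaceTime d, ℂ)) (F G : L2 d) : ℂ :=
  ∫ y : Space d × Space d, F y.1 * conj (G y.2) * ψ (freq σ y)

lemma ae_fst {d : ℕ} {p : Space d → Prop} (h : ∀ᵐ y, p y) : ∀ᵐ y : Space d × Space d, p y.1 :=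
  Measure.quasiMeasurePreserving_fst.ae h

lemma ae_snd {d : ℕ} {p : Space d → Prop} (h : ∀ᵐ y, p y) : ∀ᵐ y : Space d × Space d, p y.2 :=
  Measure.quasiMeasurePreserving_snd.ae h

lemma freqPairing_sub {d : ℕ} (σ : ℝ) (ψ : 𝓢(SpaceTime d, ℂ)) (F G : L2 d) :
    freqPairing σ ψ F F - freqPairing σ ψ G G =
      freqPairing σ ψ (F - G) F + freqPairing σ ψ G (F - G) := by
  unfold freqPairing
  rw [← integral_sub (integrable_freq σ ψ F F) (integrable_freq σ ψ G G),
    ← integral_add (integrable_freq σ ψ _ _) (integrable_freq σ ψ _ _)]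
  refine integral_congr_ae ?_
  filter_upwards [ae_fst (Lp.coeFn_sub F G), ae_snd (Lp.coeFn_sub F G)] with y h1 h2
  simp only [h1, h2, Pi.sub_apply, map_sub]
  ring

lemma tendsto_freqPairing {d : ℕ} (σ : ℝ) (ψ : 𝓢(SpaceTime d, ℂ)) {F : L2 d} {u : ℕ → L2 d}
    (hu : Tendsto u atTop (𝓝 F)) :
    Tendsto (fun k => freqPairing σ ψ (u k) (u k)) atTop (𝓝 (freqPairing σ ψ F F)) := by
  obtain ⟨K, hK0, hK⟩ := exists_lintegral_freq_le σ ψ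
  have hle : ∀ F G : L2 d, ‖freqPairing σ ψ F G‖ ≤ K * (‖F‖ * ‖G‖) := fun F G => by
    rw [← ENNReal.ofReal_le_ofReal_iff (by positivity), ofReal_norm]
    exact (enorm_integral_le_lintegral_enorm _).trans (hK F G)
  rw [tendsto_iff_norm_sub_tendsto_zero]
  have hlim : Tendsto (fun k => K * (‖u k - F‖ * ‖u k‖) + K * (‖F‖ * ‖u k - F‖)) atTop
      (𝓝 (K * (0 * ‖F‖) + K * (‖F‖ * 0))) :=
    have h0 := tendsto_iff_norm_sub_tendsto_zero.1 hu
    ((h0.mul hu.norm).const_mul K).add ((h0.const_mul ‖F‖).const_mul K)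
  simp only [zero_mul, mul_zero, add_zero] at hlim
  refine squeeze_zero (fun k => norm_nonneg _) (fun k => ?_) hlim
  rw [freqPairing_sub]
  exact (norm_add_le _ _).trans (add_le_add (hle _ _) (hle _ _))

lemma aestronglyMeasurable_modSqSlice {d : ℕ} (s : ℝ) {f : L2 d} {h : Space d → ℂ}
    (h1 : Integrable h) (hf : (𝓕 f : L2 d) =ᵐ[volume] h) (Ψ : 𝓢(SpaceTime d, ℂ)) :
    AEStronglyMeasurable (fun t : ℝ =>
      modSqSlice (propagator s t f) (fun x => Ψ (WithLp.toLp 2 (t, x)))) volume := by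
  refine (integrable_spaceTime_prod
    (integrable_norm_waveInt_sq s h1 Ψ)).integral_prod_left.aestronglyMeasurable.congr
      (Eventually.of_forall fun t => ?_)
  refine integral_congr_ae ?_
  filter_upwards [propagator_ae_eq s t h1 hf] with x hx
  simp only [hx]
  rfl

/-- The space-time Fourier transform of `|e^{itφ_s(D)} f|²` as a distribution. -/
theorem modSqPairing_fourier {d : ℕ} (s : ℝ) (f : L2 d) (ψ : 𝓢(SpaceTime d, ℂ)) :
    modSqPairing s f (𝓕 ψ) = freqPairing (s / (2 * Real.pi)) ψ (𝓕 f) (𝓕 f) := by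
  have hd : DenseRange (SchwartzMap.toLpCLM ℝ ℂ 2 (volume : Measure (Space d))) :=
    SchwartzMap.denseRange_toLpCLM (by simp)
  obtain ⟨u, hur, hu⟩ := mem_closure_iff_seq_limit.1 (hd f)
  choose φ hφ using hur
  have hF : ∀ k, (𝓕 (u k) : L2 d) =ᵐ[volume] (𝓕 (φ k) : 𝓢(Space d, ℂ)) := fun k => by
    rw [← hφ k]
    change (𝓕 ((φ k).toLp 2 : L2 d) : L2 d) =ᵐ[volume] _
    rw [SchwartzMap.toLp_fourier_eq]
    exact SchwartzMap.coeFn_toLp _ _ _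
  have hi : ∀ k, Integrable (𝓕 (φ k) : 𝓢(Space d, ℂ)) := fun k => SchwartzMap.integrable _
  have hL := tendsto_modSqPairing s hu (𝓕 ψ) fun k =>
    aestronglyMeasurable_modSqSlice s (hi k) (hF k) _
  have hFu : Tendsto (fun k => (𝓕 (u k) : L2 d)) atTop (𝓝 (𝓕 f)) :=
    ((Lp.fourierTransformₗᵢ (Space d) ℂ).continuous.tendsto f).comp hu
  have hR := tendsto_freqPairing (s / (2 * Real.pi)) ψ hFu
  refine tendsto_nhds_unique hL (hR.congr fun k => ?_)
  rw [modSqPairing_of_integrable s (hi k) (hF k), freqPairing]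
  refine integral_congr_ae ?_
  filter_upwards [ae_fst (hF k), ae_snd (hF k)] with y h1 h2
  rw [h1, h2]

end

end KleinGordon

namespace KleinGordon

noncomputable section

open scoped RealInnerProductSpace ComplexConjugate
open Filter Topology

/-! ### The space-time Fourier transform as a function -/

section Pairs

variable {n : ℕ}

/-- The pair of frequencies with difference `z` and given transversal coordinate. -/
def pairMap (σ : ℝ) (x : SpaceTime (n + 1) × Space n) : Space (n + 1) × Space (n + 1) :=
  (hypPt σ x.1.snd x.1.fst x.2 + (1 / 2 : ℝ) • x.1.snd,
    hypPt σ x.1.snd x.1.fst x.2 - (1 / 2 : ℝ) • x.1.snd)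

/-- The density of the space-time difference and the transversal coordinate. -/
def pairDens (σ : ℝ) (x : SpaceTime (n + 1) × Space n) : ℝ :=
  if |x.1.fst| < ‖x.1.snd‖ then hypJac σ x.1.snd x.1.fst x.2 else 0

lemma measurable_spaceTime_fst : Measurable (fun z : SpaceTime n => z.fst) :=
  (WithLp.fstL 2 ℝ ℝ (Space n)).continuous.measurable

lemma measurable_spaceTime_snd : Measurable (fun z : SpaceTime n => z.snd) :=
  (WithLp.sndL 2 ℝ ℝ (Space n)).continuous.measurable

lemma measurable_pairMap (σ : ℝ) : Measurable (pairMap (n := n) σ) := by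
  have h1 := measurable_spaceTime_fst (n := n + 1)
  have h2 := measurable_spaceTime_snd (n := n + 1)
  unfold pairMap
  fun_prop

lemma measurable_pairDens (σ : ℝ) : Measurable (pairDens (n := n) σ) := by
  have h1 := measurable_spaceTime_fst (n := n + 1)
  have h2 := measurable_spaceTime_snd (n := n + 1)
  unfold pairDens
  refine Measurable.ite (measurableSet_lt ?_ ?_) ?_ ?_ <;> fun_prop

variable {σ : ℝ}

lemma pairDens_nonneg (hσ : 0 < σ) (x : SpaceTime (n + 1) × Space n) : 0 ≤ pairDens σ x := by
  unfold pairDens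
  split_ifs with h
  · exact (hypJ_pos (by positivity) h).le
  · exact le_rfl

lemma freq_pairMap (hσ : 0 < σ) {x : SpaceTime (n + 1) × Space n} (hx : |x.1.fst| < ‖x.1.snd‖) :
    freq σ (pairMap σ x) = x.1 := by
  have h1 : energy σ (pairMap σ x).1 - energy σ (pairMap σ x).2 = x.1.fst := by
    rw [pairMap, energy_hypPt_add _ hσ hx, energy_hypPt_sub _ hσ hx]
    ring
  have h2 : (pairMap σ x).1 - (pairMap σ x).2 = x.1.snd := by
    rw [pairMap]
    module
  rw [freq, h1, h2]
  rfl

lemma lintegral_spaceTime {Φ : SpaceTime n → ℝ≥0∞} (hΦ : Measurable Φ) :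
    ∫⁻ z, Φ z = ∫⁻ t : ℝ, ∫⁻ x : Space n, Φ (WithLp.toLp 2 (t, x)) := by
  rw [← (WithLp.volume_preserving_toLp ℝ (Space n)).lintegral_comp hΦ, Measure.volume_eq_prod,
    lintegral_prod _ (by fun_prop)]

/-- Passing to difference and midpoint, and then to hyperbolic coordinates in the midpoint, covers
all pairs with ξ ≠ 0. The order of integration is arranged so that (τ, ξ) is outermost. -/
lemma lintegral_pairMap (hσ : 0 < σ) {Φ : Space (n + 1) × Space (n + 1) → ℝ≥0∞}
    (hΦ : Measurable Φ) : ∫⁻ y, Φ y = ∫⁻ x : SpaceTime (n + 1) × Space n,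
      ENNReal.ofReal (pairDens σ x) * Φ (pairMap σ x) := by
  have hD := measurable_pairDens (n := n) σ
  have hT := measurable_pairMap (n := n) σ
  have hm : Measurable fun x : SpaceTime (n + 1) × Space n =>
    ENNReal.ofReal (pairDens σ x) * Φ (pairMap σ x) := by fun_prop
  have hlp : Measurable fun p : ℝ × Space (n + 1) => (WithLp.toLp 2 p : SpaceTime (n + 1)) :=
    (WithLp.prod_continuous_toLp 2 ℝ (Space (n + 1))).measurable
  calc ∫⁻ y, Φ y = ∫⁻ y2 : Space (n + 1), ∫⁻ y1 : Space (n + 1), Φ (y1, y2) := by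
        rw [Measure.volume_eq_prod, lintegral_prod_symm _ hΦ.aemeasurable]
    _ = ∫⁻ y2 : Space (n + 1), ∫⁻ ξ : Space (n + 1), Φ (ξ + y2, y2) :=
        lintegral_congr fun y2 => (lintegral_add_right_eq_self (fun y1 => Φ (y1, y2)) y2).symm
    _ = ∫⁻ ξ : Space (n + 1), ∫⁻ y2 : Space (n + 1), Φ (ξ + y2, y2) :=
        lintegral_lintegral_swap (by fun_prop)
    _ = ∫⁻ ξ : Space (n + 1), ∫⁻ q : Space (n + 1), Φ (q + (1 / 2 : ℝ) • ξ, q - (1 / 2 : ℝ) • ξ) := by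
        refine lintegral_congr fun ξ => ?_
        rw [← lintegral_sub_right_eq_self (fun y2 => Φ (ξ + y2, y2)) ((1 / 2 : ℝ) • ξ)]
        refine lintegral_congr fun q => ?_
        congr 2
        module
    _ = ∫⁻ ξ : Space (n + 1), ∫⁻ v : Space n, ∫⁻ τ : ℝ,
          ENNReal.ofReal (pairDens σ (WithLp.toLp 2 (τ, ξ), v)) *
            Φ (pairMap σ (WithLp.toLp 2 (τ, ξ), v)) := by
        refine lintegral_congr_ae ?_
        have h0 : ∀ᵐ ξ : Space (n + 1), ξ ≠ 0 := by
          rw [ae_iff]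
          simp
        filter_upwards [h0] with ξ hξ
        rw [lintegral_hyp hσ hξ (by fun_prop)]
        refine lintegral_congr fun v => ?_
        rw [← lintegral_indicator measurableSet_Ioo]
        refine lintegral_congr fun τ => ?_
        rw [Set.indicator_apply]
        simp only [Set.mem_Ioo, ← abs_lt]
        split_ifs with h
        · have h' : |(WithLp.toLp 2 (τ, ξ) : SpaceTime (n + 1)).fst| <
            ‖(WithLp.toLp 2 (τ, ξ) : SpaceTime (n + 1)).snd‖ := h
          rw [pairDens, if_pos h']
          rfl
        · have h' : ¬ |(WithLp.toLp 2 (τ, ξ) : SpaceTime (n + 1)).fst| <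
            ‖(WithLp.toLp 2 (τ, ξ) : SpaceTime (n + 1)).snd‖ := h
          rw [pairDens, if_neg h']
          simp
    _ = ∫⁻ ξ : Space (n + 1), ∫⁻ τ : ℝ, ∫⁻ v : Space n,
          ENNReal.ofReal (pairDens σ (WithLp.toLp 2 (τ, ξ), v)) *
            Φ (pairMap σ (WithLp.toLp 2 (τ, ξ), v)) := by
        refine lintegral_congr fun ξ => lintegral_lintegral_swap (Measurable.aemeasurable ?_)
        exact hm.comp (((hlp.comp (measurable_snd.prodMk measurable_const))).prodMk measurable_fst)
    _ = ∫⁻ τ : ℝ, ∫⁻ ξ : Space (n + 1), ∫⁻ v : Space n,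
          ENNReal.ofReal (pairDens σ (WithLp.toLp 2 (τ, ξ), v)) *
            Φ (pairMap σ (WithLp.toLp 2 (τ, ξ), v)) := by
        refine lintegral_lintegral_swap (Measurable.aemeasurable ?_)
        exact hm.lintegral_prod_right'.comp (hlp.comp measurable_swap)
    _ = _ := by
        rw [Measure.volume_eq_prod (SpaceTime (n + 1)), lintegral_prod _ hm.aemeasurable,
          lintegral_spaceTime hm.lintegral_prod_right']

/-- The change of variables is recast as a push-forward so that Bochner integrals and
almost-everywhere statements transfer as well. -/
lemma map_pairMap (hσ : 0 < σ) : (volume.withDensity fun x : SpaceTime (n + 1) × Space n =>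
    ENNReal.ofReal (pairDens σ x)).map (pairMap σ) = volume := by
  refine Measure.ext_of_lintegral _ fun Φ hΦ => ?_
  rw [lintegral_map_withDensity (measurable_pairDens σ).ennreal_ofReal (measurable_pairMap σ) hΦ,
    lintegral_pairMap hσ hΦ]

lemma integrable_pairMap (hσ : 0 < σ) {G : Space (n + 1) × Space (n + 1) → ℂ} (hG : Integrable G) :
    Integrable (fun x : SpaceTime (n + 1) × Space n => (pairDens σ x : ℂ) * G (pairMap σ x)) := by
  have h1 : Integrable G ((volume.withDensity fun x : SpaceTime (n + 1) × Space n =>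
    ENNReal.ofReal (pairDens σ x)).map (pairMap σ)) := by rwa [map_pairMap hσ]
  have h2 := h1.comp_measurable (measurable_pairMap σ)
  rw [integrable_withDensity_iff_integrable_smul' (measurable_pairDens σ).ennreal_ofReal
    (Eventually.of_forall fun x => ENNReal.ofReal_lt_top)] at h2
  refine h2.congr (Eventually.of_forall fun x => ?_)
  simp only [ENNReal.toReal_ofReal (pairDens_nonneg hσ x), Function.comp_apply, Complex.real_smul]

lemma integral_pairMap (hσ : 0 < σ) {G : Space (n + 1) × Space (n + 1) → ℂ} (hG : Integrable G) :
    ∫ y, G y = ∫ x : SpaceTime (n + 1) × Space n, (pairDens σ x : ℂ) * G (pairMap σ x) := by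
  have h1 : AEStronglyMeasurable G ((volume.withDensity fun x : SpaceTime (n + 1) × Space n =>
    ENNReal.ofReal (pairDens σ x)).map (pairMap σ)) := by
      rw [map_pairMap hσ]; exact hG.aestronglyMeasurable
  rw [← map_pairMap hσ, integral_map (measurable_pairMap σ).aemeasurable h1,
    integral_withDensity_eq_integral_toReal_smul (measurable_pairDens σ).ennreal_ofReal
    (Eventually.of_forall fun x => ENNReal.ofReal_lt_top)]
  refine integral_congr_ae (Eventually.of_forall fun x => ?_)
  simp only [ENNReal.toReal_ofReal (pairDens_nonneg hσ x), Complex.real_smul]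

/-- The space-time Fourier transform of `|e^{itφ_s(D)} f|²`, where `F` is the Fourier transform
of `f`. -/
def spaceTimeFourier (σ : ℝ) (F : Space (n + 1) → ℂ) (z : SpaceTime (n + 1)) : ℂ :=
  ∫ v : Space n, (pairDens σ (z, v) : ℂ) * (F (pairMap σ (z, v)).1 * conj (F (pairMap σ (z, v)).2))

lemma pairDens_mul_freq (hσ : 0 < σ) (ψ : 𝓢(SpaceTime (n + 1), ℂ))
    (x : SpaceTime (n + 1) × Space n) (w : ℂ) :
    (pairDens σ x : ℂ) * (w * ψ (freq σ (pairMap σ x))) = (pairDens σ x : ℂ) * w * ψ x.1 := by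
  by_cases h : |x.1.fst| < ‖x.1.snd‖
  · rw [freq_pairMap hσ h, mul_assoc]
  · rw [pairDens, if_neg h]
    simp

lemma integrable_spaceTimeFourier_mul (hσ : 0 < σ) (F : L2 (n + 1))
    (ψ : 𝓢(SpaceTime (n + 1), ℂ)) : Integrable (fun z => spaceTimeFourier σ F z * ψ z) := by
  have h := (integrable_pairMap hσ (integrable_freq σ ψ F F)).integral_prod_left
  refine h.congr (Eventually.of_forall fun z => ?_)
  simp only [pairDens_mul_freq hσ ψ]
  exact integral_mul_const _ _

lemma integral_spaceTimeFourier_mul (hσ : 0 < σ) (F : L2 (n + 1))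
    (ψ : 𝓢(SpaceTime (n + 1), ℂ)) :
    ∫ z, spaceTimeFourier σ F z * ψ z = freqPairing σ ψ F F := by
  rw [freqPairing, integral_pairMap hσ (integrable_freq σ ψ F F), Measure.volume_eq_prod,
    integral_prod _ (integrable_pairMap hσ (integrable_freq σ ψ F F))]
  refine integral_congr_ae (Eventually.of_forall fun z => ?_)
  simp only [pairDens_mul_freq hσ ψ]
  exact (integral_mul_const _ _).symm

/-- The product with every Schwartz function is integrable, and a bump function equal to 1 on a ball
localises this. -/
lemma locallyIntegrable_spaceTimeFourier (hσ : 0 < σ) (F : L2 (n + 1)) :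
    LocallyIntegrable (spaceTimeFourier σ F) := by
  intro z
  let b : ContDiffBump z := ⟨1, 2, one_pos, one_lt_two⟩
  have hb₁ : HasCompactSupport (Complex.ofRealCLM ∘ b) := b.hasCompactSupport.comp_left rfl
  have hb₂ : ContDiff ℝ ((⊤ : ℕ∞) : WithTop ℕ∞) (Complex.ofRealCLM ∘ b) :=
    Complex.ofRealCLM.contDiff.comp b.contDiff
  refine ⟨Metric.ball z 1, Metric.ball_mem_nhds z one_pos, ?_⟩
  refine ((integrable_spaceTimeFourier_mul hσ F (hb₁.toSchwartzMap hb₂)).integrableOn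
    (s := Metric.ball z 1)).congr_fun (fun w hw => ?_) measurableSet_ball
  have : b w = 1 := b.one_of_mem_closedBall (Metric.ball_subset_closedBall hw)
  change _ * ((b w : ℝ) : ℂ) = _
  rw [this]
  simp

end Pairs

lemma isFourierOfModSq_spaceTimeFourier {n : ℕ} {s : ℝ} (hs : 0 < s) (f : L2 (n + 1)) :
    IsFourierOfModSq s f (spaceTimeFourier (s / (2 * Real.pi)) (𝓕 f : L2 (n + 1))) := by
  have hσ : 0 < s / (2 * Real.pi) := by positivity
  refine ⟨locallyIntegrable_spaceTimeFourier hσ _, fun ψ => ?_⟩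
  rw [modSqPairing_fourier, integral_spaceTimeFourier_mul hσ]

lemma IsFourierOfModSq.ae_eq {d : ℕ} {s : ℝ} {f : L2 d} {g g' : SpaceTime d → ℂ}
    (h : IsFourierOfModSq s f g) (h' : IsFourierOfModSq s f g') : g =ᵐ[volume] g' := by
  refine ae_eq_of_integral_contDiff_smul_eq h.1 h'.1 fun φ φ_smooth φ_cpt => ?_
  have hφ₁ : HasCompactSupport (Complex.ofRealCLM ∘ φ) := φ_cpt.comp_left rfl
  have hφ₂ : ContDiff ℝ ((⊤ : ℕ∞) : WithTop ℕ∞) (Complex.ofRealCLM ∘ φ) :=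
    Complex.ofRealCLM.contDiff.comp φ_smooth
  have key := (h.2 (hφ₁.toSchwartzMap hφ₂)).symm.trans (h'.2 _)
  have e : ∀ k : SpaceTime d → ℂ, ∫ z, φ z • k z = ∫ z, k z * (hφ₁.toSchwartzMap hφ₂) z :=
    fun k => integral_congr_ae (Eventually.of_forall fun z => by
      change φ z • k z = k z * ((φ z : ℝ) : ℂ)
      rw [Complex.real_smul, mul_comm])
  rw [e, e, key]

/-- All admissible representatives agree almost everywhere, so the infimum is the value at the
explicit one. -/
lemma nullFormNorm_eq {n : ℕ} {s : ℝ} (hs : 0 < s) (β : ℝ) (f : L2 (n + 1)) :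
    nullFormNorm s β f = eLpNorm (fun z : SpaceTime (n + 1) => ((boxPowSymbol β z : ℝ) : ℂ) *
      spaceTimeFourier (s / (2 * Real.pi)) (𝓕 f : L2 (n + 1)) z) 2 volume := by
  have h0 := isFourierOfModSq_spaceTimeFourier hs f
  refine le_antisymm (iInf₂_le _ h0) (le_iInf₂ fun g hg => (eLpNorm_congr_ae ?_).le)
  filter_upwards [h0.ae_eq hg] with z hz
  rw [hz]

end

end KleinGordon

namespace KleinGordon

noncomputable section

open scoped RealInnerProductSpace ComplexConjugate
open Filter Topology

/-! ### The quadrilinear form -/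

section Quad

variable {n : ℕ} {σ : ℝ}

/-- The integrand of the symmetrised quadrilinear form. -/
def quadWeight (σ : ℝ) (N : Space (n + 1) → ℝ≥0∞) (y y' : Space (n + 1) × Space (n + 1)) : ℝ≥0∞ :=
  N y.1 * N y'.2 * ENNReal.ofReal (energy σ y.1 * energy σ y'.2) *
    ENNReal.ofReal ((energy σ y.2 * energy σ y'.1)⁻¹)

lemma measurable_quadWeight {N : Space (n + 1) → ℝ≥0∞} (hN : Measurable N) :
    Measurable fun p : (Space (n + 1) × Space (n + 1)) × (Space (n + 1) × Space (n + 1)) =>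
      quadWeight σ N p.1 p.2 := by
  unfold quadWeight
  fun_prop

/-- The integrand of the quadrilinear form in hyperbolic coordinates. -/
def quadIntegrand (σ : ℝ) (N : Space (n + 1) → ℝ≥0∞)
    (p : (SpaceTime (n + 1) × Space n) × Space n) : ℝ≥0∞ :=
  ENNReal.ofReal (pairDens σ p.1) * ENNReal.ofReal (pairDens σ (p.1.1, p.2)) *
    quadWeight σ N (pairMap σ p.1) (pairMap σ (p.1.1, p.2))

lemma measurable_quadIntegrand (σ : ℝ) {N : Space (n + 1) → ℝ≥0∞} (hN : Measurable N) :
    Measurable (quadIntegrand σ N) := by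
  unfold quadIntegrand
  have hD := measurable_pairDens (n := n) σ
  have hT := measurable_pairMap (n := n) σ
  have hW := measurable_quadWeight (σ := σ) hN
  fun_prop

/-- The left side runs over two pairs with common space-time difference z, which are resonant
quadruples in hyperbolic coordinates. The weight involves F only at y₁ and y₄, so after the change
to elliptic coordinates y₂ and y₃ can be integrated out explicitly. -/
lemma lintegral_quad (hn : 1 ≤ n) (hσ : 0 < σ) {b : ℝ} (hb : 0 < b + (n : ℝ) / 2)
    {N : Space (n + 1) → ℝ≥0∞} (hN : Measurable N) :
    ∫⁻ z : SpaceTime (n + 1), posPow b (‖z.snd‖ ^ 2 - z.fst ^ 2) *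
      (∫⁻ v : Space n, ∫⁻ v' : Space n, quadIntegrand σ N ((z, v), v')) =
    ∫⁻ y : Space (n + 1) × Space (n + 1), N y.1 * N y.2 *
      ENNReal.ofReal (energy σ y.1 * energy σ y.2) * ENNReal.ofReal (kernel σ b y) := by
  set H : Space (n + 1) × Space (n + 1) → ℝ≥0∞ := fun y =>
    N y.1 * N y.2 * ENNReal.ofReal (energy σ y.1 * energy σ y.2) with hH
  have hHm : Measurable H := by fun_prop
  set Ψ : Space (n + 1) × Space (n + 1) × Space (n + 1) → ℝ≥0∞ := fun x => H (x.1, x.2.2) *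
    posPow b (‖x.1 - x.2.1‖ ^ 2 - (energy σ x.1 - energy σ x.2.1) ^ 2) *
      ENNReal.ofReal ((energy σ x.2.1 * energy σ (x.1 - x.2.1 + x.2.2))⁻¹) with hΨ
  have hΨm : Measurable Ψ := by fun_prop
  -- The convention that `posPow` vanishes at 0, even for b ≤ 0, provides the vanishing on the
  -- diagonal.
  have hdiag : ∀ x, x.1 = x.2.1 → Ψ x = 0 := fun x hx => by
    simp [hΨ, hx, posPow]
  rw [← ellInt_bilinear hn hσ hb H, ← hypInt_eq_ellInt hn hσ hΨm hdiag, hypInt]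
  have hd := measurable_hypDens (n := n) σ
  have hq := measurable_hypMom (n := n) σ
  have hD := measurable_pairDens (n := n) σ
  have hT := measurable_pairMap (n := n) σ
  have hW := measurable_quadWeight (σ := σ) hN
  have hm : Measurable fun p : (Space (n + 1) × Space (n + 1)) × Space n =>
      hypDens σ 0 p.1 p.2 * Ψ (p.1.1, p.1.2, hypMom σ 0 p.1 p.2) := by fun_prop
  have hm2 := measurable_quadIntegrand σ hN
  rw [lintegral_pairMap hσ hm.lintegral_prod_right', Measure.volume_eq_prod, lintegral_prod]
  · refine lintegral_congr fun z => ?_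
    rw [← lintegral_const_mul]
    · refine lintegral_congr fun v => ?_
      rw [← lintegral_const_mul, ← lintegral_const_mul]
      · refine lintegral_congr fun v' => ?_
        by_cases hz : |z.fst| < ‖z.snd‖
        · have hf := freq_pairMap (x := (z, v)) hσ hz
          have e1 : energy σ (pairMap σ (z, v)).1 - energy σ (pairMap σ (z, v)).2 = z.fst :=
            congrArg (fun w : SpaceTime (n + 1) => w.fst) hf
          have e2 : (pairMap σ (z, v)).1 - (pairMap σ (z, v)).2 = z.snd :=
            congrArg (fun w : SpaceTime (n + 1) => w.snd) hf
          -- With defect 0 the second pair has the same difference z, so its density and momenta are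
          -- those of `pairMap` at (z, v').
          have e3 : hypDens σ 0 (pairMap σ (z, v)) v' = ENNReal.ofReal (pairDens σ (z, v')) := by
            rw [hypDens, e1, e2, add_zero, if_pos hz, pairDens, if_pos hz]
          have e4 : hypMom σ 0 (pairMap σ (z, v)) v' = (pairMap σ (z, v')).2 := by
            rw [hypMom, e1, e2, add_zero]
            rfl
          have e5 : z.snd + (pairMap σ (z, v')).2 = (pairMap σ (z, v')).1 := by
            simp only [pairMap]
            module
          rw [e3, e4]
          simp only [hΨ, hH, quadIntegrand, quadWeight, e1, e2, e5]
          ring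
        · simp [quadIntegrand, pairDens, hz]
      · fun_prop
      · fun_prop
    · exact (hm2.comp (measurable_prodMk_left.prodMap measurable_id)).lintegral_prod_right'
  · exact (hD.ennreal_ofReal.mul (hm.lintegral_prod_right'.comp hT)).aemeasurable

/-- The difference of the two sides is a square: equality holds exactly when ‖F‖φ has the same
product at y₁, y₄ as at y₂, y₃. On resonant quadruples e^{-aφ}/φ has this property. -/
lemma two_mul_le_quadWeight (hσ : 0 < σ) (F : Space (n + 1) → ℂ)
    (y y' : Space (n + 1) × Space (n + 1)) :
    2 * ((‖F y.1‖ₑ * ‖F y.2‖ₑ) * (‖F y'.1‖ₑ * ‖F y'.2‖ₑ)) ≤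
      quadWeight σ (fun x => ‖F x‖ₑ ^ 2) y y' + quadWeight σ (fun x => ‖F x‖ₑ ^ 2) y' y := by
  have h1 := energy_pos hσ y.1
  have h2 := energy_pos hσ y.2
  have h3 := energy_pos hσ y'.1
  have h4 := energy_pos hσ y'.2
  have n1 := norm_nonneg (F y.1)
  have n2 := norm_nonneg (F y.2)
  have n3 := norm_nonneg (F y'.1)
  have n4 := norm_nonneg (F y'.2)
  simp only [quadWeight, ← ofReal_norm]
  set a := ‖F y.1‖
  set b := ‖F y.2‖
  set c := ‖F y'.1‖
  set d := ‖F y'.2‖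
  set p := energy σ y.1
  set q := energy σ y.2
  set r := energy σ y'.1
  set t := energy σ y'.2
  rw [← ENNReal.ofReal_mul n1, ← ENNReal.ofReal_mul n3, ← ENNReal.ofReal_mul (by positivity),
    ← ENNReal.ofReal_pow n1, ← ENNReal.ofReal_pow n2, ← ENNReal.ofReal_pow n3,
    ← ENNReal.ofReal_pow n4, ← ENNReal.ofReal_mul (by positivity),
    ← ENNReal.ofReal_mul (by positivity), ← ENNReal.ofReal_mul (by positivity),
    ← ENNReal.ofReal_mul (by positivity), ← ENNReal.ofReal_mul (by positivity),
    ← ENNReal.ofReal_mul (by positivity), ← ENNReal.ofReal_add (by positivity) (by positivity),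
    show (2 : ℝ≥0∞) = ENNReal.ofReal 2 by simp, ← ENNReal.ofReal_mul (by positivity)]
  refine ENNReal.ofReal_le_ofReal ?_
  rw [← sub_nonneg]
  have : a ^ 2 * d ^ 2 * (p * t) * (q * r)⁻¹ + c ^ 2 * b ^ 2 * (r * q) * (t * p)⁻¹ -
      2 * (a * b * (c * d)) = (a * d * (p * t) - b * c * (q * r)) ^ 2 / ((p * t) * (q * r)) := by
    field_simp
    ring
  rw [this]
  positivity

/-- Exchanging v and v' leaves the double integral unchanged, so the symmetric bound costs B only
once. -/
lemma sq_lintegral_le_of_two_mul_le {α : Type*} [MeasurableSpace α] {μ : Measure α} [SFinite μ]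
    {M : α → ℝ≥0∞} (hM : Measurable M) {B : α → α → ℝ≥0∞} (hB : Measurable (Function.uncurry B))
    (h : ∀ v v', 2 * (M v * M v') ≤ B v v' + B v' v) :
    (∫⁻ v, M v ∂μ) ^ 2 ≤ ∫⁻ v, ∫⁻ v', B v v' ∂μ ∂μ := by
  rw [← ENNReal.mul_le_mul_iff_right two_ne_zero (by simp : (2 : ℝ≥0∞) ≠ ∞)]
  have hB' : Measurable fun p : α × α => B p.2 p.1 := hB.comp measurable_swap
  calc 2 * (∫⁻ v, M v ∂μ) ^ 2 = ∫⁻ v, ∫⁻ v', 2 * (M v * M v') ∂μ ∂μ := by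
        rw [sq, ← lintegral_mul_const _ hM, ← lintegral_const_mul _ (by fun_prop)]
        refine lintegral_congr fun v => ?_
        rw [← lintegral_const_mul _ hM, ← lintegral_const_mul _ (by fun_prop)]
    _ ≤ ∫⁻ v, ∫⁻ v', (B v v' + B v' v) ∂μ ∂μ :=
        lintegral_mono fun v => lintegral_mono fun v' => h v v'
    _ = (∫⁻ v, ∫⁻ v', B v v' ∂μ ∂μ) + ∫⁻ v, ∫⁻ v', B v' v ∂μ ∂μ := by
        have hB1 : Measurable fun v => ∫⁻ v', B v v' ∂μ := hB.lintegral_prod_right'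
        rw [← lintegral_add_left hB1]
        refine lintegral_congr fun v => ?_
        rw [lintegral_add_left (hB.of_uncurry_left)]
    _ = 2 * ∫⁻ v, ∫⁻ v', B v v' ∂μ ∂μ := by
        rw [lintegral_lintegral_swap (f := fun v v' => B v' v) hB'.aemeasurable, two_mul]

lemma sq_lintegral_le (hσ : 0 < σ) {F : Space (n + 1) → ℂ} (hF : Measurable F)
    (z : SpaceTime (n + 1)) :
    (∫⁻ v : Space n, ENNReal.ofReal (pairDens σ (z, v)) *
      (‖F (pairMap σ (z, v)).1‖ₑ * ‖F (pairMap σ (z, v)).2‖ₑ)) ^ 2 ≤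
    ∫⁻ v : Space n, ∫⁻ v' : Space n, quadIntegrand σ (fun x => ‖F x‖ₑ ^ 2) ((z, v), v') := by
  have hD : Measurable fun v : Space n => pairDens σ (z, v) :=
    (measurable_pairDens (n := n) σ).comp measurable_prodMk_left
  have hT : Measurable fun v : Space n => pairMap σ (z, v) :=
    (measurable_pairMap (n := n) σ).comp measurable_prodMk_left
  refine sq_lintegral_le_of_two_mul_le (B := fun v v' =>
    quadIntegrand σ (fun x => ‖F x‖ₑ ^ 2) ((z, v), v')) ?_ ?_
    fun v v' => ?_
  · fun_prop
  · have h := measurable_quadIntegrand σ (N := fun x => ‖F x‖ₑ ^ 2) (by fun_prop)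
    have hc : Measurable fun p : Space n × Space n => ((z, p.1), p.2) := by fun_prop
    exact h.comp hc
  · have := mul_le_mul_right (two_mul_le_quadWeight hσ F (pairMap σ (z, v)) (pairMap σ (z, v')))
      (ENNReal.ofReal (pairDens σ (z, v)) * ENNReal.ofReal (pairDens σ (z, v')))
    calc _ = _ := by ring
      _ ≤ _ := this
      _ = _ := by simp only [quadIntegrand]; ring

lemma enorm_spaceTimeFourier_le (hσ : 0 < σ) (F : Space (n + 1) → ℂ) (z : SpaceTime (n + 1)) :
    ‖spaceTimeFourier σ F z‖ₑ ≤ ∫⁻ v : Space n, ENNReal.ofReal (pairDens σ (z, v)) *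
      (‖F (pairMap σ (z, v)).1‖ₑ * ‖F (pairMap σ (z, v)).2‖ₑ) := by
  refine (enorm_integral_le_lintegral_enorm _).trans (lintegral_mono fun v => ?_)
  rw [enorm_mul, enorm_mul, show ∀ w : ℂ, ‖conj w‖ₑ = ‖w‖ₑ from
    fun w => enorm_eq_iff_norm_eq.2 (Complex.norm_conj _), ← ofReal_norm ((pairDens σ (z, v) : ℂ)),
    Complex.norm_real, Real.norm_of_nonneg (pairDens_nonneg hσ _)]

lemma spaceTimeFourier_eq_zero (F : Space (n + 1) → ℂ) {z : SpaceTime (n + 1)}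
    (hz : ¬ |z.fst| < ‖z.snd‖) : spaceTimeFourier σ F z = 0 := by
  simp [spaceTimeFourier, pairDens, hz]

lemma enorm_boxPowSymbol_sq {β : ℝ} {z : SpaceTime n} (hz : |z.fst| < ‖z.snd‖) :
    ‖((boxPowSymbol β z : ℝ) : ℂ)‖ₑ ^ 2 = ENNReal.ofReal ((2 * Real.pi) ^ (4 * β)) *
      posPow (2 * β) (‖z.snd‖ ^ 2 - z.fst ^ 2) := by
  have hpos : 0 < ‖z.snd‖ ^ 2 - z.fst ^ 2 := by
    have := sq_lt_sq' (abs_lt.1 hz).1 (abs_lt.1 hz).2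
    linarith
  have hpi := Real.pi_pos
  rw [posPow_of_pos hpos, ← ofReal_norm, Complex.norm_real, boxPowSymbol,
    Real.norm_of_nonneg (by positivity), ← ENNReal.ofReal_pow (by positivity),
    ← ENNReal.ofReal_mul (by positivity)]
  congr 1
  rw [show (2 * Real.pi * z.fst) ^ 2 - (2 * Real.pi * ‖z.snd‖) ^ 2 =
    -((2 * Real.pi) ^ 2 * (‖z.snd‖ ^ 2 - z.fst ^ 2)) by ring, abs_neg, abs_of_pos (by positivity),
    Real.mul_rpow (by positivity) hpos.le, mul_pow, ← Real.rpow_natCast, ← Real.rpow_natCast,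
    ← Real.rpow_natCast, ← Real.rpow_mul (by positivity), ← Real.rpow_mul (by positivity),
    ← Real.rpow_mul hpos.le]
  congr 2 <;> push_cast <;> ring

lemma eLpNorm_boxPowSymbol_mul (β : ℝ) (F : Space (n + 1) → ℂ) :
    eLpNorm (fun z : SpaceTime (n + 1) => ((boxPowSymbol β z : ℝ) : ℂ) * spaceTimeFourier σ F z) 2
      volume ^ 2 = ENNReal.ofReal ((2 * Real.pi) ^ (4 * β)) * ∫⁻ z : SpaceTime (n + 1),
        posPow (2 * β) (‖z.snd‖ ^ 2 - z.fst ^ 2) * ‖spaceTimeFourier σ F z‖ₑ ^ 2 := by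
  rw [eLpNorm_eq_lintegral_rpow_enorm_toReal (by simp) (by simp), ← ENNReal.rpow_natCast,
    ← ENNReal.rpow_mul, ← lintegral_const_mul' _ _ ENNReal.ofReal_ne_top]
  simp only [ENNReal.toReal_ofNat, Nat.cast_ofNat, one_div, inv_mul_cancel₀ (two_ne_zero' ℝ),
    ENNReal.rpow_one]
  refine lintegral_congr fun z => ?_
  rw [show (2 : ℝ) = ((2 : ℕ) : ℝ) by norm_num, ENNReal.rpow_natCast, enorm_mul, mul_pow]
  by_cases hz : |z.fst| < ‖z.snd‖
  · rw [enorm_boxPowSymbol_sq hz, mul_assoc]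
    norm_num
  · rw [spaceTimeFourier_eq_zero F hz]
    simp

/-- The sharp quadratic form bounding the square of the null form norm. -/
def sharpForm (σ b : ℝ) (F : Space (n + 1) → ℂ) : ℝ≥0∞ :=
  ∫⁻ y : Space (n + 1) × Space (n + 1), ‖F y.1‖ₑ ^ 2 * ‖F y.2‖ₑ ^ 2 *
    ENNReal.ofReal (energy σ y.1 * energy σ y.2) * ENNReal.ofReal (kernel σ b y)

/-- Only the triangle inequality under the integral and the weighted inequality lose anything here.
Both are equalities for the test functions used for optimality. -/
lemma eLpNorm_sq_le_sharpForm (hn : 1 ≤ n) (hσ : 0 < σ) {β : ℝ} (hb : 0 < 2 * β + (n : ℝ) / 2)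
    {F : Space (n + 1) → ℂ} (hF : Measurable F) :
    eLpNorm (fun z : SpaceTime (n + 1) => ((boxPowSymbol β z : ℝ) : ℂ) * spaceTimeFourier σ F z) 2
      volume ^ 2 ≤ ENNReal.ofReal ((2 * Real.pi) ^ (4 * β)) * sharpForm σ (2 * β) F := by
  rw [eLpNorm_boxPowSymbol_mul, sharpForm,
    ← lintegral_quad hn hσ hb (N := fun x => ‖F x‖ₑ ^ 2) (by fun_prop)]
  gcongr with z
  exact (pow_le_pow_left' (enorm_spaceTimeFourier_le hσ F z) 2).trans (sq_lintegral_le hσ hF z)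

end Quad

end

end KleinGordon

namespace KleinGordon

noncomputable section

open scoped RealInnerProductSpace ComplexConjugate
open Filter Topology

/-! ### The sharp bounds -/

section Bounds

variable {n : ℕ} {σ : ℝ}

/-- The centre of mass momentum of two particles of momenta `y.1`, `y.2`. -/
def pairRad (σ : ℝ) (y : Space (n + 1) × Space (n + 1)) : ℝ :=
  cmRad σ (y.1 + y.2) (energy σ y.1 + energy σ y.2)

lemma pairRad_pos (hσ : 0 < σ) {y : Space (n + 1) × Space (n + 1)} (hy : y.1 ≠ y.2) :
    0 < pairRad σ y := (cmRad_sq (exists_cm hσ hy).1).2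

lemma pairRad_sq (hσ : 0 < σ) {y : Space (n + 1) × Space (n + 1)} (hy : y.1 ≠ y.2) :
    pairRad σ y ^ 2 = (energy σ y.1 * energy σ y.2 - ⟪y.1, y.2⟫ - σ ^ 2) / 2 := by
  rw [pairRad, (cmRad_sq (exists_cm hσ hy).1).1, norm_add_sq_real, add_sq, energy_sq, energy_sq]
  ring

lemma pairRad_lt_phi (hσ : 0 < σ) {y : Space (n + 1) × Space (n + 1)} (hy : y.1 ≠ y.2) :
    pairRad σ y < phi σ (pairRad σ y) := by
  have h := pairRad_pos hσ hy
  exact Real.lt_sqrt_of_sq_lt (by nlinarith)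

/-- The total power of r is n - 1 + 2b = k. Since r > 0 off the diagonal, the natural and real
powers combine. -/
lemma kernel_eq (hn : 1 ≤ n) (hσ : 0 < σ) {y : Space (n + 1) × Space (n + 1)} (hy : y.1 ≠ y.2)
    {b : ℝ} {k : ℕ} (hk : 2 * b + n = k + 1) : kernel σ b y =
      2 ^ (b - 1) * sphereConst n b * (pairRad σ y ^ k / phi σ (pairRad σ y)) := by
  have h := pairRad_pos hσ hy
  have h2 := h.trans (pairRad_lt_phi hσ hy)
  rw [kernel, ← pairRad, Real.mul_rpow (by positivity) (by positivity),
    Real.rpow_sub_one two_ne_zero]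
  have : pairRad σ y ^ (n - 1) * (pairRad σ y ^ 2) ^ b = pairRad σ y ^ k := by
    rw [← Real.rpow_natCast, ← Real.rpow_natCast, ← Real.rpow_natCast, ← Real.rpow_mul h.le,
      ← Real.rpow_add h, Nat.cast_sub hn]
    congr 1
    push_cast
    linarith
  rw [← this]
  field_simp

/-- The moments of the energy with respect to the density `|F|²`. -/
def moment {d : ℕ} (σ : ℝ) (k : ℕ) (F : Space d → ℂ) : ℝ := ∫ y, energy σ y ^ k * ‖F y‖ ^ 2

/-- The kernel bound is strict almost everywhere. If F ≠ 0, the weight is positive on the product of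
{F ≠ 0} with itself, which has positive measure, and the integrals differ. This excludes
extremisers. -/
lemma sharpForm_lt (hσ : 0 < σ) {b : ℝ} {F : Space (n + 1) → ℂ} {κ : Space (n + 1) × Space (n + 1) → ℝ}
    (hG : Integrable fun y : Space (n + 1) × Space (n + 1) =>
      ‖F y.1‖ ^ 2 * ‖F y.2‖ ^ 2 * (energy σ y.1 * energy σ y.2) * κ y)
    (h0 : ∀ᵐ y : Space (n + 1) × Space (n + 1), 0 ≤ kernel σ b y)
    (hκ : ∀ᵐ y : Space (n + 1) × Space (n + 1), kernel σ b y < κ y) :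
    sharpForm σ b F ≤ ENNReal.ofReal (∫ y : Space (n + 1) × Space (n + 1),
      ‖F y.1‖ ^ 2 * ‖F y.2‖ ^ 2 * (energy σ y.1 * energy σ y.2) * κ y) ∧
    (¬ F =ᵐ[volume] 0 → sharpForm σ b F < ENNReal.ofReal (∫ y : Space (n + 1) × Space (n + 1),
      ‖F y.1‖ ^ 2 * ‖F y.2‖ ^ 2 * (energy σ y.1 * energy σ y.2) * κ y)) := by
  have hen : ∀ y : Space (n + 1), 0 < energy σ y := fun y => energy_pos hσ y
  have hpos : ∀ᵐ y : Space (n + 1) × Space (n + 1),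
      0 ≤ ‖F y.1‖ ^ 2 * ‖F y.2‖ ^ 2 * (energy σ y.1 * energy σ y.2) * κ y := by
    filter_upwards [h0, hκ] with y h1 h2
    have := h1.trans h2.le
    have := hen y.1
    have := hen y.2
    positivity
  have heq : sharpForm σ b F = ∫⁻ y : Space (n + 1) × Space (n + 1), ENNReal.ofReal
      (‖F y.1‖ ^ 2 * ‖F y.2‖ ^ 2 * (energy σ y.1 * energy σ y.2) * kernel σ b y) := by
    refine lintegral_congr fun y => ?_
    have := hen y.1
    have := hen y.2
    rw [← ofReal_norm, ← ofReal_norm, ← ENNReal.ofReal_pow (norm_nonneg _),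
      ← ENNReal.ofReal_pow (norm_nonneg _), ← ENNReal.ofReal_mul (by positivity),
      ← ENNReal.ofReal_mul (by positivity), ← ENNReal.ofReal_mul (by positivity)]
  have hle : ∀ᵐ y : Space (n + 1) × Space (n + 1), ENNReal.ofReal
      (‖F y.1‖ ^ 2 * ‖F y.2‖ ^ 2 * (energy σ y.1 * energy σ y.2) * kernel σ b y) ≤ ENNReal.ofReal
      (‖F y.1‖ ^ 2 * ‖F y.2‖ ^ 2 * (energy σ y.1 * energy σ y.2) * κ y) := by
    filter_upwards [hκ] with y h2
    have := hen y.1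
    have := hen y.2
    exact ENNReal.ofReal_le_ofReal (mul_le_mul_of_nonneg_left h2.le (by positivity))
  rw [ofReal_integral_eq_lintegral_ofReal hG hpos, heq]
  refine ⟨lintegral_mono_ae hle, fun hF => ?_⟩
  have hfin := hG.lintegral_lt_top
  refine lintegral_strict_mono_of_ae_le_of_ae_lt_on hG.aestronglyMeasurable.aemeasurable.ennreal_ofReal
    ((lintegral_mono_ae hle).trans_lt hfin).ne hle (s := {y | F y ≠ 0} ×ˢ {y | F y ≠ 0}) ?_ ?_
  · rw [Measure.volume_eq_prod, Measure.prod_prod]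
    have : volume {y | F y ≠ 0} ≠ 0 := fun h => hF (ae_iff.2 h)
    exact mul_ne_zero this this
  · filter_upwards [h0, hκ] with y h1 h2 hy
    have := hen y.1
    have := hen y.2
    have h3 : 0 < ‖F y.1‖ := norm_pos_iff.2 hy.1
    have h4 : 0 < ‖F y.2‖ := norm_pos_iff.2 hy.2
    have h5 := h1.trans_lt h2
    exact (ENNReal.ofReal_lt_ofReal_iff (by positivity)).2
      (mul_lt_mul_of_pos_left h2 (by positivity))

lemma kernel_const_pos (hn : 1 ≤ n) {b : ℝ} (hb : 0 < b + (n : ℝ) / 2) :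
    0 < 2 ^ (b - 1) * sphereConst n b := by
  have := sphereConst_pos hn hb
  positivity

lemma ae_kernel_nonneg (hn : 1 ≤ n) (hσ : 0 < σ) {b : ℝ} (hb : 0 < b + (n : ℝ) / 2) {k : ℕ}
    (hk : 2 * b + n = k + 1) : ∀ᵐ y : Space (n + 1) × Space (n + 1), 0 ≤ kernel σ b y := by
  filter_upwards [ae_ne] with y hy
  have h := pairRad_pos hσ hy
  have h2 := h.trans (pairRad_lt_phi hσ hy)
  have := kernel_const_pos hn hb
  rw [kernel_eq hn hσ hy hk]
  positivity

/-- Since r/√(σ² + r²) < 1, the kernel is bounded by a constant and the double integral factorises.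
-/
lemma sharpForm_le_moment_one (hn : 1 ≤ n) (hσ : 0 < σ) {b : ℝ} (hb : 2 * b + n = 2)
    {F : Space (n + 1) → ℂ} (hF : Integrable fun y => energy σ y ^ 1 * ‖F y‖ ^ 2) :
    sharpForm σ b F ≤ ENNReal.ofReal (2 ^ (b - 1) * sphereConst n b * moment σ 1 F ^ 2) ∧
    (¬ F =ᵐ[volume] 0 →
      sharpForm σ b F < ENNReal.ofReal (2 ^ (b - 1) * sphereConst n b * moment σ 1 F ^ 2)) := by
  set c := 2 ^ (b - 1) * sphereConst n b with hc
  have hc0 : 0 < c := kernel_const_pos hn (by linarith)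
  have hk : 2 * b + n = (1 : ℕ) + 1 := by rw [hb]; norm_num
  have hcongr : ∀ y : Space (n + 1) × Space (n + 1),
      energy σ y.1 ^ 1 * ‖F y.1‖ ^ 2 * (energy σ y.2 ^ 1 * ‖F y.2‖ ^ 2) * c =
      ‖F y.1‖ ^ 2 * ‖F y.2‖ ^ 2 * (energy σ y.1 * energy σ y.2) * c := fun y => by ring
  have hG := (hF.mul_prod hF).mul_const c
  have hint : ∫ y : Space (n + 1) × Space (n + 1),
      ‖F y.1‖ ^ 2 * ‖F y.2‖ ^ 2 * (energy σ y.1 * energy σ y.2) * c = c * moment σ 1 F ^ 2 := by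
    simp only [← hcongr]
    rw [integral_mul_const, Measure.volume_eq_prod, integral_prod_mul (fun y => energy σ y ^ 1 * ‖F y‖ ^ 2)
      (fun y => energy σ y ^ 1 * ‖F y‖ ^ 2), moment]
    ring
  rw [← hint]
  refine sharpForm_lt hσ (hG.congr (Eventually.of_forall hcongr))
    (ae_kernel_nonneg hn hσ (by linarith) hk) ?_
  filter_upwards [ae_ne] with y hy
  have h := pairRad_pos hσ hy
  have h2 := pairRad_lt_phi hσ hy
  rw [kernel_eq hn hσ hy hk, pow_one, ← hc]
  exact mul_lt_of_lt_one_right hc0 ((div_lt_one (h.trans h2)).2 h2)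

lemma integrable_moment_of_le (hσ : 0 < σ) {F : Space n → ℂ} (hm : Measurable F)
    (hF : Integrable fun y => energy σ y ^ 2 * ‖F y‖ ^ 2) :
    Integrable fun y => energy σ y ^ 1 * ‖F y‖ ^ 2 := by
  refine (hF.const_mul σ⁻¹).mono' (by fun_prop) (Eventually.of_forall fun y => ?_)
  have h1 := le_energy σ y
  have h2 := energy_pos hσ y
  rw [Real.norm_of_nonneg (by positivity), ← mul_assoc]
  refine mul_le_mul_of_nonneg_right ?_ (by positivity)
  rw [inv_mul_eq_div, le_div_iff₀ hσ]
  nlinarith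

/-- Since r³/√(σ² + r²) < r², the kernel is bounded by a multiple of φ₁φ₂ - y₁·y₂ - σ², a sum of
products. The first and last terms give the two moments and the middle one gives -‖∫U‖². -/
lemma sharpForm_le_moment_two (hn : 1 ≤ n) (hσ : 0 < σ) {b : ℝ} (hb : 2 * b + n = 4)
    {F : Space (n + 1) → ℂ} (hm : Measurable F)
    (hF : Integrable fun y => energy σ y ^ 2 * ‖F y‖ ^ 2) :
    sharpForm σ b F ≤ ENNReal.ofReal (2 ^ (b - 1) * sphereConst n b / 2 *
      (moment σ 2 F ^ 2 - σ ^ 2 * moment σ 1 F ^ 2)) ∧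
    (¬ F =ᵐ[volume] 0 → sharpForm σ b F < ENNReal.ofReal (2 ^ (b - 1) * sphereConst n b / 2 *
      (moment σ 2 F ^ 2 - σ ^ 2 * moment σ 1 F ^ 2))) := by
  set c := 2 ^ (b - 1) * sphereConst n b with hc
  have hc0 : 0 < c := kernel_const_pos hn (by linarith)
  have hk : 2 * b + n = (3 : ℕ) + 1 := by rw [hb]; norm_num
  have hF1 := integrable_moment_of_le hσ hm hF
  set U : Space (n + 1) → Space (n + 1) := fun y => (energy σ y * ‖F y‖ ^ 2) • y with hU
  have hUi : Integrable U := by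
    refine hF.mono' (Measurable.aestronglyMeasurable (by fun_prop)) (Eventually.of_forall fun y => ?_)
    have h1 := norm_le_energy σ y
    have h2 := energy_pos hσ y
    rw [hU, norm_smul, Real.norm_of_nonneg (by positivity)]
    calc energy σ y * ‖F y‖ ^ 2 * ‖y‖ ≤ energy σ y * ‖F y‖ ^ 2 * energy σ y := by gcongr
      _ = _ := by ring
  have hUU : Integrable (fun y : Space (n + 1) × Space (n + 1) => ⟪U y.1, U y.2⟫)
      (volume.prod volume) := by
    refine (hUi.norm.mul_prod hUi.norm).mono' ?_ (Eventually.of_forall fun y => norm_inner_le_norm _ _)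
    exact (hUi.aestronglyMeasurable.comp_fst).inner (hUi.aestronglyMeasurable.comp_snd)
  have hUint : ∫ y : Space (n + 1) × Space (n + 1), ⟪U y.1, U y.2⟫ ∂(volume.prod volume) =
      ‖∫ y, U y‖ ^ 2 := by
    rw [integral_prod _ hUU]
    simp only [integral_inner hUi]
    simp only [real_inner_comm (∫ y, U y)]
    rw [integral_inner hUi, real_inner_self_eq_norm_sq]
  have hcongr : ∀ y : Space (n + 1) × Space (n + 1),
      c / 2 * (energy σ y.1 ^ 2 * ‖F y.1‖ ^ 2 * (energy σ y.2 ^ 2 * ‖F y.2‖ ^ 2) - ⟪U y.1, U y.2⟫ -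
        σ ^ 2 * (energy σ y.1 ^ 1 * ‖F y.1‖ ^ 2 * (energy σ y.2 ^ 1 * ‖F y.2‖ ^ 2))) =
      ‖F y.1‖ ^ 2 * ‖F y.2‖ ^ 2 * (energy σ y.1 * energy σ y.2) *
        (c * ((energy σ y.1 * energy σ y.2 - ⟪y.1, y.2⟫ - σ ^ 2) / 2)) := fun y => by
    simp only [hU, real_inner_smul_left, real_inner_smul_right]
    ring
  have i2 := hF.mul_prod hF
  have i1 := (hF1.mul_prod hF1).const_mul (σ ^ 2)
  have i12 : Integrable (fun y : Space (n + 1) × Space (n + 1) =>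
      energy σ y.1 ^ 2 * ‖F y.1‖ ^ 2 * (energy σ y.2 ^ 2 * ‖F y.2‖ ^ 2) - ⟪U y.1, U y.2⟫)
      (volume.prod volume) := i2.sub hUU
  have hG := (i12.sub i1).const_mul (c / 2)
  have hint : ∫ y : Space (n + 1) × Space (n + 1), ‖F y.1‖ ^ 2 * ‖F y.2‖ ^ 2 *
      (energy σ y.1 * energy σ y.2) * (c * ((energy σ y.1 * energy σ y.2 - ⟪y.1, y.2⟫ - σ ^ 2) / 2)) =
      c / 2 * (moment σ 2 F ^ 2 - ‖∫ y, U y‖ ^ 2 - σ ^ 2 * moment σ 1 F ^ 2) := by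
    simp only [← hcongr]
    rw [integral_const_mul, Measure.volume_eq_prod, integral_sub i12 i1,
      integral_sub i2 hUU, integral_const_mul, hUint,
      integral_prod_mul (fun y => energy σ y ^ 1 * ‖F y‖ ^ 2) (fun y => energy σ y ^ 1 * ‖F y‖ ^ 2),
      integral_prod_mul (fun y => energy σ y ^ 2 * ‖F y‖ ^ 2) (fun y => energy σ y ^ 2 * ‖F y‖ ^ 2),
      moment, moment]
    ring
  -- The square of the integral of U enters with a favourable sign and is dropped. It vanishes for
  -- radial F, so this costs nothing in the constant.
  have hle : ENNReal.ofReal (c / 2 * (moment σ 2 F ^ 2 - ‖∫ y, U y‖ ^ 2 - σ ^ 2 * moment σ 1 F ^ 2)) ≤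
      ENNReal.ofReal (c / 2 * (moment σ 2 F ^ 2 - σ ^ 2 * moment σ 1 F ^ 2)) := by
    refine ENNReal.ofReal_le_ofReal (mul_le_mul_of_nonneg_left ?_ (by positivity))
    have := sq_nonneg ‖∫ y, U y‖
    linarith
  rw [← hint] at hle
  have key := sharpForm_lt hσ (hG.congr (Eventually.of_forall hcongr))
    (ae_kernel_nonneg hn hσ (b := b) (by linarith) hk) ?_
  · exact ⟨key.1.trans hle, fun h => (key.2 h).trans_le hle⟩
  filter_upwards [ae_ne] with y hy
  have h := pairRad_pos hσ hy
  have h2 := pairRad_lt_phi hσ hy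
  rw [kernel_eq hn hσ hy hk, ← hc, ← pairRad_sq hσ hy]
  refine mul_lt_mul_of_pos_left ?_ hc0
  rw [div_lt_iff₀ (h.trans h2)]
  calc pairRad σ y ^ 3 = pairRad σ y ^ 2 * pairRad σ y := by ring
    _ < _ := mul_lt_mul_of_pos_left h2 (by positivity)

end Bounds

/-! ### Identification of the constant. -/

lemma rpow_half_sq (x : ℝ) {a : ℝ} (ha : 0 < a) : a ^ x = (a ^ (x / 2)) ^ 2 := by
  rw [← Real.rpow_natCast, ← Real.rpow_mul ha.le]
  congr 1
  push_cast
  ring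

/-- Legendre's duplication formula at n/2. It removes the Gamma function that occurs in `constF` but
not in `sphereConst`. -/
lemma gamma_half {n : ℕ} (hn : 1 ≤ n) : Real.Gamma (((n : ℝ) + 1) / 2) =
    Real.Gamma n * 2 * Real.sqrt Real.pi / ((2 ^ ((n : ℝ) / 2)) ^ 2 * Real.Gamma ((n : ℝ) / 2)) := by
  have hn' : (1 : ℝ) ≤ n := by exact_mod_cast hn
  have h := Real.Gamma_mul_Gamma_add_half ((n : ℝ) / 2)
  have hG := Real.Gamma_pos_of_pos (show 0 < (n : ℝ) / 2 by linarith)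
  rw [show (n : ℝ) / 2 + 1 / 2 = ((n : ℝ) + 1) / 2 by ring, show 2 * ((n : ℝ) / 2) = n by ring,
    Real.rpow_sub two_pos, Real.rpow_one, rpow_half_sq (n : ℝ) two_pos] at h
  rw [eq_div_iff (by positivity), mul_comm, mul_assoc, h]
  field_simp

/-- The powers of 2π come from Mathlib's normalisation of frequencies: (2π)² from the square of the
Sobolev norm squared with k = 1, and (2π)^{2b} from the symbol of the null form. -/
lemma constF_one {n : ℕ} (hn : 1 ≤ n) {b : ℝ} (hb : 2 * b + n = 2) :
    constF (b / 2) (n + 1) * (2 * Real.pi) ^ 2 =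
      (2 * Real.pi) ^ (2 * b) * (2 ^ (b - 1) * sphereConst n b) := by
  have hn' : (1 : ℝ) ≤ n := by exact_mod_cast hn
  have hpi := Real.pi_pos
  have hG := Real.Gamma_pos_of_pos (show 0 < (n : ℝ) / 2 by linarith)
  have hG' := Real.Gamma_pos_of_pos (show 0 < (n : ℝ) by linarith)
  obtain rfl : b = 1 - n / 2 := by linarith
  rw [constF, sphereConst]
  push_cast
  rw [show (n : ℝ) + 1 - 3 + 4 * ((1 - n / 2) / 2) = 0 by ring,
    show ((n : ℝ) + 1 - 1) / 2 + 2 * ((1 - n / 2) / 2) = 1 by ring,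
    show (n : ℝ) + 1 - 2 + 2 * ((1 - n / 2) / 2) = n / 2 by ring,
    show (3 * ((n : ℝ) + 1) - 5) / 2 + 2 * ((1 - n / 2) / 2) = n by ring,
    show 1 - (n : ℝ) / 2 + n / 2 = 1 by ring, show (n : ℝ) + (1 - n / 2) = n / 2 + 1 by ring,
    show -(((n : ℝ) + 1) / 2) = -((n : ℝ) / 2 + 1 / 2) by ring,
    show 2 * (1 - (n : ℝ) / 2) = (2 : ℕ) - n by push_cast; ring,
    show 1 - (n : ℝ) / 2 - 1 = -((n : ℝ) / 2) by ring, Real.Gamma_add_one (by positivity),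
    gamma_half hn, Real.rpow_sub (by positivity), Real.rpow_natCast, Real.rpow_neg hpi.le,
    Real.rpow_add hpi, ← Real.sqrt_eq_rpow, Real.rpow_neg two_pos.le,
    rpow_half_sq (n : ℝ) (by positivity : 0 < 2 * Real.pi),
    Real.mul_rpow two_pos.le hpi.le, Real.rpow_zero, Real.rpow_one, Real.Gamma_one]
  have h1 : 0 < (2 : ℝ) ^ ((n : ℝ) / 2) := by positivity
  have h2 : 0 < Real.pi ^ ((n : ℝ) / 2) := by positivity
  have h3 : 0 < Real.sqrt Real.pi := by positivity
  field_simp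

/-- The additional 1/2 on the right comes from r² = (φ₁φ₂ - y₁·y₂ - σ²)/2, and the power (2π)⁴ from
k = 2. -/
lemma constF_two {n : ℕ} (hn : 1 ≤ n) {b : ℝ} (hb : 2 * b + n = 4) :
    constF (b / 2) (n + 1) * (2 * Real.pi) ^ 4 =
      (2 * Real.pi) ^ (2 * b) * (2 ^ (b - 1) * sphereConst n b / 2) := by
  have hn' : (1 : ℝ) ≤ n := by exact_mod_cast hn
  have hpi := Real.pi_pos
  have hG := Real.Gamma_pos_of_pos (show 0 < (n : ℝ) / 2 by linarith)
  have hG' := Real.Gamma_pos_of_pos (show 0 < (n : ℝ) by linarith)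
  obtain rfl : b = 2 - n / 2 := by linarith
  rw [constF, sphereConst]
  push_cast
  rw [show (n : ℝ) + 1 - 3 + 4 * ((2 - n / 2) / 2) = (2 : ℕ) by push_cast; ring,
    show ((n : ℝ) + 1 - 1) / 2 + 2 * ((2 - n / 2) / 2) = 2 by ring,
    show (n : ℝ) + 1 - 2 + 2 * ((2 - n / 2) / 2) = n / 2 + 1 by ring,
    show (3 * ((n : ℝ) + 1) - 5) / 2 + 2 * ((2 - n / 2) / 2) = n + 1 by ring,
    show 2 - (n : ℝ) / 2 + n / 2 = 2 by ring, show (n : ℝ) + (2 - n / 2) = n / 2 + 1 + 1 by ring,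
    show -(((n : ℝ) + 1) / 2) = -((n : ℝ) / 2 + 1 / 2) by ring,
    show 2 * (2 - (n : ℝ) / 2) = (4 : ℕ) - n by push_cast; ring,
    show 2 - (n : ℝ) / 2 - 1 = 1 - (n : ℝ) / 2 by ring, Real.Gamma_add_one (by positivity),
    Real.Gamma_add_one (by positivity), Real.Gamma_add_one (by positivity),
    gamma_half hn, Real.rpow_sub (by positivity), Real.rpow_natCast, Real.rpow_natCast,
    Real.rpow_neg hpi.le,
    Real.rpow_add hpi, ← Real.sqrt_eq_rpow, Real.rpow_sub two_pos,
    rpow_half_sq (n : ℝ) (by positivity : 0 < 2 * Real.pi),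
    Real.mul_rpow two_pos.le hpi.le, Real.rpow_one, Real.Gamma_two, Real.rpow_two]
  have h1 : 0 < (2 : ℝ) ^ ((n : ℝ) / 2) := by positivity
  have h2 : 0 < Real.pi ^ ((n : ℝ) / 2) := by positivity
  have h3 : 0 < Real.sqrt Real.pi := by positivity
  field_simp

end

end KleinGordon

namespace KleinGordon

noncomputable section

open scoped RealInnerProductSpace ComplexConjugate
open Filter Topology

/-! ### Sobolev norms as moments of the energy. -/

section Norms

variable {d : ℕ} {s α : ℝ} {k : ℕ}

lemma norm_phiPowSymbol_sq (hs : 0 < s) (hα : 2 * α = k) (y : Space d) :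
    ‖phiPowSymbol s α y‖ ^ 2 = (2 * Real.pi) ^ k * energy (s / (2 * Real.pi)) y ^ k := by
  have h := energy_pos (show 0 < s / (2 * Real.pi) by positivity) y
  rw [phiPowSymbol, Complex.norm_real, phiSymbol_eq, Real.norm_of_nonneg (by positivity),
    ← Real.rpow_natCast, ← Real.rpow_mul (by positivity), ← mul_pow, ← Real.rpow_natCast _ k,
    ← hα]
  congr 1
  push_cast
  ring

@[fun_prop]
lemma measurable_phiPowSymbol :
    Measurable (phiPowSymbol s α : Space d → ℂ) := by
  unfold phiPowSymbol
  simp only [phiSymbol_eq]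
  fun_prop

lemma sobolev_iff (hs : 0 < s) (hα : 2 * α = k) (f : L2 d) : f ∈ Sobolev d s α ↔
    Integrable fun y => energy (s / (2 * Real.pi)) y ^ k * ‖(𝓕 f : L2 d) y‖ ^ 2 := by
  have hF := measurable_L2 (𝓕 f : L2 d)
  have hm := measurable_phiPowSymbol (d := d) (s := s) (α := α)
  have hm2 : Measurable fun y => phiPowSymbol s α y * (𝓕 f : L2 d) y := hm.mul hF
  change MemLp _ _ _ ↔ _
  rw [memLp_two_iff_integrable_sq_norm hm2.aestronglyMeasurable]
  have hpi : (2 * Real.pi) ^ k ≠ 0 := by positivity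
  have e : (fun y => ‖phiPowSymbol s α y * (𝓕 f : L2 d) y‖ ^ 2) = fun y => (2 * Real.pi) ^ k *
      (energy (s / (2 * Real.pi)) y ^ k * ‖(𝓕 f : L2 d) y‖ ^ 2) := by
    ext y
    rw [norm_mul, mul_pow, norm_phiPowSymbol_sq hs hα, mul_assoc]
  rw [e, integrable_const_mul_iff hpi.isUnit]

lemma sobolevSq_eq (hs : 0 < s) (hα : 2 * α = k) {f : L2 d} (hf : f ∈ Sobolev d s α) :
    sobolevSq s α f = (2 * Real.pi) ^ k * moment (s / (2 * Real.pi)) k (𝓕 f : L2 d) := by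
  have hf' : InDomain (phiPowSymbol s α) f := hf
  rw [sobolevSq, phiDPow, norm_fourierMul hf', hf'.eLpNorm_eq_integral_rpow_norm (by simp) (by simp),
    ENNReal.toReal_ofReal (by positivity), moment, ← integral_const_mul, ← Real.rpow_natCast,
    ← Real.rpow_mul (by positivity)]
  simp only [ENNReal.toReal_ofNat, Nat.cast_ofNat, inv_mul_cancel₀ (two_ne_zero' ℝ), Real.rpow_one,
    Real.rpow_two, norm_mul, mul_pow, norm_phiPowSymbol_sq hs hα, mul_assoc]

lemma fourier_ae_ne_zero {f : L2 d} (hf : f ≠ 0) : ¬ (𝓕 f : L2 d) =ᵐ[volume] 0 := fun h => by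
  have h0 : (𝓕 f : L2 d) = 0 := (Lp.eq_zero_iff_ae_eq_zero).2 h
  rw [← norm_ne_zero_iff, ← Lp.norm_fourier_eq, h0, norm_zero] at hf
  exact hf rfl

end Norms

/-- Takes square roots in the weak and the strict inequality at once; `p` stands for the condition
that the datum is non-zero. -/
lemma le_ofReal_of_sq_le {X Y : ℝ≥0∞} {A B C R : ℝ} (hA : 0 < A) (hC : 0 ≤ C) (hR : 0 ≤ R)
    (h : A * B = C * R ^ 2) (hX : X ^ 2 ≤ ENNReal.ofReal A * Y) {p : Prop}
    (hY : Y ≤ ENNReal.ofReal B ∧ (p → Y < ENNReal.ofReal B)) :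
    X ≤ ENNReal.ofReal (C ^ (1 / 2 : ℝ) * R) ∧ (p → X < ENNReal.ofReal (C ^ (1 / 2 : ℝ) * R)) := by
  have e : ENNReal.ofReal (C ^ (1 / 2 : ℝ) * R) ^ 2 = ENNReal.ofReal A * ENNReal.ofReal B := by
    rw [← ENNReal.ofReal_pow (by positivity), ← ENNReal.ofReal_mul hA.le, h, mul_pow,
      ← Real.sqrt_eq_rpow, Real.sq_sqrt hC]
  constructor
  · rw [← ENNReal.pow_le_pow_left_iff two_ne_zero, e]
    exact hX.trans (mul_le_mul_right hY.1 _)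
  · intro hp
    rw [← ENNReal.pow_lt_pow_left_iff two_ne_zero, e]
    exact hX.trans_lt ((ENNReal.mul_lt_mul_iff_right (by simpa using hA) ENNReal.ofReal_ne_top).2
      (hY.2 hp))

/-! ### The sharp estimates, with strict inequality for non-zero data. -/

section Final

variable {n : ℕ} {s : ℝ}

lemma nullFormNorm_sq_le (hn : 1 ≤ n) (hs : 0 < s) {b : ℝ} (hb : 0 < b + (n : ℝ) / 2)
    (f : L2 (n + 1)) : nullFormNorm s (b / 2) f ^ 2 ≤ ENNReal.ofReal ((2 * Real.pi) ^ (2 * b)) *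
      sharpForm (s / (2 * Real.pi)) b (𝓕 f : L2 (n + 1)) := by
  have h := eLpNorm_sq_le_sharpForm hn (show 0 < s / (2 * Real.pi) by positivity) (β := b / 2)
    (by linarith) (measurable_L2 (𝓕 f : L2 (n + 1)))
  rw [show 4 * (b / 2) = 2 * b by ring, show 2 * (b / 2) = b by ring] at h
  rwa [nullFormNorm_eq hs]

lemma constF_one_pos (hn : 1 ≤ n) {b : ℝ} (hb : 2 * b + n = 2) : 0 < constF (b / 2) (n + 1) := by
  have h := constF_one hn hb
  have h2 := kernel_const_pos (b := b) hn (by linarith)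
  have hpi := Real.pi_pos
  refine pos_of_mul_pos_left (b := (2 * Real.pi) ^ 2) ?_ (by positivity)
  rw [h]
  positivity

lemma constF_two_pos (hn : 1 ≤ n) {b : ℝ} (hb : 2 * b + n = 4) : 0 < constF (b / 2) (n + 1) := by
  have h := constF_two hn hb
  have h2 := kernel_const_pos (b := b) hn (by linarith)
  have hpi := Real.pi_pos
  refine pos_of_mul_pos_left (b := (2 * Real.pi) ^ 4) ?_ (by positivity)
  rw [h]
  positivity

theorem nullFormNorm_le_half (hn : 1 ≤ n) (hs : 0 < s) {b : ℝ} (hb : 2 * b + n = 2)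
    {f : L2 (n + 1)} (hf : f ∈ Sobolev (n + 1) s (1 / 2)) :
    nullFormNorm s (b / 2) f ≤
      ENNReal.ofReal (constF (b / 2) (n + 1) ^ (1 / 2 : ℝ) * sobolevSq s (1 / 2) f) ∧
    (f ≠ 0 → nullFormNorm s (b / 2) f <
      ENNReal.ofReal (constF (b / 2) (n + 1) ^ (1 / 2 : ℝ) * sobolevSq s (1 / 2) f)) := by
  have hα : 2 * (1 / 2 : ℝ) = (1 : ℕ) := by norm_num
  have hσ : 0 < s / (2 * Real.pi) := by positivity
  obtain ⟨h1, h2⟩ := sharpForm_le_moment_one hn hσ hb ((sobolev_iff hs hα f).1 hf)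
  refine le_ofReal_of_sq_le (R := sobolevSq s (1 / 2) f) (by positivity)
    (constF_one_pos hn hb).le (sq_nonneg _) ?_
    (nullFormNorm_sq_le hn hs (by linarith) f) ⟨h1, fun hf0 => h2 (fourier_ae_ne_zero hf0)⟩
  rw [sobolevSq_eq hs hα hf, mul_pow, ← pow_mul, one_mul, ← mul_assoc (constF _ _),
    constF_one hn hb]
  ring

lemma sobolev_one_subset (hs : 0 < s) {f : L2 n} (hf : f ∈ Sobolev n s 1) :
    f ∈ Sobolev n s (1 / 2) :=
  (sobolev_iff hs (k := 1) (by norm_num) f).2 <| integrable_moment_of_le (by positivity)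
    (measurable_L2 _) ((sobolev_iff hs (k := 2) (by norm_num) f).1 hf)

lemma moment_nonneg (σ : ℝ) (k : ℕ) (F : Space n → ℂ) : 0 ≤ moment σ k F :=
  integral_nonneg fun y => by
    have : 0 ≤ energy σ y := Real.sqrt_nonneg _
    positivity

lemma mul_moment_one_le {σ : ℝ} (hσ : 0 < σ) {F : Space n → ℂ} (hm : Measurable F)
    (hF : Integrable fun y => energy σ y ^ 2 * ‖F y‖ ^ 2) : σ * moment σ 1 F ≤ moment σ 2 F := by
  rw [moment, moment, ← integral_const_mul]
  refine integral_mono ((integrable_moment_of_le hσ hm hF).const_mul σ) hF fun y => ?_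
  have h1 := le_energy σ y
  have h2 := energy_pos hσ y
  simp only
  rw [← mul_assoc, pow_one, sq (energy σ y)]
  gcongr

/-- `Real.sqrt` is 0 on negative numbers, so the radicand must be shown nonnegative; this follows
from φ ≥ σ, which gives σM₁ ≤ M₂ for the moments. -/
lemma refinedRhs_sq (hs : 0 < s) {f : L2 n} (hf : f ∈ Sobolev n s 1) :
    refinedRhs s f ^ 2 = (2 * Real.pi) ^ 4 * (moment (s / (2 * Real.pi)) 2 (𝓕 f : L2 n) ^ 2 -
      (s / (2 * Real.pi)) ^ 2 * moment (s / (2 * Real.pi)) 1 (𝓕 f : L2 n) ^ 2) := by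
  have h1 := sobolevSq_eq hs (k := 1) (by norm_num) (sobolev_one_subset hs hf)
  have h2 := sobolevSq_eq hs (k := 2) (by norm_num) hf
  have hσ : 0 < s / (2 * Real.pi) := by positivity
  have h3 := mul_moment_one_le hσ (measurable_L2 (𝓕 f : L2 n))
    ((sobolev_iff hs (k := 2) (by norm_num) f).1 hf)
  have h4 := moment_nonneg (s / (2 * Real.pi)) 1 (𝓕 f : L2 n)
  unfold sobolevSq at h1 h2
  have e : ‖phiDPow s 1 f‖ ^ 4 - s ^ 2 * ‖phiDPow s (1 / 2) f‖ ^ 4 =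
      (2 * Real.pi) ^ 4 * (moment (s / (2 * Real.pi)) 2 (𝓕 f : L2 n) ^ 2 -
      (s / (2 * Real.pi)) ^ 2 * moment (s / (2 * Real.pi)) 1 (𝓕 f : L2 n) ^ 2) := by
    rw [show ‖phiDPow s 1 f‖ ^ 4 = (‖phiDPow s 1 f‖ ^ 2) ^ 2 by ring,
      show ‖phiDPow s (1 / 2) f‖ ^ 4 = (‖phiDPow s (1 / 2) f‖ ^ 2) ^ 2 by ring, h1, h2]
    field_simp
  rw [refinedRhs, Real.sq_sqrt, e]
  rw [e]
  have h5 := pow_le_pow_left₀ (mul_nonneg hσ.le h4) h3 2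
  rw [mul_pow] at h5
  exact mul_nonneg (by positivity) (sub_nonneg.2 h5)

lemma refinedRhs_le_sobolevSq (s : ℝ) (f : L2 n) : refinedRhs s f ≤ sobolevSq s 1 f := by
  rw [refinedRhs, sobolevSq]
  refine Real.sqrt_le_iff.2 ⟨by positivity, ?_⟩
  have : 0 ≤ s ^ 2 * ‖phiDPow s (1 / 2) f‖ ^ 4 := by positivity
  calc _ ≤ ‖phiDPow s 1 f‖ ^ 4 := by linarith
    _ = _ := by ring

theorem nullFormNorm_le_refined (hn : 1 ≤ n) (hs : 0 < s) {b : ℝ} (hb : 2 * b + n = 4)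
    {f : L2 (n + 1)} (hf : f ∈ Sobolev (n + 1) s 1) :
    nullFormNorm s (b / 2) f ≤
      ENNReal.ofReal (constF (b / 2) (n + 1) ^ (1 / 2 : ℝ) * refinedRhs s f) ∧
    (f ≠ 0 → nullFormNorm s (b / 2) f <
      ENNReal.ofReal (constF (b / 2) (n + 1) ^ (1 / 2 : ℝ) * refinedRhs s f)) := by
  have hα : 2 * (1 : ℝ) = (2 : ℕ) := by norm_num
  have hσ : 0 < s / (2 * Real.pi) := by positivity
  obtain ⟨h1, h2⟩ := sharpForm_le_moment_two hn hσ hb (measurable_L2 _)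
    ((sobolev_iff hs hα f).1 hf)
  refine le_ofReal_of_sq_le (R := refinedRhs s f) (by positivity) (constF_two_pos hn hb).le
    (Real.sqrt_nonneg _) ?_
    (nullFormNorm_sq_le hn hs (by linarith) f) ⟨h1, fun hf0 => h2 (fourier_ae_ne_zero hf0)⟩
  rw [refinedRhs_sq hs hf, ← mul_assoc (constF _ _), constF_two hn hb]
  ring

end Final

end

end KleinGordon

namespace KleinGordon

noncomputable section

open scoped RealInnerProductSpace ComplexConjugate
open Filter Topology

/-! ### A family of near extremisers -/

lemma integrable_exp_neg_energy {d : ℕ} {σ a : ℝ} (hσ : 0 < σ) (ha : 0 < a) :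
    Integrable fun y : Space d => Real.exp (-(a * energy σ y)) := by
  have h1 : Integrable fun y : Space d => (energy σ y ^ (d + 1))⁻¹ := by
    refine ⟨Measurable.aestronglyMeasurable (by fun_prop), ?_⟩
    rw [hasFiniteIntegral_iff_ofReal (Eventually.of_forall fun y => by
      have := energy_pos hσ y
      positivity)]
    exact lintegral_inv_energy_pow_lt_top hσ (Nat.lt_succ_self d)
  refine (h1.const_mul ((Nat.factorial (d + 1) : ℝ) / a ^ (d + 1))).mono'
    (Measurable.aestronglyMeasurable (by fun_prop)) (Eventually.of_forall fun y => ?_)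
  have he := energy_pos hσ y
  have h := Real.pow_div_factorial_le_exp (a * energy σ y) (by positivity) (d + 1)
  rw [Real.norm_of_nonneg (Real.exp_pos _).le, Real.exp_neg]
  calc (Real.exp (a * energy σ y))⁻¹ ≤ ((a * energy σ y) ^ (d + 1) / (Nat.factorial (d + 1)))⁻¹ :=
        inv_anti₀ (by positivity) h
    _ = _ := by
        rw [mul_pow]
        field_simp

/-- The Fourier transform of a near extremiser. -/
def testFn {d : ℕ} (σ a : ℝ) (y : Space d) : ℂ :=
  ((Real.exp (-(a * energy σ y)) / energy σ y : ℝ) : ℂ)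

@[fun_prop]
lemma measurable_testFn {d : ℕ} (σ a : ℝ) : Measurable (testFn σ a : Space d → ℂ) := by
  unfold testFn
  fun_prop

lemma norm_testFn {d : ℕ} {σ : ℝ} (hσ : 0 < σ) (a : ℝ) (y : Space d) :
    ‖testFn σ a y‖ = Real.exp (-(a * energy σ y)) / energy σ y := by
  have := energy_pos hσ y
  rw [testFn, Complex.norm_real, Real.norm_of_nonneg (by positivity)]

lemma norm_testFn_sq {d : ℕ} {σ : ℝ} (hσ : 0 < σ) (a : ℝ) (y : Space d) :
    ‖testFn σ a y‖ ^ 2 = Real.exp (-(2 * a * energy σ y)) / energy σ y ^ 2 := by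
  rw [norm_testFn hσ, div_pow, ← Real.exp_nat_mul]
  congr 2
  push_cast
  ring

lemma integrable_testFn {d : ℕ} {σ a : ℝ} (hσ : 0 < σ) (ha : 0 < a) :
    Integrable (testFn σ a : Space d → ℂ) := by
  refine ((integrable_exp_neg_energy hσ ha).const_mul σ⁻¹).mono'
    (measurable_testFn σ a).aestronglyMeasurable (Eventually.of_forall fun y => ?_)
  rw [norm_testFn hσ, div_eq_inv_mul]
  gcongr
  exact le_energy σ y

lemma integrable_energy_pow_mul_testFn {d : ℕ} {σ a : ℝ} (hσ : 0 < σ) (ha : 0 < a) {k : ℕ}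
    (hk : k ≤ 2) : Integrable fun y : Space d => energy σ y ^ k * ‖testFn σ a y‖ ^ 2 := by
  refine ((integrable_exp_neg_energy hσ (show 0 < 2 * a by positivity)).const_mul
    ((σ ^ (2 - k))⁻¹)).mono' (Measurable.aestronglyMeasurable (by fun_prop))
    (Eventually.of_forall fun y => ?_)
  have he := energy_pos hσ y
  rw [Real.norm_of_nonneg (by positivity), norm_testFn_sq hσ]
  calc energy σ y ^ k * (Real.exp (-(2 * a * energy σ y)) / energy σ y ^ 2) =
      (energy σ y ^ (2 - k))⁻¹ * Real.exp (-(2 * a * energy σ y)) := by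
        rw [show energy σ y ^ 2 = energy σ y ^ k * energy σ y ^ (2 - k) by
          rw [← pow_add, Nat.add_sub_cancel' hk]]
        field_simp
    _ ≤ _ := by
        gcongr
        exact le_energy σ y

lemma memLp_testFn {d : ℕ} {σ a : ℝ} (hσ : 0 < σ) (ha : 0 < a) :
    MemLp (testFn σ a : Space d → ℂ) 2 volume := by
  rw [memLp_two_iff_integrable_sq_norm (measurable_testFn σ a).aestronglyMeasurable]
  simpa using integrable_energy_pow_mul_testFn (d := d) hσ ha (Nat.zero_le 2)

/-! ### Equality in the quadrilinear bound for the test functions. -/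

section Equality

variable {n : ℕ} {σ a : ℝ}

lemma spaceTimeFourier_congr_ae (hσ : 0 < σ) {F G : Space (n + 1) → ℂ} (h : F =ᵐ[volume] G) :
    spaceTimeFourier σ F =ᵐ[volume] spaceTimeFourier σ G := by
  have h1 : ∀ᵐ y : Space (n + 1) × Space (n + 1), F y.1 = G y.1 ∧ F y.2 = G y.2 :=
    (ae_fst h).and (ae_snd h)
  rw [← map_pairMap hσ] at h1
  have h2 := ae_of_ae_map (measurable_pairMap σ).aemeasurable h1
  rw [ae_withDensity_iff (measurable_pairDens σ).ennreal_ofReal] at h2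
  rw [Measure.volume_eq_prod] at h2
  filter_upwards [Measure.ae_ae_of_ae_prod h2] with z hz
  refine integral_congr_ae ?_
  filter_upwards [hz] with v hv
  by_cases h0 : pairDens σ (z, v) = 0
  · simp [h0]
  · have hpos := (pairDens_nonneg hσ (z, v)).lt_of_ne' h0
    obtain ⟨e1, e2⟩ := hv (by simpa using hpos)
    rw [e1, e2]

/-- The test function is real and nonnegative, so nothing is lost when the absolute value is taken
inside. -/
lemma enorm_spaceTimeFourier_testFn (hσ : 0 < σ) (ha : 0 < a) :
    ∀ᵐ z : SpaceTime (n + 1), ‖spaceTimeFourier σ (testFn σ a) z‖ₑ =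
      ∫⁻ v : Space n, ENNReal.ofReal (pairDens σ (z, v)) *
        (‖testFn σ a (pairMap σ (z, v)).1‖ₑ * ‖testFn σ a (pairMap σ (z, v)).2‖ₑ) := by
  have h := integrable_pairMap hσ (integrable_tensor (integrable_testFn (d := n + 1) hσ ha))
  rw [Measure.volume_eq_prod] at h
  filter_upwards [h.prod_right_ae] with z hz
  have e : ∀ v : Space n, (pairDens σ (z, v) : ℂ) * (testFn σ a (pairMap σ (z, v)).1 *
      conj (testFn σ a (pairMap σ (z, v)).2)) = ((pairDens σ (z, v) *
        (‖testFn σ a (pairMap σ (z, v)).1‖ * ‖testFn σ a (pairMap σ (z, v)).2‖) : ℝ) : ℂ) := fun v => by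
    rw [norm_testFn hσ, norm_testFn hσ, testFn, testFn, Complex.conj_ofReal]
    push_cast
    ring
  simp only [e] at hz
  have hz' : Integrable fun v : Space n => pairDens σ (z, v) *
        (‖testFn σ a (pairMap σ (z, v)).1‖ * ‖testFn σ a (pairMap σ (z, v)).2‖) := by
    simpa using hz.re
  have hnn : ∀ v : Space n, 0 ≤ pairDens σ (z, v) *
        (‖testFn σ a (pairMap σ (z, v)).1‖ * ‖testFn σ a (pairMap σ (z, v)).2‖) := fun v =>
    mul_nonneg (pairDens_nonneg hσ _) (by positivity)
  rw [spaceTimeFourier]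
  simp only [e]
  rw [integral_complex_ofReal, ← ofReal_norm, Complex.norm_real,
    Real.norm_of_nonneg (integral_nonneg hnn),
    ofReal_integral_eq_lintegral_ofReal hz' (Eventually.of_forall hnn)]
  refine lintegral_congr fun v => ?_
  rw [ENNReal.ofReal_mul (pairDens_nonneg hσ _), ENNReal.ofReal_mul (norm_nonneg _), ofReal_norm,
    ofReal_norm]

lemma quadIntegrand_testFn (hσ : 0 < σ) (z : SpaceTime (n + 1)) (v v' : Space n) :
    quadIntegrand σ (fun x => ‖testFn σ a x‖ₑ ^ 2) ((z, v), v') =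
      (ENNReal.ofReal (pairDens σ (z, v)) *
        (‖testFn σ a (pairMap σ (z, v)).1‖ₑ * ‖testFn σ a (pairMap σ (z, v)).2‖ₑ)) *
      (ENNReal.ofReal (pairDens σ (z, v')) *
        (‖testFn σ a (pairMap σ (z, v')).1‖ₑ * ‖testFn σ a (pairMap σ (z, v')).2‖ₑ)) := by
  by_cases hz : |z.fst| < ‖z.snd‖
  swap
  · simp [quadIntegrand, pairDens, hz]
  have h1 : energy σ (pairMap σ (z, v)).1 - energy σ (pairMap σ (z, v)).2 = z.fst :=
    congrArg (fun w : SpaceTime (n + 1) => w.fst) (freq_pairMap (x := (z, v)) hσ hz)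
  have h2 : energy σ (pairMap σ (z, v')).1 - energy σ (pairMap σ (z, v')).2 = z.fst :=
    congrArg (fun w : SpaceTime (n + 1) => w.fst) (freq_pairMap (x := (z, v')) hσ hz)
  have p1 := energy_pos hσ (pairMap σ (z, v)).1
  have p2 := energy_pos hσ (pairMap σ (z, v)).2
  have p3 := energy_pos hσ (pairMap σ (z, v')).1
  have p4 := energy_pos hσ (pairMap σ (z, v')).2
  simp only [quadIntegrand, quadWeight, ← ofReal_norm, norm_testFn hσ]
  set w := energy σ (pairMap σ (z, v)).1
  set x := energy σ (pairMap σ (z, v)).2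
  set y := energy σ (pairMap σ (z, v')).1
  set u := energy σ (pairMap σ (z, v')).2
  have key : ENNReal.ofReal (Real.exp (-(a * w)) / w) ^ 2 * ENNReal.ofReal (Real.exp (-(a * u)) / u) ^ 2 *
      ENNReal.ofReal (w * u) * ENNReal.ofReal ((x * y)⁻¹) =
      (ENNReal.ofReal (Real.exp (-(a * w)) / w) * ENNReal.ofReal (Real.exp (-(a * x)) / x)) *
      (ENNReal.ofReal (Real.exp (-(a * y)) / y) * ENNReal.ofReal (Real.exp (-(a * u)) / u)) := by
    rw [← ENNReal.ofReal_pow (by positivity), ← ENNReal.ofReal_pow (by positivity),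
      ← ENNReal.ofReal_mul (by positivity), ← ENNReal.ofReal_mul (by positivity),
      ← ENNReal.ofReal_mul (by positivity), ← ENNReal.ofReal_mul (by positivity),
      ← ENNReal.ofReal_mul (by positivity), ← ENNReal.ofReal_mul (by positivity)]
    congr 1
    -- Both pairs have energy difference `z.fst`, so w + u = x + y: conservation of energy gives
    -- equality in the weighted inequality.
    have hexp : Real.exp (-(a * w)) * Real.exp (-(a * u)) =
        Real.exp (-(a * x)) * Real.exp (-(a * y)) := by
      rw [← Real.exp_add, ← Real.exp_add]
      congr 1
      linear_combination (-a) * (h1 - h2)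
    field_simp
    linear_combination hexp
  rw [key]
  ring

lemma eLpNorm_testFn (hn : 1 ≤ n) (hσ : 0 < σ) (ha : 0 < a) {b : ℝ} (hb : 0 < b + (n : ℝ) / 2) :
    eLpNorm (fun z : SpaceTime (n + 1) => ((boxPowSymbol (b / 2) z : ℝ) : ℂ) *
      spaceTimeFourier σ (testFn σ a) z) 2 volume ^ 2 =
      ENNReal.ofReal ((2 * Real.pi) ^ (2 * b)) * sharpForm σ b (testFn σ a : Space (n + 1) → ℂ) := by
  rw [eLpNorm_boxPowSymbol_mul, sharpForm,
    ← lintegral_quad hn hσ hb (N := fun x => ‖testFn σ a x‖ₑ ^ 2) (by fun_prop),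
    show 4 * (b / 2) = 2 * b by ring, show 2 * (b / 2) = b by ring]
  congr 1
  refine lintegral_congr_ae ?_
  filter_upwards [enorm_spaceTimeFourier_testFn hσ ha] with z hz
  have hD : Measurable fun v : Space n => pairDens σ (z, v) :=
    (measurable_pairDens (n := n) σ).comp measurable_prodMk_left
  have hT : Measurable fun v : Space n => pairMap σ (z, v) :=
    (measurable_pairMap (n := n) σ).comp measurable_prodMk_left
  rw [hz]
  congr 1
  simp only [quadIntegrand_testFn hσ]
  rw [sq, ← lintegral_mul_const _ (by fun_prop)]
  refine lintegral_congr fun v => ?_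
  rw [lintegral_const_mul _ (by fun_prop)]

end Equality

/-- A near extremiser. -/
def testL2 {d : ℕ} {σ a : ℝ} (hσ : 0 < σ) (ha : 0 < a) : L2 d :=
  𝓕⁻ ((memLp_testFn hσ ha).toLp (testFn σ a) : L2 d)

lemma fourier_testL2 {d : ℕ} {σ a : ℝ} (hσ : 0 < σ) (ha : 0 < a) :
    (𝓕 (testL2 hσ ha : L2 d) : L2 d) =ᵐ[volume] testFn σ a := by
  rw [testL2, fourier_fourierInv_eq]
  exact (memLp_testFn hσ ha).coeFn_toLp

lemma nullFormNorm_testL2 {n : ℕ} (hn : 1 ≤ n) {s a : ℝ} (hs : 0 < s)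
    (hσ : 0 < s / (2 * Real.pi)) (ha : 0 < a) {b : ℝ} (hb : 0 < b + (n : ℝ) / 2) :
    nullFormNorm s (b / 2) (testL2 hσ ha : L2 (n + 1)) ^ 2 =
      ENNReal.ofReal ((2 * Real.pi) ^ (2 * b)) *
        sharpForm (s / (2 * Real.pi)) b (testFn (s / (2 * Real.pi)) a : Space (n + 1) → ℂ) := by
  rw [nullFormNorm_eq hs, ← eLpNorm_testFn hn hσ ha hb]
  congr 1
  refine eLpNorm_congr_ae ?_
  filter_upwards [spaceTimeFourier_congr_ae hσ (fourier_testL2 hσ ha)] with z hz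
  rw [hz]

lemma testL2_mem_sobolev {d : ℕ} {s a : ℝ} (hs : 0 < s) (hσ : 0 < s / (2 * Real.pi)) (ha : 0 < a)
    {α : ℝ} {k : ℕ} (hk : k ≤ 2) (hα : 2 * α = k) : (testL2 hσ ha : L2 d) ∈ Sobolev d s α := by
  rw [sobolev_iff hs hα]
  refine (integrable_energy_pow_mul_testFn hσ ha hk).congr ?_
  filter_upwards [fourier_testL2 (d := d) hσ ha] with y hy
  rw [hy]

lemma sobolevSq_testL2 {d : ℕ} {s a : ℝ} (hs : 0 < s) (hσ : 0 < s / (2 * Real.pi)) (ha : 0 < a)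
    {α : ℝ} {k : ℕ} (hk : k ≤ 2) (hα : 2 * α = k) : sobolevSq s α (testL2 hσ ha : L2 d) =
      (2 * Real.pi) ^ k * moment (s / (2 * Real.pi)) k (testFn (s / (2 * Real.pi)) a : Space d → ℂ) := by
  rw [sobolevSq_eq hs hα (testL2_mem_sobolev hs hσ ha hk hα), moment, moment]
  congr 1
  refine integral_congr_ae ?_
  filter_upwards [fourier_testL2 (d := d) hσ ha] with y hy
  rw [hy]

end

end KleinGordon

namespace KleinGordon

noncomputable section

open scoped RealInnerProductSpace ComplexConjugate
open Filter Topology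

/-! ### The limit of vanishing mass -/

section Scaling

variable {n : ℕ}

lemma lintegral_comp_inv_smul {d : ℕ} {a : ℝ} (ha : 0 < a) {H : Space d → ℝ≥0∞} (hH : Measurable H) :
    ∫⁻ y, H y = ENNReal.ofReal ((a ^ d)⁻¹) * ∫⁻ z, H (a⁻¹ • z) := by
  have h := Measure.map_addHaar_smul (volume : Measure (Space d)) (inv_ne_zero ha.ne')
  rw [← lintegral_map hH (measurable_const_smul a⁻¹), h, lintegral_smul_measure, smul_eq_mul,
    ← mul_assoc, ← ENNReal.ofReal_mul (by positivity)]
  have : (a ^ d)⁻¹ * |((a⁻¹) ^ Module.finrank ℝ (Space d))⁻¹| = 1 := by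
    rw [finrank_euclideanSpace_fin, abs_of_pos (by positivity), inv_pow, inv_inv]
    exact inv_mul_cancel₀ (by positivity)
  rw [this, ENNReal.ofReal_one, one_mul]

lemma lintegral_comp_inv_smul_prod {d : ℕ} {a : ℝ} (ha : 0 < a) {H : Space d × Space d → ℝ≥0∞}
    (hH : Measurable H) :
    ∫⁻ y, H y = ENNReal.ofReal ((a ^ d)⁻¹) ^ 2 * ∫⁻ z : Space d × Space d, H (a⁻¹ • z) := by
  have hm : Measurable fun p : Space d × Space d => H (a⁻¹ • p.1, p.2) :=
    hH.comp (by fun_prop)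
  have hm2 : Measurable fun p : Space d × Space d => H (a⁻¹ • p) := hH.comp (by fun_prop)
  rw [Measure.volume_eq_prod, lintegral_prod _ hH.aemeasurable, lintegral_prod _ hm2.aemeasurable,
    lintegral_comp_inv_smul ha hH.lintegral_prod_right', sq, mul_assoc,
    ← lintegral_const_mul _ hm2.lintegral_prod_right']
  congr 1
  refine lintegral_congr fun x => ?_
  rw [lintegral_comp_inv_smul ha (H := fun y => H (a⁻¹ • x, y)) (hH.comp measurable_prodMk_left)]
  rfl

lemma phi_inv_mul {a : ℝ} (ha : 0 < a) (σ r : ℝ) : phi σ (a⁻¹ * r) = a⁻¹ * phi (a * σ) r := by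
  rw [phi, phi, Real.sqrt_eq_iff_mul_self_eq (by positivity) (by positivity), mul_mul_mul_comm,
    Real.mul_self_sqrt (by positivity)]
  field_simp

lemma energy_inv_smul {d : ℕ} {a : ℝ} (ha : 0 < a) (σ : ℝ) (z : Space d) :
    energy σ (a⁻¹ • z) = a⁻¹ * energy (a * σ) z := by
  rw [energy, energy, norm_smul, Real.norm_of_nonneg (by positivity), phi_inv_mul ha]

lemma pairRad_inv_smul {a : ℝ} (ha : 0 < a) (σ : ℝ) (z : Space (n + 1) × Space (n + 1)) :
    pairRad σ (a⁻¹ • z) = a⁻¹ * pairRad (a * σ) z := by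
  rw [pairRad, pairRad, cmRad, cmRad, Prod.smul_fst, Prod.smul_snd, ← smul_add, norm_smul,
    Real.norm_of_nonneg (by positivity), energy_inv_smul ha, energy_inv_smul ha,
    show (((a⁻¹ * energy (a * σ) z.1 + a⁻¹ * energy (a * σ) z.2) ^ 2 - (a⁻¹ * ‖z.1 + z.2‖) ^ 2) / 4 -
      σ ^ 2) = (a⁻¹) ^ 2 * (((energy (a * σ) z.1 + energy (a * σ) z.2) ^ 2 - ‖z.1 + z.2‖ ^ 2) / 4 -
        (a * σ) ^ 2) by field_simp, Real.sqrt_mul (by positivity), Real.sqrt_sq (by positivity)]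

/-- The rescaled density of a near extremiser. -/
def massDens {d : ℕ} (j : ℕ) (μ : ℝ) (z : Space d) : ℝ :=
  Real.exp (-(2 * energy μ z)) / energy μ z ^ j

/-- The rescaled integrand of the sharp form at a near extremiser. -/
def pairMassDens (m : ℕ) (μ : ℝ) (z : Space (n + 1) × Space (n + 1)) : ℝ :=
  massDens 1 μ z.1 * massDens 1 μ z.2 * (pairRad μ z ^ m / phi μ (pairRad μ z))

@[fun_prop]
lemma measurable_massDens {d : ℕ} (j : ℕ) (μ : ℝ) : Measurable (massDens j μ : Space d → ℝ) := by
  unfold massDens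
  fun_prop

@[fun_prop]
lemma measurable_pairRad (μ : ℝ) :
    Measurable (pairRad μ : Space (n + 1) × Space (n + 1) → ℝ) := by
  unfold pairRad cmRad
  fun_prop

@[fun_prop]
lemma measurable_pairMassDens (m : ℕ) (μ : ℝ) :
    Measurable (pairMassDens m μ : Space (n + 1) × Space (n + 1) → ℝ) := by
  unfold pairMassDens phi
  fun_prop

lemma massDens_nonneg {d : ℕ} (j : ℕ) (μ : ℝ) (z : Space d) : 0 ≤ massDens j μ z := by
  have : 0 ≤ energy μ z := Real.sqrt_nonneg _
  unfold massDens
  positivity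

lemma pairMassDens_nonneg (m : ℕ) (μ : ℝ) (z : Space (n + 1) × Space (n + 1)) :
    0 ≤ pairMassDens m μ z := by
  have h1 := massDens_nonneg 1 μ z.1
  have h2 := massDens_nonneg 1 μ z.2
  have h3 : 0 ≤ pairRad μ z := Real.sqrt_nonneg _
  have h4 : 0 ≤ phi μ (pairRad μ z) := Real.sqrt_nonneg _
  unfold pairMassDens
  positivity

/-- The substitution y = z/a turns mass σ into aσ. The density φ^k |F|² carries φ^{k-2} = φ^{-j},
whence the factor a^j. -/
lemma moment_testFn {d : ℕ} {σ a : ℝ} (hσ : 0 < σ) (ha : 0 < a) {k j : ℕ} (hkj : k + j = 2) :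
    ENNReal.ofReal (moment σ k (testFn σ a : Space d → ℂ)) =
      ENNReal.ofReal ((a ^ d)⁻¹) * ENNReal.ofReal (a ^ j) *
        ∫⁻ z : Space d, ENNReal.ofReal (massDens j (a * σ) z) := by
  rw [moment, ofReal_integral_eq_lintegral_ofReal
    (integrable_energy_pow_mul_testFn hσ ha (by omega)) (Eventually.of_forall fun y => by
      have := energy_pos hσ y
      positivity), lintegral_comp_inv_smul ha (by fun_prop), mul_assoc]
  congr 1
  rw [← lintegral_const_mul _ (by fun_prop)]
  refine lintegral_congr fun z => ?_
  have := energy_pos (show 0 < a * σ by positivity) z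
  rw [← ENNReal.ofReal_mul (by positivity), norm_testFn_sq hσ, energy_inv_smul ha, massDens, ← hkj,
    show 2 * a * (a⁻¹ * energy (a * σ) z) = 2 * energy (a * σ) z by field_simp]
  congr 1
  rw [pow_add, mul_pow a⁻¹ _ j, inv_pow]
  field_simp

/-- The condition m + 2j = 3 makes the power of a the square of the one in `moment_testFn`, so it
cancels when the two sides of the estimate are compared. -/
lemma sharpForm_testFn (hn : 1 ≤ n) {σ a : ℝ} (hσ : 0 < σ) (ha : 0 < a) {b : ℝ}
    (hb : 0 < b + (n : ℝ) / 2) {m j : ℕ} (hm : 2 * b + n = m + 1) (hmj : m + 2 * j = 3) :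
    sharpForm σ b (testFn σ a : Space (n + 1) → ℂ) =
      (ENNReal.ofReal ((a ^ (n + 1))⁻¹) * ENNReal.ofReal (a ^ j)) ^ 2 *
        (ENNReal.ofReal (2 ^ (b - 1) * sphereConst n b) *
        ∫⁻ z : Space (n + 1) × Space (n + 1), ENNReal.ofReal (pairMassDens m (a * σ) z)) := by
  have hc := kernel_const_pos hn hb
  have e : sharpForm σ b (testFn σ a : Space (n + 1) → ℂ) =
      ∫⁻ y : Space (n + 1) × Space (n + 1), ENNReal.ofReal (‖testFn σ a y.1‖ ^ 2 *
        ‖testFn σ a y.2‖ ^ 2 * (energy σ y.1 * energy σ y.2) *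
        (2 ^ (b - 1) * sphereConst n b * (pairRad σ y ^ m / phi σ (pairRad σ y)))) := by
    refine lintegral_congr_ae ?_
    filter_upwards [ae_ne] with y hy
    have h1 := energy_pos hσ y.1
    have h2 := energy_pos hσ y.2
    rw [kernel_eq hn hσ hy hm, ← ofReal_norm, ← ofReal_norm, ← ENNReal.ofReal_pow (norm_nonneg _),
      ← ENNReal.ofReal_pow (norm_nonneg _), ← ENNReal.ofReal_mul (by positivity),
      ← ENNReal.ofReal_mul (by positivity), ← ENNReal.ofReal_mul (by positivity)]
  have hmeas : Measurable fun r : ℝ => phi σ r := by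
    unfold phi
    fun_prop
  rw [e, lintegral_comp_inv_smul_prod ha (by fun_prop), mul_pow, mul_assoc]
  congr 1
  rw [← lintegral_const_mul _ (by fun_prop), ← lintegral_const_mul _ (by fun_prop)]
  refine lintegral_congr fun z => ?_
  have h1 := energy_pos (show 0 < a * σ by positivity) z.1
  have h2 := energy_pos (show 0 < a * σ by positivity) z.2
  have h3 : 0 < phi (a * σ) (pairRad (a * σ) z) := Real.sqrt_pos.2 (by positivity)
  rw [← ENNReal.ofReal_mul hc.le, ← ENNReal.ofReal_pow (by positivity),
    ← ENNReal.ofReal_mul (by positivity), norm_testFn_sq hσ, norm_testFn_sq hσ, pairRad_inv_smul ha,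
    Prod.smul_fst, Prod.smul_snd, energy_inv_smul ha, energy_inv_smul ha, phi_inv_mul ha,
    show 2 * a * (a⁻¹ * energy (a * σ) z.1) = 2 * energy (a * σ) z.1 by field_simp,
    show 2 * a * (a⁻¹ * energy (a * σ) z.2) = 2 * energy (a * σ) z.2 by field_simp,
    pairMassDens, massDens, massDens, mul_pow a⁻¹ _ m, ← pow_mul, pow_one, pow_one]
  congr 1
  -- Two factors 1/φ from the densities and one from the kernel give a³, and r^m gives a^{-m}.
  have h4 : (a⁻¹) ^ m * a ^ 3 = a ^ (j * 2) := by
    rw [← hmj, pow_add, inv_pow, inv_mul_cancel_left₀ (by positivity), mul_comm]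
  rw [← h4]
  field_simp

end Scaling

/-! ### The massless integrals. -/

section Limit

variable {n : ℕ}

lemma energy_zero {d : ℕ} (z : Space d) : energy 0 z = ‖z‖ := by
  rw [energy, phi, zero_pow two_ne_zero, zero_add, Real.sqrt_sq (norm_nonneg _)]

lemma ae_ne_zero {d : ℕ} (hd : 1 ≤ d) : ∀ᵐ z : Space d, z ≠ 0 := by
  have : Nonempty (Fin d) := ⟨⟨0, hd⟩⟩
  rw [ae_iff]
  simp

/-- The energy increases with the mass, so the massless integral dominates the moment side of the
estimate for every a. -/
lemma massDens_le {d : ℕ} (hd : 1 ≤ d) (j : ℕ) (μ : ℝ) :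
    ∫⁻ z : Space d, ENNReal.ofReal (massDens j μ z) ≤
      ∫⁻ z : Space d, ENNReal.ofReal (massDens j 0 z) := by
  refine lintegral_mono_ae ?_
  filter_upwards [ae_ne_zero hd] with z hz
  have h0 : 0 < ‖z‖ := norm_pos_iff.2 hz
  have h1 := norm_le_energy μ z
  refine ENNReal.ofReal_le_ofReal ?_
  rw [massDens, massDens, energy_zero]
  gcongr

lemma lintegral_massDens_zero_lt_top {j : ℕ} (hj : j ≤ n) :
    ∫⁻ z : Space (n + 1), ENNReal.ofReal (massDens j 0 z) < ∞ := by
  rw [lintegral_polar (by fun_prop)]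
  have h : ∀ ω : Metric.sphere (0 : Space (n + 1)) 1, ∫⁻ r in Set.Ioi (0 : ℝ),
      ENNReal.ofReal (r ^ n) * ENNReal.ofReal (massDens j 0 (r • ω.1)) =
      ENNReal.ofReal ((1 / 2) ^ (((n - j : ℕ) : ℝ) + 1) * Real.Gamma (((n - j : ℕ) : ℝ) + 1)) := by
    intro ω
    rw [← lintegral_rpow_mul_exp (by positivity) two_pos]
    refine setLIntegral_congr_fun measurableSet_Ioi fun r hr => ?_
    have hr : 0 < r := hr
    have hω : ‖ω.1‖ = 1 := by simp
    rw [massDens, energy_zero, norm_smul, hω, mul_one, Real.norm_of_nonneg hr.le,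
      ← ENNReal.ofReal_mul (by positivity), add_sub_cancel_right, Real.rpow_natCast]
    congr 1
    rw [← Nat.sub_add_cancel hj, pow_add, Nat.add_sub_cancel]
    field_simp
  simp only [h, lintegral_const]
  exact ENNReal.mul_lt_top ENNReal.ofReal_lt_top (measure_lt_top _ _)

lemma lintegral_massDens_zero_ne_zero {d : ℕ} (hd : 1 ≤ d) (j : ℕ) :
    ∫⁻ z : Space d, ENNReal.ofReal (massDens j 0 z) ≠ 0 := by
  rw [Ne, lintegral_eq_zero_iff (by fun_prop)]
  intro h
  have : ∀ᵐ z : Space d, False := by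
    filter_upwards [h, ae_ne_zero hd] with z hz hz0
    have h0 : 0 < ‖z‖ := norm_pos_iff.2 hz0
    rw [massDens, energy_zero, Pi.zero_apply, ENNReal.ofReal_eq_zero] at hz
    have : 0 < Real.exp (-(2 * ‖z‖)) / ‖z‖ ^ j := by positivity
    linarith
  exact this.exists.choose_spec

lemma pairRad_zero (z : Space (n + 1) × Space (n + 1)) :
    pairRad 0 z = Real.sqrt ((‖z.1‖ * ‖z.2‖ - ⟪z.1, z.2⟫) / 2) := by
  rw [pairRad, cmRad, energy_zero, energy_zero, norm_add_sq_real]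
  congr 1
  ring

/-- In the massless case r vanishes only for parallel momenta. These lie on a line, a null set since
the dimension is at least 2. -/
lemma ae_pairRad_zero_pos (hn : 1 ≤ n) :
    ∀ᵐ z : Space (n + 1) × Space (n + 1), 0 < pairRad 0 z := by
  have hm : MeasurableSet {z : Space (n + 1) × Space (n + 1) | 0 < pairRad 0 z} :=
    measurableSet_lt measurable_const (by fun_prop)
  refine (Measure.ae_prod_iff_ae_ae hm).2 ?_
  filter_upwards [ae_ne_zero (d := n + 1) (by omega)] with x hx
  have hspan : (Submodule.span ℝ {x}) ≠ ⊤ := fun h => by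
    have h1 := finrank_span_singleton (K := ℝ) hx
    rw [h, finrank_top, finrank_euclideanSpace_fin] at h1
    omega
  have h0 : ∀ᵐ y : Space (n + 1), y ∉ (Submodule.span ℝ {x} : Set (Space (n + 1))) := by
    rw [ae_iff]
    simpa using Measure.addHaar_submodule volume _ hspan
  filter_upwards [h0] with y hy
  rw [pairRad_zero]
  refine Real.sqrt_pos.2 (div_pos (sub_pos.2 ((real_inner_le_norm _ _).lt_of_ne fun h => hy ?_))
    two_pos)
  rw [inner_eq_norm_mul_iff_real] at h
  refine Submodule.mem_span_singleton.2 ⟨‖x‖⁻¹ * ‖y‖, ?_⟩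
  rw [mul_smul, h, smul_smul, inv_mul_cancel₀ (norm_ne_zero_iff.2 hx), one_smul]

lemma tendsto_pairMassDens (m : ℕ) {z : Space (n + 1) × Space (n + 1)} (hz : 0 < pairRad 0 z)
    {u : ℕ → ℝ} (hu : Tendsto u atTop (𝓝 0)) :
    Tendsto (fun i => pairMassDens m (u i) z) atTop (𝓝 (pairMassDens m 0 z)) := by
  have h1 : z.1 ≠ 0 := fun h => by simp [pairRad_zero, h] at hz
  have h2 : z.2 ≠ 0 := fun h => by simp [pairRad_zero, h] at hz
  have he : ∀ y : Space (n + 1), Continuous fun μ => energy μ y := fun y => by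
    unfold energy phi
    fun_prop
  have hr : Continuous fun μ => pairRad μ z := by
    have := he z.1
    have := he z.2
    unfold pairRad cmRad
    fun_prop
  have hp : Continuous fun μ => phi μ (pairRad μ z) := by
    unfold phi
    fun_prop
  have hd : ∀ y : Space (n + 1), y ≠ 0 → ContinuousAt (fun μ => massDens 1 μ y) 0 := fun y hy => by
    unfold massDens
    refine ContinuousAt.div ?_ ?_ ?_
    · exact (Real.continuous_exp.comp (by have := he y; fun_prop)).continuousAt
    · exact ((he y).pow 1).continuousAt
    · rw [energy_zero, pow_one]
      exact norm_ne_zero_iff.2 hy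
  have hc : ContinuousAt (fun μ => pairMassDens m μ z) 0 := by
    unfold pairMassDens
    refine ((hd _ h1).mul (hd _ h2)).mul (ContinuousAt.div (hr.pow m).continuousAt hp.continuousAt ?_)
    exact (Real.sqrt_pos.2 (by positivity)).ne'
  exact hc.tendsto.comp hu

/-- Without mass r/√(0 + r²) = 1, so the bound used for k = 1 becomes an equality. -/
lemma lintegral_pairMassDens_zero_one (hn : 1 ≤ n) :
    ∫⁻ z : Space (n + 1) × Space (n + 1), ENNReal.ofReal (pairMassDens 1 0 z) =
      (∫⁻ z : Space (n + 1), ENNReal.ofReal (massDens 1 0 z)) ^ 2 := by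
  rw [sq, ← lintegral_prod_mul (by fun_prop) (by fun_prop), ← Measure.volume_eq_prod]
  refine lintegral_congr_ae ?_
  filter_upwards [ae_pairRad_zero_pos hn] with z hz
  rw [← ENNReal.ofReal_mul (massDens_nonneg _ _ _), pairMassDens, phi, zero_pow two_ne_zero, zero_add,
    Real.sqrt_sq hz.le, pow_one, div_self hz.ne', mul_one]

/-- Without mass the kernel is r² = (‖z₁‖‖z₂‖ - z₁·z₂)/2. Averaging over z₁ ↦ -z₁ removes the inner
product, and the remaining product of norms cancels the denominators. -/
lemma two_mul_lintegral_pairMassDens_zero_three (hn : 1 ≤ n) :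
    2 * ∫⁻ z : Space (n + 1) × Space (n + 1), ENNReal.ofReal (pairMassDens 3 0 z) =
      (∫⁻ z : Space (n + 1), ENNReal.ofReal (massDens 0 0 z)) ^ 2 := by
  have hneg : MeasurePreserving (fun z : Space (n + 1) × Space (n + 1) => (-z.1, z.2)) :=
    (Measure.measurePreserving_neg volume).prod (MeasurePreserving.id volume)
  rw [two_mul]
  conv_lhs =>
    enter [2]
    rw [← hneg.lintegral_comp (by fun_prop)]
  rw [← lintegral_add_left (by fun_prop), sq, ← lintegral_prod_mul (by fun_prop) (by fun_prop),
    ← Measure.volume_eq_prod]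
  refine lintegral_congr_ae ?_
  filter_upwards [ae_pairRad_zero_pos hn,
    hneg.quasiMeasurePreserving.ae (ae_pairRad_zero_pos hn)] with z hz hz'
  rw [← ENNReal.ofReal_mul (massDens_nonneg _ _ _), ← ENNReal.ofReal_add (pairMassDens_nonneg _ _ _)
    (pairMassDens_nonneg _ _ _)]
  have h1 : 0 < ‖z.1‖ := norm_pos_iff.2 fun h => by simp [pairRad_zero, h] at hz
  have h2 : 0 < ‖z.2‖ := norm_pos_iff.2 fun h => by simp [pairRad_zero, h] at hz
  have e : ∀ w : Space (n + 1) × Space (n + 1), 0 < pairRad 0 w → pairMassDens 3 0 w =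
      massDens 1 0 w.1 * massDens 1 0 w.2 * ((‖w.1‖ * ‖w.2‖ - ⟪w.1, w.2⟫) / 2) := fun w hw => by
    rw [pairMassDens, phi, zero_pow two_ne_zero, zero_add, Real.sqrt_sq hw.le, pow_succ,
      mul_div_cancel_right₀ _ hw.ne', pairRad_zero, Real.sq_sqrt]
    rw [pairRad_zero] at hw
    exact (Real.sqrt_pos.1 hw).le
  rw [e z hz, e _ hz']
  simp only [massDens, energy_zero, norm_neg, inner_neg_left]
  congr 1
  field_simp
  ring

end Limit

end

end KleinGordon

namespace KleinGordon

noncomputable section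

open Filter Topology

/-! ### Optimality of the constants -/

section Optimality

variable {n : ℕ} {s : ℝ}

/-- The assumed estimate is tested on `testL2` and a → 0. The common power of a cancels, the norm
side is at most its massless value, and Fatou's lemma bounds the massless form from above. The
identity kI = J² then compares the constants. The triples (k, j, m) used are (1, 1, 1) and (2, 0,
3). -/
lemma constF_le_sq_of_bound (hn : 1 ≤ n) (hs : 0 < s) {b α K : ℝ} {k j m : ℕ}
    (hb : 0 < b + (n : ℝ) / 2) (hα : 2 * α = k) (hkj : k + j = 2) (hj : j ≤ n)
    (hm : 2 * b + n = m + 1) (hmj : m + 2 * j = 3) (hk : 0 < k)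
    (hI : (k : ℝ≥0∞) * ∫⁻ z : Space (n + 1) × Space (n + 1), ENNReal.ofReal (pairMassDens m 0 z) =
      (∫⁻ z : Space (n + 1), ENNReal.ofReal (massDens j 0 z)) ^ 2)
    (hc : constF (b / 2) (n + 1) * ((2 * Real.pi) ^ k) ^ 2 * k =
      (2 * Real.pi) ^ (2 * b) * (2 ^ (b - 1) * sphereConst n b)) (hK : 0 ≤ K)
    (h : ∀ f ∈ Sobolev (n + 1) s α, nullFormNorm s (b / 2) f ≤ ENNReal.ofReal (K * sobolevSq s α f)) :
    constF (b / 2) (n + 1) ≤ K ^ 2 := by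
  have hσ : 0 < s / (2 * Real.pi) := by positivity
  set σ := s / (2 * Real.pi) with hσ_def
  set J := ∫⁻ z : Space (n + 1), ENNReal.ofReal (massDens j 0 z) with hJ
  set I := ∫⁻ z : Space (n + 1) × Space (n + 1), ENNReal.ofReal (pairMassDens m 0 z) with hI_def
  have hJtop : J ≠ ∞ := (lintegral_massDens_zero_lt_top hj).ne
  have hJ0 : J ≠ 0 := lintegral_massDens_zero_ne_zero (by omega) j
  have hI0 : I ≠ 0 := fun h0 => by
    rw [h0, mul_zero] at hI
    exact pow_ne_zero 2 hJ0 hI.symm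
  have hItop : I ≠ ∞ := fun h0 => by
    rw [h0, ENNReal.mul_top (by exact_mod_cast hk.ne')] at hI
    exact ENNReal.pow_ne_top hJtop hI.symm
  have hker := kernel_const_pos hn hb
  set c := 2 ^ (b - 1) * sphereConst n b with hc_def
  set A := (2 * Real.pi) ^ (2 * b) * c with hA
  have hA0 : 0 < A := by positivity
  set B := (K * (2 * Real.pi) ^ k) ^ 2 with hB
  have hbound : ∀ a : ℝ, 0 < a → ∫⁻ z : Space (n + 1) × Space (n + 1),
      ENNReal.ofReal (pairMassDens m (a * σ) z) ≤ ENNReal.ofReal B * J ^ 2 / ENNReal.ofReal A := by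
    intro a ha
    have h1 := h _ (testL2_mem_sobolev (d := n + 1) hs hσ ha (by omega) hα)
    set S := (ENNReal.ofReal ((a ^ (n + 1))⁻¹) * ENNReal.ofReal (a ^ j)) ^ 2 with hS
    have hR : ENNReal.ofReal (K * sobolevSq s α (testL2 hσ ha : L2 (n + 1))) ^ 2 =
        S * (ENNReal.ofReal B *
          (∫⁻ z : Space (n + 1), ENNReal.ofReal (massDens j (a * σ) z)) ^ 2) := by
      rw [sobolevSq_testL2 hs hσ ha (by omega) hα, ← mul_assoc K, ENNReal.ofReal_mul (by positivity),
        moment_testFn hσ ha hkj, hB, hS,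
        ENNReal.ofReal_pow (show 0 ≤ K * (2 * Real.pi) ^ k by positivity)]
      ring
    rw [← ENNReal.pow_le_pow_left_iff two_ne_zero, nullFormNorm_testL2 hn hs hσ ha hb,
      sharpForm_testFn hn hσ ha hb hm hmj, hR] at h1
    have hS0 : S ≠ 0 := by
      have h1 : 0 < (a ^ (n + 1))⁻¹ := by positivity
      have h2 : 0 < a ^ j := by positivity
      exact pow_ne_zero 2 (mul_ne_zero (by simpa using h1) (by simpa using h2))
    have hStop : S ≠ ∞ := by finiteness
    rw [ENNReal.le_div_iff_mul_le (Or.inl (by simpa using hA0)) (Or.inl ENNReal.ofReal_ne_top)]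
    refine le_trans ?_ (mul_le_mul_right (pow_le_pow_left' (massDens_le (d := n + 1) (by omega) j
      (a * σ)) 2) (ENNReal.ofReal B))
    rw [← ENNReal.mul_le_mul_iff_right hS0 hStop, hA, ENNReal.ofReal_mul (by positivity)]
    calc _ = _ := by ring
      _ ≤ _ := h1
  have hlim : Tendsto (fun i : ℕ => 1 / ((i : ℝ) + 1) * σ) atTop (𝓝 0) := by
    simpa using tendsto_one_div_add_atTop_nhds_zero_nat.mul_const σ
  -- A lower bound for the limit of the forms is all that is needed, so Fatou replaces a majorant
  -- for `pairMassDens`.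
  have hfatou : I ≤ ENNReal.ofReal B * J ^ 2 / ENNReal.ofReal A := by
    calc I = ∫⁻ z : Space (n + 1) × Space (n + 1), liminf (fun i : ℕ =>
          ENNReal.ofReal (pairMassDens m (1 / ((i : ℝ) + 1) * σ) z)) atTop := by
          refine lintegral_congr_ae ?_
          filter_upwards [ae_pairRad_zero_pos hn] with z hz
          exact (ENNReal.tendsto_ofReal (tendsto_pairMassDens m hz hlim)).liminf_eq.symm
      _ ≤ liminf (fun i : ℕ => ∫⁻ z : Space (n + 1) × Space (n + 1),
          ENNReal.ofReal (pairMassDens m (1 / ((i : ℝ) + 1) * σ) z)) atTop :=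
          lintegral_liminf_le fun i => by fun_prop
      _ ≤ liminf (fun _ : ℕ => ENNReal.ofReal B * J ^ 2 / ENNReal.ofReal A) atTop :=
          liminf_le_liminf (Eventually.of_forall fun i => hbound _ (by positivity))
      _ = _ := liminf_const _
  rw [ENNReal.le_div_iff_mul_le (Or.inl (by simpa using hA0)) (Or.inl ENNReal.ofReal_ne_top), ← hI,
    ← mul_assoc, mul_comm, ENNReal.mul_le_mul_iff_left hI0 hItop,
    show (k : ℝ≥0∞) = ENNReal.ofReal k by simp, ← ENNReal.ofReal_mul (by positivity),
    ENNReal.ofReal_le_ofReal_iff (by positivity), ← hc, hB, mul_pow K] at hfatou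
  have hk' : (0 : ℝ) < k := by exact_mod_cast hk
  exact le_of_mul_le_mul_right (le_of_mul_le_mul_right hfatou hk') (by positivity)

lemma rpow_half_le_of_le_sq {C K : ℝ} (hK : 0 ≤ K) (h : C ≤ K ^ 2) : C ^ (1 / 2 : ℝ) ≤ K := by
  rw [← Real.sqrt_eq_rpow]
  exact Real.sqrt_le_iff.2 ⟨hK, h⟩

theorem isOptimalConst_half (hn : 1 ≤ n) (hs : 0 < s) {b : ℝ} (hb : 2 * b + n = 2) :
    IsOptimalConst s (b / 2) (Sobolev (n + 1) s (1 / 2)) (sobolevSq s (1 / 2))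
      (constF (b / 2) (n + 1) ^ (1 / 2 : ℝ)) := by
  refine ⟨⟨Real.rpow_nonneg (constF_one_pos hn hb).le _, fun f hf =>
    (nullFormNorm_le_half hn hs hb hf).1⟩, fun K hK => ?_⟩
  refine rpow_half_le_of_le_sq hK.1 (constF_le_sq_of_bound hn hs (k := 1) (j := 1) (m := 1)
    (by linarith) (by norm_num) rfl hn (by rw [hb]; norm_num) rfl one_pos ?_ ?_ hK.1 hK.2)
  · rw [lintegral_pairMassDens_zero_one hn]
    simp
  · rw [← constF_one hn hb]
    simp

/-- Since `refinedRhs` is at most `sobolevSq`, optimality in the weaker H¹ estimate implies it in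
the refined one. Conversely the refined upper bound and its strictness imply those of the H¹
estimate. -/
lemma rpow_half_constF_le (hn : 1 ≤ n) (hs : 0 < s) {b : ℝ} (hb : 2 * b + n = 4) {K : ℝ} (hK : 0 ≤ K)
    (h : ∀ f ∈ Sobolev (n + 1) s 1, nullFormNorm s (b / 2) f ≤ ENNReal.ofReal (K * sobolevSq s 1 f)) :
    constF (b / 2) (n + 1) ^ (1 / 2 : ℝ) ≤ K := by
  refine rpow_half_le_of_le_sq hK (constF_le_sq_of_bound hn hs (k := 2) (j := 0) (m := 3)
    (by linarith) (by norm_num) rfl (Nat.zero_le _) (by rw [hb]; norm_num) rfl two_pos ?_ ?_ hK h)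
  · rw [← two_mul_lintegral_pairMassDens_zero_three hn]
    simp
  · rw [← pow_mul, show 2 * 2 = 4 from rfl, constF_two hn hb]
    push_cast
    ring

lemma ofReal_mul_refinedRhs_le {K : ℝ} (hK : 0 ≤ K) (f : L2 n) :
    ENNReal.ofReal (K * refinedRhs s f) ≤ ENNReal.ofReal (K * sobolevSq s 1 f) :=
  ENNReal.ofReal_le_ofReal (mul_le_mul_of_nonneg_left (refinedRhs_le_sobolevSq s f) hK)

theorem isOptimalConst_one (hn : 1 ≤ n) (hs : 0 < s) {b : ℝ} (hb : 2 * b + n = 4) :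
    IsOptimalConst s (b / 2) (Sobolev (n + 1) s 1) (sobolevSq s 1)
      (constF (b / 2) (n + 1) ^ (1 / 2 : ℝ)) :=
  have hC := Real.rpow_nonneg (constF_two_pos hn hb).le (1 / 2 : ℝ)
  ⟨⟨hC, fun _ hf => (nullFormNorm_le_refined hn hs hb hf).1.trans (ofReal_mul_refinedRhs_le hC _)⟩,
    fun _ hK => rpow_half_constF_le hn hs hb hK.1 hK.2⟩

theorem isOptimalConst_refined (hn : 1 ≤ n) (hs : 0 < s) {b : ℝ} (hb : 2 * b + n = 4) :
    IsOptimalConst s (b / 2) (Sobolev (n + 1) s 1) (refinedRhs s)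
      (constF (b / 2) (n + 1) ^ (1 / 2 : ℝ)) :=
  ⟨⟨Real.rpow_nonneg (constF_two_pos hn hb).le _, fun _ hf =>
    (nullFormNorm_le_refined hn hs hb hf).1⟩, fun _ hK => rpow_half_constF_le hn hs hb hK.1
      fun f hf => (hK.2 f hf).trans (ofReal_mul_refinedRhs_le hK.1 f)⟩

theorem noExtremiser_half (hn : 1 ≤ n) (hs : 0 < s) {b : ℝ} (hb : 2 * b + n = 2) :
    NoExtremiser s (b / 2) (Sobolev (n + 1) s (1 / 2)) (sobolevSq s (1 / 2))
      (constF (b / 2) (n + 1) ^ (1 / 2 : ℝ)) :=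
  fun _ hf h0 => ((nullFormNorm_le_half hn hs hb hf).2 h0).ne

theorem noExtremiser_refined (hn : 1 ≤ n) (hs : 0 < s) {b : ℝ} (hb : 2 * b + n = 4) :
    NoExtremiser s (b / 2) (Sobolev (n + 1) s 1) (refinedRhs s)
      (constF (b / 2) (n + 1) ^ (1 / 2 : ℝ)) :=
  fun _ hf h0 => ((nullFormNorm_le_refined hn hs hb hf).2 h0).ne

theorem noExtremiser_one (hn : 1 ≤ n) (hs : 0 < s) {b : ℝ} (hb : 2 * b + n = 4) :
    NoExtremiser s (b / 2) (Sobolev (n + 1) s 1) (sobolevSq s 1)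
      (constF (b / 2) (n + 1) ^ (1 / 2 : ℝ)) :=
  fun f hf h0 => (((nullFormNorm_le_refined hn hs hb hf).2 h0).trans_le
    (ofReal_mul_refinedRhs_le (Real.rpow_nonneg (constF_two_pos hn hb).le _) f)).ne

end Optimality

end

end KleinGordon

theorem mainTheorem2 (d : ℕ) (hd : 2 ≤ d) (s : ℝ) (hs : 0 < s) :
    (KleinGordon.IsOptimalConst s ((3 - (d : ℝ)) / 4) (KleinGordon.Sobolev d s (1 / 2))
        (KleinGordon.sobolevSq s (1 / 2)) (KleinGordon.constF ((3 - (d : ℝ)) / 4) d ^ (1 / 2 : ℝ)) ∧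
      KleinGordon.NoExtremiser s ((3 - (d : ℝ)) / 4) (KleinGordon.Sobolev d s (1 / 2))
        (KleinGordon.sobolevSq s (1 / 2)) (KleinGordon.constF ((3 - (d : ℝ)) / 4) d ^ (1 / 2 : ℝ))) ∧
    (KleinGordon.IsOptimalConst s ((5 - (d : ℝ)) / 4) (KleinGordon.Sobolev d s 1)
        (KleinGordon.sobolevSq s 1) (KleinGordon.constF ((5 - (d : ℝ)) / 4) d ^ (1 / 2 : ℝ)) ∧
      KleinGordon.NoExtremiser s ((5 - (d : ℝ)) / 4) (KleinGordon.Sobolev d s 1)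
        (KleinGordon.sobolevSq s 1) (KleinGordon.constF ((5 - (d : ℝ)) / 4) d ^ (1 / 2 : ℝ))) ∧
    (KleinGordon.IsOptimalConst s ((5 - (d : ℝ)) / 4) (KleinGordon.Sobolev d s 1)
        (KleinGordon.refinedRhs s) (KleinGordon.constF ((5 - (d : ℝ)) / 4) d ^ (1 / 2 : ℝ)) ∧
      KleinGordon.NoExtremiser s ((5 - (d : ℝ)) / 4) (KleinGordon.Sobolev d s 1)
        (KleinGordon.refinedRhs s) (KleinGordon.constF ((5 - (d : ℝ)) / 4) d ^ (1 / 2 : ℝ))) := by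
  obtain ⟨n, rfl⟩ : ∃ n, d = n + 1 := ⟨d - 1, by omega⟩
  have hn : 1 ≤ n := by omega
  -- The parameter is b = 2β with d = n + 1, so the two values of β correspond to 2b + n = 2 and 2b
  -- + n = 4.
  have hb1 : 2 * ((2 - (n : ℝ)) / 2) + n = 2 := by ring
  have hb2 : 2 * ((4 - (n : ℝ)) / 2) + n = 4 := by ring
  have e1 : (3 - ((n + 1 : ℕ) : ℝ)) / 4 = (2 - (n : ℝ)) / 2 / 2 := by
    push_cast
    ring
  have e2 : (5 - ((n + 1 : ℕ) : ℝ)) / 4 = (4 - (n : ℝ)) / 2 / 2 := by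
    push_cast
    ring
  rw [e1, e2]
  exact ⟨⟨KleinGordon.isOptimalConst_half hn hs hb1, KleinGordon.noExtremiser_half hn hs hb1⟩,
    ⟨KleinGordon.isOptimalConst_one hn hs hb2, KleinGordon.noExtremiser_one hn hs hb2⟩,
    KleinGordon.isOptimalConst_refined hn hs hb2, KleinGordon.noExtremiser_refined hn hs hb2⟩
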